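/- **Setting.** Let $0<\alpha<1$ and $T>0$. Let $H$ be a separable real Hilbert space and let $\phi:H\to\mathbb R$ be convex, lower semicontinuous and bounded below, with Fréchet subdifferential $$\partial\phi(u)=\Big\{\xi\in H:\ \liminf_{w\to u}\frac{\phi(w)-\phi(u)-\langle\xi,w-u\rangle}{\|w-u\|}\ge 0\Big\}.$$ Assume that whenever $v_n\to v$ strongly in $H$, every sequence $\xi_n\in\partial\phi(v_n)$ converges weakly to some $\xi\in H$. Let $u_0\in H$. **Strong solutions.** For $X\in L^1_{loc}([0,T);H)$ the generalized Caputo derivative with initial value $u_0$ is the distribution $D_c^\alpha X=g_{-\alpha}*\big((X-u_0)\theta\big)$ on $(-\infty,T)$, where $\theta$ is the Heaviside function and $g_{-\alpha}=\frac1{\Gamma(1-\alpha)}D(\theta(t)t^{-\alpha})$, with $D$ the distributional derivative. A function $u\in L^1_{loc}([0,T);H)$ is a strong solution of $$D_c^\alpha u\in-\partial\phi(u),\qquad u(0)=u_0$$ on $[0,T)$ if (i) $D_c^\alpha u$ is a locally integrable function on $[0,T)$; (ii) $\lim_{t\to0^+}\frac1t\int_0^t\|u(s)-u_0\|\,ds=0$;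 (iii) $D_c^\alpha u(t)\in-\partial\phi(u(t))$ for almost every $t\in[0,T)$. **Scheme.** Let $a_n=\frac{(n+1)^\alpha-n^\alpha}{\Gamma(1+\alpha)}$ for $n\ge0$, let $a^{(-1)}$ be its convolution inverse, so that $a*a^{(-1)}=(1,0,0,\dots)$, and put $c_0=a^{(-1)}_0$, $c_i=-a^{(-1)}_i$ for $i\ge1$, and $c_n^n=c_0-\sum_{i=1}^{n-1}c_i$. For an integer $N\ge1$ put $k=T/N$, $t_n=nk$, $U_0=u_0$, and for $n\ge1$ $$U_n=\operatorname*{argmin}_{v\in H}\ \Big(\frac1{2k^\alpha}\Big(\sum_{j=1}^{n-1}c_j\|v-U_{n-j}\|^2+c_n^n\|v-U_0\|^2\Big)+\phi(v)\Big).$$ **Theorem.** There is a strong solution $u$ on $[0,T)$, it is unique up to equality almost everywhere, and for every $N\ge1$ the minimizers $U_n$ exist and are unique. The continuous representative of $u$ (extended continuously to $[0,T]$) is Hölder continuous of order $\alpha/2$, and the numerical solutions converge to it. More precisely, there is a constant $C=C(\alpha,T)$, depending only on $\alpha$ and $T$, such that, with $E=\phi(u_0)-\inf_H\phi$, $$\|u(t)-u(s)\|\le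 C\sqrt{E}\,|t-s|^{\alpha/2}\quad\text{for all } s,t\in[0,T],$$ $$\sup_{n:\ nk\le T}\|U_n-u(t_n)\|\le C\sqrt{E}\,k^{\alpha/4}\quad\text{for every } k=T/N,\ N\ge1.$$ -/

import Mathlib

open Set Filter Topology MeasureTheory
open scoped ContDiff

namespace FracGradFlow

noncomputable section

section Continuous

variable {H : Type*} [NormedAddCommGroup H] [InnerProductSpace ℝ H]

/-- The Fréchet subdifferential `∂φ(u)`: all `ξ` with
`liminf_{w → u} (φ w - φ u - ⟨ξ, w - u⟩) / ‖w - u‖ ≥ 0`, the lower limit being taken over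
`w ≠ u` in the extended reals. -/
def subdiff (φ : H → ℝ) (u : H) : Set H :=
  {ξ | (0 : EReal) ≤
    liminf (fun w : H => (((φ w - φ u - inner ℝ ξ (w - u)) / ‖w - u‖ : ℝ) : EReal)) (𝓝[≠] u)}

/-- Strong-to-weak regularity of `∂φ`: whenever `v n → v` in norm, every sequence
`ξ n ∈ ∂φ (v n)` converges weakly to some element of `H`. -/
def StrongToWeak (φ : H → ℝ) : Prop :=
  ∀ (v : ℕ → H) (v' : H), Tendsto v atTop (𝓝 v') →
    ∀ ξ : ℕ → H, (∀ n, ξ n ∈ subdiff φ (v n)) →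
      ∃ ξ' : H, ∀ h : H, Tendsto (fun n => inner ℝ (ξ n) h) atTop (𝓝 (inner ℝ ξ' h))

/-- Test functions on `(-∞, T)`: smooth, with compact support contained in `(-∞, T)`. -/
def IsTest (T : ℝ) (ψ : ℝ → ℝ) : Prop :=
  ContDiff ℝ ∞ ψ ∧ HasCompactSupport ψ ∧ tsupport ψ ⊆ Iio T

/-- For `-1 < β < 0`, the action on `ψ` of the distribution
`g_β = (1 / Γ(1 + β)) D(θ(t) t ^ β)`, where `θ` is the Heaviside function and `D` is the
distributional derivative, `⟨D S, ψ⟩ = -⟨S, ψ'⟩`. -/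
def gDist (β : ℝ) (ψ : ℝ → ℝ) : ℝ :=
  (1 / Real.Gamma (1 + β)) * -(∫ t in Ioi (0 : ℝ), t ^ β * deriv ψ t)

/-- The generalized Caputo derivative of order `α` of `X` on `[0, T)` with initial value `X₀`:
the distribution `g_{-α} * ((X - X₀) θ)` on `(-∞, T)`, evaluated at the test function `ψ`.
The convolution of a distribution `S` with a locally integrable `Y` is
`⟨S * Y, ψ⟩ = ∫ ⟨S, ψ(· + s)⟩ Y(s) ds`. -/
def caputo (α T : ℝ) (X₀ : H) (X : ℝ → H) (ψ : ℝ → ℝ) : H :=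
  ∫ s in Ico 0 T, gDist (-α) (fun t => ψ (t + s)) • (X s - X₀)

/-- The generalized Caputo derivative of `X` is the locally integrable function `f` on `[0, T)`,
extended by zero to negative times. -/
def HasCaputo (α T : ℝ) (X₀ : H) (X f : ℝ → H) : Prop :=
  LocallyIntegrableOn f (Ico 0 T) ∧
    ∀ ψ : ℝ → ℝ, IsTest T ψ → caputo α T X₀ X ψ = ∫ t in Ico 0 T, ψ t • f t

/-- Strong solutions on `[0, T)` of `D_c^α u ∈ -∂φ(u)`, `u(0) = u₀`. -/
def IsStrongSolution (φ : H → ℝ) (α T : ℝ) (u₀ : H) (u : ℝ → H) : Prop :=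
  LocallyIntegrableOn u (Ico 0 T) ∧
  Tendsto (fun t : ℝ => (1 / t) * ∫ s in (0 : ℝ)..t, ‖u s - u₀‖) (𝓝[>] 0) (𝓝 0) ∧
  ∃ f : ℝ → H, HasCaputo α T u₀ u f ∧
    ∀ᵐ t ∂(volume.restrict (Ico 0 T)), -f t ∈ subdiff φ (u t)

end Continuous

section Discrete

/-- The weights `a_n = ((n + 1) ^ α - n ^ α) / Γ(1 + α)` of the discrete fractional integral. -/
def a (α : ℝ) (n : ℕ) : ℝ :=
  (((n : ℝ) + 1) ^ α - (n : ℝ) ^ α) / Real.Gamma (1 + α)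

/-- The convolution inverse of `a`, obtained as the inverse of its generating power series. -/
def aInv (α : ℝ) (n : ℕ) : ℝ :=
  PowerSeries.coeff n (PowerSeries.mk (a α))⁻¹

/-- Indeed `a * a^{(-1)} = (1, 0, 0, …)`. -/
theorem a_conv_aInv {α : ℝ} (hα : 0 < α) (n : ℕ) :
    ∑ p ∈ Finset.HasAntidiagonal.antidiagonal n, a α p.1 * aInv α p.2 = if n = 0 then 1 else 0 := by
  have h0 : PowerSeries.constantCoeff (PowerSeries.mk (a α)) ≠ 0 := by
    have : Real.Gamma (1 + α) ≠ 0 := (Real.Gamma_pos_of_pos (by linarith)).ne'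
    simp [← PowerSeries.coeff_zero_eq_constantCoeff_apply, a, Real.zero_rpow hα.ne', this]
  have h := congrArg (PowerSeries.coeff n) (PowerSeries.mul_inv_cancel _ h0)
  rw [PowerSeries.coeff_mul, PowerSeries.coeff_one] at h
  simpa [aInv] using h

/-- `c_0 = a^{(-1)}_0` and `c_i = -a^{(-1)}_i` for `i ≥ 1`. -/
def c (α : ℝ) (i : ℕ) : ℝ := if i = 0 then aInv α 0 else -aInv α i

/-- `c_n^n = c_0 - ∑_{i=1}^{n-1} c_i`. -/
def cc (α : ℝ) (n : ℕ) : ℝ := c α 0 - ∑ i ∈ Finset.Ico 1 n, c α i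

variable {H : Type*} [NormedAddCommGroup H]

/-- The functional minimized at step `n` of the scheme with time step `k`. -/
def stepFunctional (φ : H → ℝ) (α k : ℝ) (U : ℕ → H) (n : ℕ) (v : H) : ℝ :=
  1 / (2 * k ^ α) *
    ((∑ j ∈ Finset.Ico 1 n, c α j * ‖v - U (n - j)‖ ^ 2) + cc α n * ‖v - U 0‖ ^ 2) + φ v

/-- `U` is a numerical solution with time step `k` and initial value `u₀`: `U 0 = u₀` and, for
every `n ≥ 1`, `U n` minimizes the step functional, which involves `U 0, …, U (n - 1)` only. -/
def IsScheme (φ : H → ℝ) (α k : ℝ) (u₀ : H) (U : ℕ → H) : Prop :=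
  U 0 = u₀ ∧ ∀ n : ℕ, 1 ≤ n → IsMinOn (stepFunctional φ α k U n) univ (U n)

end Discrete

end

end FracGradFlow

/-! Up to sign, the equation says `u = u₀ - J η` with `η ∈ ∂φ(u)`, where `J = fracInt α` is the
Riemann-Liouville integral, and the scheme is the same equation with `J` replaced by discrete
convolution with the weights `a`. Everything rests on one convexity principle: if `z` is a
fractional integral of `F` and `h` is convex, then `h(z) ≤ h(z 0) + J⟨∇h(z), F⟩`. Discretely
(`discrete_convexity`) this holds because the inverse weights `aInv` have signs `+, -, -, …` with
nonnegative partial sums (Kaluza's theorem, from the log-convexity of `a`). The continuous version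
is needed only for the squared norm (`ae_norm_sq_le_fracInt`). It is derived from the discrete one
by approximating `J` in `L¹` by combinations of translations, which are exact discrete convolutions
along every shifted grid.

Applied to `φ` along the scheme, the principle bounds `J(‖ξ‖²)` for the subgradients `ξ` in terms of
`E = φ(u₀) - inf φ`. Cauchy-Schwarz against differences of kernels then gives Hölder continuity of
order `α/2` for the interpolants, uniformly in the step. For two steps `k`, `k'`, monotonicity of
`∂φ` and the squared-norm principle give `‖z‖² ≤ 2 J δ` for the difference `z` of the interpolants.
Here `δ` is the interpolation error, of size `√E (k^(α/2) + k'^(α/2))`, times the norms of the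
subgradients, whose fractional integral is of size `√E`. The square root turns `α/2` into the rate
`α/4`.

Hence the interpolants converge. Strong-to-weak regularity makes the subgradients converge weakly at
every time and, by compactness, stay bounded, so the limit solves the integral equation with `η ∈
∂φ(u)` (`exists_limit_solution`). The distributional Caputo derivative is matched with `J` by
duality with right-sided integrals (`hasCaputo_of_eq_fracInt`, `HasCaputo.ae_eq_fracInt`).
Uniqueness is the squared-norm principle with `δ = 0`. -/

namespace FracGradFlow

/-! ### Signs and inversion of the convolution weights. -/

section Weights

variable {α : ℝ}

theorem a_pos (hα : 0 < α) (n : ℕ) : 0 < a α n := by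
  have hG : 0 < Real.Gamma (1 + α) := Real.Gamma_pos_of_pos (by linarith)
  refine div_pos (sub_pos.2 ?_) hG
  exact Real.rpow_lt_rpow (by positivity) (by linarith) hα

/-- The ratio of consecutive weights is `(1 + 1 / x) ^ (α - 1)` for some `x` between `n` and
`n + 1`. -/
theorem exists_a_succ_eq (hα : 0 < α) (n : ℕ) :
    ∃ x ∈ Ioo (n : ℝ) (n + 1), a α (n + 1) = (1 + 1 / x) ^ (α - 1) * a α n := by
  have hd : ∀ x ∈ Ioo (n : ℝ) (n + 1),
      HasDerivAt (fun y : ℝ => (y + 1) ^ α) (α * (x + 1) ^ (α - 1)) x := by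
    intro x hx
    have hx0 : 0 < x := lt_of_le_of_lt (Nat.cast_nonneg n) hx.1
    have := ((hasDerivAt_id x).add_const 1).rpow_const (p := α) (Or.inl (by simp; linarith))
    simpa using this
  have hd' : ∀ x ∈ Ioo (n : ℝ) (n + 1),
      HasDerivAt (fun y : ℝ => y ^ α) (α * x ^ (α - 1)) x := by
    intro x hx
    have hx0 : 0 < x := lt_of_le_of_lt (Nat.cast_nonneg n) hx.1
    exact Real.hasDerivAt_rpow_const (Or.inl hx0.ne')
  obtain ⟨x, hx, h⟩ := exists_ratio_hasDerivAt_eq_ratio_slope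
    (fun y : ℝ => (y + 1) ^ α) (fun x => α * (x + 1) ^ (α - 1))
    (a := (n : ℝ)) (b := n + 1) (by linarith)
    (Continuous.continuousOn (by
      exact (continuous_id.add continuous_const).rpow_const fun _ => Or.inr hα.le)) hd
    (fun y : ℝ => y ^ α) (fun x => α * x ^ (α - 1))
    (Continuous.continuousOn (continuous_id.rpow_const fun _ => Or.inr hα.le)) hd'
  have hx0 : 0 < x := lt_of_le_of_lt (Nat.cast_nonneg n) hx.1
  refine ⟨x, hx, ?_⟩
  have h1 : (1 + 1 / x) ^ (α - 1) = (x + 1) ^ (α - 1) / x ^ (α - 1) := by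
    rw [← Real.div_rpow (by linarith) hx0.le]
    congr 1
    field_simp
  have hp : 0 < x ^ (α - 1) := Real.rpow_pos_of_pos hx0 _
  rw [h1]
  simp only [a]
  push_cast
  field_simp
  have h2 := mul_left_cancel₀ hα.ne' (by linear_combination h :
    α * ((((n : ℝ) + 1) ^ α - n ^ α) * (x + 1) ^ (α - 1)) =
      α * ((((n : ℝ) + 1 + 1) ^ α - (n + 1) ^ α) * x ^ (α - 1)))
  linear_combination -h2

theorem a_succ_le (hα : 0 < α) (hα₁ : α < 1) (n : ℕ) : a α (n + 1) ≤ a α n := by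
  obtain ⟨x, hx, h⟩ := exists_a_succ_eq hα n
  have hx0 : 0 < x := lt_of_le_of_lt (Nat.cast_nonneg n) hx.1
  rw [h]
  refine mul_le_of_le_one_left (a_pos hα n).le ?_
  exact Real.rpow_le_one_of_one_le_of_nonpos (by have := one_div_pos.2 hx0; linarith) (by linarith)

/-- Log-convexity of the weights, the hypothesis of Kaluza's theorem. The mean-value points of
successive ratios lie in successive intervals, and `(1 + 1 / x) ^ (α - 1)` increases with `x`
because the exponent is negative. -/
theorem a_sq_le (hα : 0 < α) (hα₁ : α < 1) (n : ℕ) :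
    a α (n + 1) / a α n ≤ a α (n + 2) / a α (n + 1) := by
  obtain ⟨x, hx, h⟩ := exists_a_succ_eq hα n
  obtain ⟨y, hy, h'⟩ := exists_a_succ_eq hα (n + 1)
  have hx0 : 0 < x := lt_of_le_of_lt (Nat.cast_nonneg n) hx.1
  have hxy : x < y := by have := hy.1; have := hx.2; push_cast at *; linarith
  rw [show n + 2 = n + 1 + 1 from rfl, h', mul_div_assoc, div_self (a_pos hα _).ne', h,
    mul_div_assoc, div_self (a_pos hα _).ne', mul_one, mul_one]
  have hy0 := hx0.trans hxy
  refine Real.rpow_le_rpow_of_nonpos (by positivity) ?_ (by linarith)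
  have := one_div_le_one_div_of_le hx0 hxy.le
  linarith

theorem a_ratio_mono (hα : 0 < α) (hα₁ : α < 1) : Monotone fun n => a α (n + 1) / a α n :=
  monotone_nat_of_le_succ fun n => a_sq_le hα hα₁ n

theorem sum_a_mul_aInv (hα : 0 < α) (n : ℕ) :
    ∑ i ∈ Finset.range (n + 1), aInv α i * a α (n - i) = if n = 0 then 1 else 0 := by
  rw [← a_conv_aInv hα n, Finset.Nat.sum_antidiagonal_eq_sum_range_succ (fun i j => a α i * aInv α j),
    ← Finset.sum_range_reflect]
  refine Finset.sum_congr rfl fun i hi => ?_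
  have : i ≤ n := by simpa [Nat.lt_succ_iff] using hi
  rw [mul_comm]
  congr 2; simp; omega

theorem aInv_zero_pos (hα : 0 < α) : 0 < aInv α 0 := by
  have h := sum_a_mul_aInv hα 0
  simp at h
  have h0 := a_pos hα 0
  by_contra hn
  nlinarith

/-- Kaluza's theorem for the weights `a`: the coefficients of the inverse series have the signs
`+, -, -, …`. -/
theorem aInv_succ_nonpos (hα : 0 < α) (hα₁ : α < 1) (n : ℕ) : aInv α (n + 1) ≤ 0 := by
  induction n using Nat.strong_induction_on with
  | _ n ih =>
    have h1 := sum_a_mul_aInv hα (n + 1)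
    have h0 := sum_a_mul_aInv hα n
    rw [Finset.sum_range_succ', Finset.sum_range_succ] at h1
    rw [Finset.sum_range_succ'] at h0
    simp only [Nat.sub_zero, Nat.sub_self, Nat.add_sub_add_right, Nat.succ_ne_zero, if_false] at h0 h1
    set r := a α (n + 1) / a α n with hr
    have han := a_pos hα n
    have hr' : a α (n + 1) = r * a α n := by rw [hr]; field_simp
    -- Subtracting `r` times the convolution identity at `n` from the one at `n + 1` cancels the
    -- terms with `aInv α 0`. The remaining earlier terms have a nonnegative sum, since the ratios
    -- of `a` increase and the earlier `aInv` are nonpositive; this forces the sign of the last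
    -- term.
    have hkey : r * ∑ i ∈ Finset.range n, aInv α (i + 1) * a α (n - (i + 1)) ≤
        ∑ i ∈ Finset.range n, aInv α (i + 1) * a α (n - i) := by
      rw [Finset.mul_sum]
      refine Finset.sum_le_sum fun i hi => ?_
      have hin := Finset.mem_range.1 hi
      have hm := a_ratio_mono hα hα₁ (show n - (i + 1) ≤ n by omega)
      simp only at hm
      rw [← hr, show n - (i + 1) + 1 = n - i by omega, div_le_iff₀ (a_pos hα _)] at hm
      nlinarith [ih i hin]
    have ha0 := a_pos hα 0
    have hr0 : 0 ≤ r := div_nonneg (a_pos hα _).le han.le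
    have hif : (0 : ℝ) ≤ if n = 0 then 1 else 0 := by split_ifs <;> norm_num
    have : aInv α (n + 1) * a α 0 ≤ 0 := by
      rw [hr'] at h1
      rw [← h0] at hif
      nlinarith [mul_nonneg hr0 hif]
    by_contra hn
    nlinarith

theorem c_zero : c α 0 = aInv α 0 := by simp [c]

theorem c_succ (n : ℕ) : c α (n + 1) = -aInv α (n + 1) := by simp [c]

theorem c_nonneg (hα : 0 < α) (hα₁ : α < 1) (n : ℕ) : 0 ≤ c α n := by
  cases n with
  | zero => rw [c_zero]; exact (aInv_zero_pos hα).le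
  | succ n => rw [c_succ]; linarith [aInv_succ_nonpos hα hα₁ n]

theorem cc_succ (n : ℕ) : cc α (n + 1) = ∑ i ∈ Finset.range (n + 1), aInv α i := by
  rw [cc, c_zero, Finset.sum_Ico_eq_sum_range, Finset.sum_range_succ', Nat.add_sub_cancel]
  simp only [add_comm 1, c_succ, Finset.sum_neg_distrib]
  ring

/-- The `cc` are the partial sums of `aInv`, so convolving them with `a` yields the partial sums of
`(1, 0, 0, …)`. -/
theorem sum_a_mul_cc (hα : 0 < α) (n : ℕ) :
    ∑ i ∈ Finset.range (n + 1), a α (n - i) * cc α (i + 1) = 1 := by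
  induction n with
  | zero => simpa [cc_succ, mul_comm] using sum_a_mul_aInv hα 0
  | succ n ih =>
    have h := sum_a_mul_aInv hα (n + 1)
    simp only [Nat.succ_ne_zero, if_false] at h
    rw [Finset.sum_range_succ'] at h ⊢
    have hcc : ∀ i : ℕ, cc α (i + 1 + 1) = cc α (i + 1) + aInv α (i + 1) := fun i => by
      rw [cc_succ, Finset.sum_range_succ, ← cc_succ]
    simp only [hcc, mul_add, Finset.sum_add_distrib, Nat.add_sub_add_right, ih]
    have h1 : cc α (0 + 1) = aInv α 0 := by simp [cc_succ]
    rw [h1]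
    simp only [Nat.add_sub_add_right] at h
    simp only [mul_comm (a α _) (aInv α _)]
    linarith

/-- The identity `a * cc = 1` is compared at `n` and `n + 1`: as `a` decreases, the older terms
contribute no more than before, so the new term must make up a nonnegative deficit. -/
theorem cc_succ_nonneg (hα : 0 < α) (hα₁ : α < 1) (n : ℕ) : 0 ≤ cc α (n + 1) := by
  induction n using Nat.strong_induction_on with
  | _ n ih =>
    have ha0 := a_pos hα 0
    cases n with
    | zero => rw [cc_succ]; simpa using (aInv_zero_pos hα).le
    | succ n =>
      have h0 := sum_a_mul_cc hα n
      have h1 := sum_a_mul_cc hα (n + 1)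
      rw [Finset.sum_range_succ] at h1
      have hle : ∑ i ∈ Finset.range (n + 1), a α (n + 1 - i) * cc α (i + 1) ≤
          ∑ i ∈ Finset.range (n + 1), a α (n - i) * cc α (i + 1) := by
        refine Finset.sum_le_sum fun i hi => ?_
        have hin := Finset.mem_range.1 hi
        rw [show n + 1 - i = n - i + 1 by omega]
        exact mul_le_mul_of_nonneg_right (a_succ_le hα hα₁ _) (ih i hin)
      simp only [Nat.sub_self] at h1
      by_contra hn
      nlinarith

variable {E : Type*} [AddCommGroup E] [Module ℝ E]

/-- Associativity of discrete convolution. -/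
theorem sum_conv_assoc (x y : ℕ → ℝ) (F : ℕ → E) (n : ℕ) :
    ∑ i ∈ Finset.range (n + 1), x i • ∑ j ∈ Finset.range (n - i + 1), y (n - i - j) • F j =
      ∑ j ∈ Finset.range (n + 1),
        (∑ i ∈ Finset.range (n - j + 1), x i * y (n - j - i)) • F j := by
  simp only [Finset.smul_sum, Finset.sum_smul, smul_smul]
  rw [Finset.sum_sigma', Finset.sum_sigma']
  refine Finset.sum_bij' (fun p _ => ⟨p.2, p.1⟩) (fun p _ => ⟨p.2, p.1⟩) ?_ ?_ ?_ ?_ ?_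
  · rintro ⟨i, j⟩ h
    simp only [Finset.mem_sigma, Finset.mem_range] at h ⊢
    omega
  · rintro ⟨i, j⟩ h
    simp only [Finset.mem_sigma, Finset.mem_range] at h ⊢
    omega
  · intros; rfl
  · intros; rfl
  · rintro ⟨i, j⟩ h
    simp only [Finset.mem_sigma, Finset.mem_range] at h ⊢
    rw [show n - i - j = n - j - i by omega]

theorem conv_a_conv_aInv (hα : 0 < α) (F : ℕ → E) (n : ℕ) :
    ∑ i ∈ Finset.range (n + 1), a α i • ∑ j ∈ Finset.range (n - i + 1), aInv α (n - i - j) • F j =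
      F n := by
  rw [sum_conv_assoc, Finset.sum_range_succ]
  rw [Finset.sum_eq_zero]
  · have := sum_a_mul_aInv hα 0
    simp at this
    simp [mul_comm (a α 0), this]
  · intro j hj
    have hj := Finset.mem_range.1 hj
    have h := sum_a_mul_aInv hα (n - j)
    rw [if_neg (by omega), ← Finset.sum_range_reflect] at h
    rw [← zero_smul ℝ (F j), ← h]
    congr 1
    refine Finset.sum_congr rfl fun i hi => ?_
    have hi := Finset.mem_range.1 hi
    rw [mul_comm]
    congr 2
    omega

theorem conv_aInv_conv_a (hα : 0 < α) (F : ℕ → E) (n : ℕ) :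
    ∑ i ∈ Finset.range (n + 1), aInv α i • ∑ j ∈ Finset.range (n - i + 1), a α (n - i - j) • F j =
      F n := by
  rw [sum_conv_assoc, Finset.sum_range_succ]
  rw [Finset.sum_eq_zero]
  · have := sum_a_mul_aInv hα 0
    simp at this
    simp [this]
  · intro j hj
    have hj := Finset.mem_range.1 hj
    have h := sum_a_mul_aInv hα (n - j)
    rw [if_neg (by omega)] at h
    rw [h, zero_smul]

/-- The discrete Caputo derivative written with the weights of the scheme. -/
theorem sum_aInv_sub (z : ℕ → E) (n : ℕ) :
    ∑ i ∈ Finset.range (n + 1), aInv α i • (z (n + 1 - i) - z 0) =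
      (∑ i ∈ Finset.Ico 1 (n + 1), c α i • (z (n + 1) - z (n + 1 - i))) +
        cc α (n + 1) • (z (n + 1) - z 0) := by
  rw [cc_succ, Finset.sum_Ico_eq_sum_range, Nat.add_sub_cancel, Finset.sum_range_succ',
    Finset.sum_range_succ']
  simp only [add_comm 1, c_succ, add_smul, Finset.sum_smul, Nat.sub_zero]
  rw [← add_assoc, ← Finset.sum_add_distrib]
  congr 1
  refine Finset.sum_congr rfl fun i _ => ?_
  module

end Weights

/-! ### The discrete convexity principle. -/

section Convexity

variable {α : ℝ} {H : Type*} [NormedAddCommGroup H] [InnerProductSpace ℝ H]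

/-- The convexity inequality for the discrete fractional integral. -/
theorem discrete_convexity (hα : 0 < α) (hα₁ : α < 1) {z F p : ℕ → H} {Φ : ℕ → ℝ}
    (hz : ∀ n, z n = z 0 + ∑ j ∈ Finset.range n, a α (n - 1 - j) • F j)
    (hp : ∀ n m, Φ (n + 1) + inner ℝ (p (n + 1)) (z m - z (n + 1)) ≤ Φ m) (n : ℕ) :
    Φ n ≤ Φ 0 + ∑ j ∈ Finset.range n, a α (n - 1 - j) * inner ℝ (p (j + 1)) (F j) := by
  have hF : ∀ n, F n = ∑ i ∈ Finset.range (n + 1), aInv α i • (z (n + 1 - i) - z 0) := by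
    intro n
    rw [← conv_aInv_conv_a hα F n]
    refine Finset.sum_congr rfl fun i hi => ?_
    have hi := Finset.mem_range.1 hi
    rw [hz (n + 1 - i), add_sub_cancel_left, show n + 1 - i = n - i + 1 by omega]
    simp
  -- By `hF`, `F` is the discrete Caputo derivative of `z`. Written with differences from the newest
  -- value, all its weights `c`, `cc` are nonnegative, so the subgradient inequality may be applied
  -- to each difference.
  have hle : ∀ n, ∑ i ∈ Finset.range (n + 1), aInv α i • (Φ (n + 1 - i) - Φ 0) ≤
      inner ℝ (p (n + 1)) (F n) := by
    intro n
    rw [hF, sum_aInv_sub, sum_aInv_sub, inner_add_right, inner_sum]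
    have key : ∀ m, Φ (n + 1) - Φ m ≤ inner ℝ (p (n + 1)) (z (n + 1) - z m) := by
      intro m
      have := hp n m
      rw [← neg_sub (z (n + 1)) (z m), inner_neg_right] at this
      linarith
    refine add_le_add (Finset.sum_le_sum fun i _ => ?_) ?_
    · rw [inner_smul_right, smul_eq_mul]
      exact mul_le_mul_of_nonneg_left (key _) (c_nonneg hα hα₁ i)
    · rw [inner_smul_right, smul_eq_mul]
      exact mul_le_mul_of_nonneg_left (key _) (cc_succ_nonneg hα hα₁ n)
  cases n with
  | zero => simp
  | succ n =>
    -- Convolution with the positive weights `a` preserves `hle` and inverts the discrete derivative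
    -- on its left side.
    have h1 := conv_a_conv_aInv hα (fun n => Φ (n + 1) - Φ 0) n
    have h2 : Φ (n + 1) - Φ 0 ≤
        ∑ i ∈ Finset.range (n + 1), a α i * inner ℝ (p (n - i + 1)) (F (n - i)) := by
      rw [← h1]
      refine Finset.sum_le_sum fun i hi => ?_
      rw [smul_eq_mul]
      refine mul_le_mul_of_nonneg_left ?_ (a_pos hα i).le
      refine le_trans (le_of_eq ?_) (hle (n - i))
      rw [← Finset.sum_range_reflect]
      refine Finset.sum_congr rfl fun j hj => ?_
      have hj := Finset.mem_range.1 hj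
      congr 3 <;> omega
    rw [← Finset.sum_range_reflect] at h2
    have h3 : ∀ j ∈ Finset.range (n + 1), a α (n + 1 - 1 - j) *
        inner ℝ (p (n - (n + 1 - 1 - j) + 1)) (F (n - (n + 1 - 1 - j))) =
        a α (n + 1 - 1 - j) * inner ℝ (p (j + 1)) (F j) := by
      intro j hj
      have hj := Finset.mem_range.1 hj
      rw [show n - (n + 1 - 1 - j) = j by omega]
    rw [Finset.sum_congr rfl h3] at h2
    linarith

end Convexity

/-! ### The fractional kernel and its integrals. -/

section Kernel

/-- The kernel `θ(r) r ^ (α - 1) / Γ(α)` of the fractional integral. -/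
noncomputable def kern (α r : ℝ) : ℝ := if 0 < r then r ^ (α - 1) / Real.Gamma α else 0

variable {α : ℝ}

theorem kern_of_pos {r : ℝ} (hr : 0 < r) : kern α r = r ^ (α - 1) / Real.Gamma α := if_pos hr

theorem kern_of_nonpos {r : ℝ} (hr : r ≤ 0) : kern α r = 0 := if_neg hr.not_gt

theorem kern_nonneg (hα : 0 < α) (r : ℝ) : 0 ≤ kern α r := by
  unfold kern
  have := Real.Gamma_pos_of_pos hα
  split_ifs <;> positivity

@[fun_prop]
theorem measurable_kern : Measurable (kern α) :=
  Measurable.ite measurableSet_Ioi (by fun_prop) measurable_const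

theorem kern_anti (hα : 0 < α) (hα₁ : α < 1) {x y : ℝ} (hx : 0 < x) (hxy : x ≤ y) :
    kern α y ≤ kern α x := by
  rw [kern_of_pos hx, kern_of_pos (hx.trans_le hxy)]
  have := Real.Gamma_pos_of_pos hα
  gcongr ?_ / _
  exact Real.rpow_le_rpow_of_nonpos hx hxy (by linarith)

theorem intervalIntegrable_kern_zero (hα : 0 < α) (x : ℝ) :
    IntervalIntegrable (kern α) volume 0 x := by
  rcases le_total x 0 with hx | hx
  · refine IntervalIntegrable.symm ?_
    rw [intervalIntegrable_iff_integrableOn_Ioc_of_le hx]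
    exact (integrableOn_zero).congr_fun (fun r hr => (kern_of_nonpos hr.2).symm) measurableSet_Ioc
  · have h : IntervalIntegrable (fun r : ℝ => r ^ (α - 1) / Real.Gamma α) volume 0 x :=
      (intervalIntegral.intervalIntegrable_rpow' (by linarith)).div_const _
    rw [intervalIntegrable_iff_integrableOn_Ioc_of_le hx] at h ⊢
    exact h.congr_fun (fun r hr => (kern_of_pos hr.1).symm) measurableSet_Ioc

theorem intervalIntegrable_kern (hα : 0 < α) (x y : ℝ) :
    IntervalIntegrable (kern α) volume x y :=
  (intervalIntegrable_kern_zero hα x).symm.trans (intervalIntegrable_kern_zero hα y)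

theorem Gamma_one_add (hα : 0 < α) : Real.Gamma (1 + α) = α * Real.Gamma α := by
  rw [add_comm, Real.Gamma_add_one hα.ne']

theorem Gamma_one_add_pos (hα : 0 < α) : 0 < Real.Gamma (1 + α) :=
  Real.Gamma_pos_of_pos (by linarith)

theorem integral_kern (hα : 0 < α) {x y : ℝ} (hx : 0 ≤ x) (hxy : x ≤ y) :
    ∫ r in x..y, kern α r = (y ^ α - x ^ α) / Real.Gamma (1 + α) := by
  have h : ∫ r in x..y, kern α r = ∫ r in x..y, r ^ (α - 1) / Real.Gamma α := by
    rw [intervalIntegral.integral_of_le hxy, intervalIntegral.integral_of_le hxy]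
    exact setIntegral_congr_fun measurableSet_Ioc fun r hr => kern_of_pos (hx.trans_lt hr.1)
  rw [h, intervalIntegral.integral_div, integral_rpow (Or.inl (by linarith)), Gamma_one_add hα]
  have := (Real.Gamma_pos_of_pos hα).ne'
  simp only [sub_add_cancel]
  field_simp

theorem intervalIntegrable_kern_sub (hα : 0 < α) (t x y : ℝ) :
    IntervalIntegrable (fun s => kern α (t - s)) volume x y := by
  simpa using (intervalIntegrable_kern hα (t - x) (t - y)).comp_sub_left t

theorem integral_kern_sub (hα : 0 < α) {t x y : ℝ} (hxy : x ≤ y) (hy : y ≤ t) :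
    ∫ s in x..y, kern α (t - s) = ((t - x) ^ α - (t - y) ^ α) / Real.Gamma (1 + α) := by
  rw [intervalIntegral.integral_comp_sub_left (fun s => kern α s) t,
    integral_kern hα (by linarith) (by linarith)]

theorem kern_sub_eq_indicator (t x : ℝ) :
    (Ioi x).indicator (fun s => kern α (t - s)) = (Ioc x t).indicator (fun s => kern α (t - s)) := by
  ext s
  by_cases hs : x < s <;> by_cases hst : s ≤ t <;> simp [hs, hst, indicator]
  exact kern_of_nonpos (by linarith)

theorem integrableOn_kern_sub (hα : 0 < α) (t x : ℝ) :
    IntegrableOn (fun s => kern α (t - s)) (Ioi x) := by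
  rw [← integrable_indicator_iff measurableSet_Ioi, kern_sub_eq_indicator,
    integrable_indicator_iff measurableSet_Ioc]
  rcases le_total x t with h | h
  · exact (intervalIntegrable_iff_integrableOn_Ioc_of_le h).1 (intervalIntegrable_kern_sub hα _ _ _)
  · simp [Ioc_eq_empty_of_le h]

theorem setIntegral_kern_sub (hα : 0 < α) {t x : ℝ} (hx : x ≤ t) :
    ∫ s in Ioi x, kern α (t - s) = (t - x) ^ α / Real.Gamma (1 + α) := by
  rw [← integral_indicator measurableSet_Ioi, kern_sub_eq_indicator,
    integral_indicator measurableSet_Ioc, ← intervalIntegral.integral_of_le hx,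
    integral_kern_sub hα hx le_rfl, sub_self, Real.zero_rpow hα.ne', sub_zero]

end Kernel

/-- The Cauchy-Schwarz inequality for a weight `w`. -/
theorem integral_weight_mul_le {X : Type*} [MeasurableSpace X] {μ : Measure X} {w G : X → ℝ}
    {W K : ℝ} (hw0 : ∀ x, 0 ≤ w x) (hG0 : ∀ x, 0 ≤ G x) (hG : AEStronglyMeasurable G μ)
    (hw : Integrable w μ) (hwG : Integrable (fun x => w x * G x ^ 2) μ)
    (hW : ∫ x, w x ∂μ ≤ W) (hK : ∫ x, w x * G x ^ 2 ∂μ ≤ K) :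
    Integrable (fun x => w x * G x) μ ∧ ∫ x, w x * G x ∂μ ≤ √W * √K := by
  have hW0 : 0 ≤ W := (integral_nonneg hw0).trans hW
  have hK0 : 0 ≤ K := (integral_nonneg fun x => mul_nonneg (hw0 x) (sq_nonneg _)).trans hK
  have hpt : ∀ l : ℝ, 0 < l → ∀ x, w x * G x ≤ l / 2 * w x + 1 / (2 * l) * (w x * G x ^ 2) := by
    intro l hl x
    have : l / 2 * w x + 1 / (2 * l) * (w x * G x ^ 2) - w x * G x =
        w x * ((l - G x) ^ 2 / (2 * l)) := by field_simp; ring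
    have h2 : 0 ≤ w x * ((l - G x) ^ 2 / (2 * l)) := mul_nonneg (hw0 x) (by positivity)
    linarith
  have hint : Integrable (fun x => w x * G x) μ := by
    refine ((hw.const_mul (1 / 2)).add (hwG.const_mul (1 / (2 * 1)))).mono'
      (hw.aestronglyMeasurable.mul hG) (Eventually.of_forall fun x => ?_)
    rw [Real.norm_of_nonneg (mul_nonneg (hw0 x) (hG0 x))]
    exact hpt 1 one_pos x
  refine ⟨hint, ?_⟩
  have hle : ∀ l : ℝ, 0 < l → ∫ x, w x * G x ∂μ ≤ l / 2 * W + 1 / (2 * l) * K := by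
    intro l hl
    have h1 := integral_mono hint ((hw.const_mul (l / 2)).add (hwG.const_mul (1 / (2 * l))))
      (hpt l hl)
    simp only [Pi.add_apply] at h1
    rw [integral_add (hw.const_mul _) (hwG.const_mul _), integral_const_mul,
      integral_const_mul] at h1
    refine h1.trans ?_
    gcongr
  -- The optimal parameter `l = √K / √W` degenerates when `W` or `K` vanishes, hence the
  -- perturbation by `e`.
  have hlim : Tendsto (fun e : ℝ => √(W + e) * √(K + e)) (𝓝[>] 0) (𝓝 (√(W + 0) * √(K + 0))) := by
    have : Continuous fun e : ℝ => √(W + e) * √(K + e) := by fun_prop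
    exact (this.tendsto 0).mono_left nhdsWithin_le_nhds
  rw [add_zero, add_zero] at hlim
  refine ge_of_tendsto hlim ?_
  filter_upwards [self_mem_nhdsWithin] with e (he : 0 < e)
  have hp : 0 < √(W + e) := Real.sqrt_pos.2 (by linarith)
  have hq : 0 < √(K + e) := Real.sqrt_pos.2 (by linarith)
  refine (hle (√(K + e) / √(W + e)) (by positivity)).trans ?_
  have h1 : √(K + e) / √(W + e) / 2 * W ≤ √(K + e) / √(W + e) / 2 * √(W + e) ^ 2 := by
    rw [Real.sq_sqrt (by linarith)]
    gcongr
    linarith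
  have h2 : 1 / (2 * (√(K + e) / √(W + e))) * K ≤
      1 / (2 * (√(K + e) / √(W + e))) * √(K + e) ^ 2 := by
    rw [Real.sq_sqrt (by linarith)]
    gcongr
    linarith
  refine (add_le_add h1 h2).trans (le_of_eq ?_)
  field_simp
  ring

/-- The function equal to `F n` on `((n - 1) k, n k]`. -/
noncomputable def stepFun {E : Type*} (k : ℝ) (F : ℕ → E) (s : ℝ) : E := F ⌈s / k⌉₊

theorem stronglyMeasurable_stepFun {E : Type*} [TopologicalSpace E] (k : ℝ) (F : ℕ → E) : StronglyMeasurable (stepFun k F) := by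
  have h : StronglyMeasurable F := StronglyMeasurable.of_discrete
  exact h.comp_measurable (Nat.measurable_ceil.comp (by fun_prop : Measurable fun s : ℝ => s / k))

theorem stepFun_apply {E : Type*} {k s : ℝ} (hk : 0 < k) (F : ℕ → E) {n : ℕ} (h1 : n * k < s)
    (h2 : s ≤ (n + 1) * k) : stepFun k F s = F (n + 1) := by
  unfold stepFun
  congr 1
  rw [Nat.ceil_eq_iff (by omega)]
  constructor
  · rw [lt_div_iff₀ hk]; simpa using h1
  · rw [div_le_iff₀ hk]; push_cast; exact h2

theorem exists_mem_cell {k s : ℝ} (hk : 0 < k) (hs : 0 < s) :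
    ∃ n : ℕ, n * k < s ∧ s ≤ (n + 1) * k := by
  have h1 : 0 < ⌈s / k⌉₊ := Nat.ceil_pos.2 (by positivity)
  refine ⟨⌈s / k⌉₊ - 1, ?_, ?_⟩
  · rw [← lt_div_iff₀ hk, ← Nat.lt_ceil]; omega
  · rw [← div_le_iff₀ hk]
    have := Nat.le_ceil (s / k)
    rw [Nat.cast_sub (by omega)]
    simpa using this

theorem exists_bound_stepFun {E : Type*} [NormedAddCommGroup E] {k : ℝ} (hk : 0 < k) (F : ℕ → E) (t : ℝ) :
    ∃ M, ∀ s ∈ Ioc 0 t, ‖stepFun k F s‖ ≤ M := by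
  refine ⟨∑ i ∈ Finset.range (⌈t / k⌉₊ + 1), ‖F i‖, fun s hs => ?_⟩
  refine Finset.single_le_sum (f := fun i => ‖F i‖) (fun i _ => norm_nonneg _) ?_
  rw [Finset.mem_range, Nat.lt_succ_iff]
  exact Nat.ceil_mono (div_le_div_of_nonneg_right hs.2 hk.le)

/-! ### Fractional integrals: Hölder continuity and step functions. -/

section FracInt

variable {α : ℝ} {E : Type*} [NormedAddCommGroup E] [NormedSpace ℝ E]

/-- The Riemann-Liouville fractional integral of order `α` started at time `0`. -/
noncomputable def fracInt (α : ℝ) (f : ℝ → E) (t : ℝ) : E :=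
  ∫ s in Ioi (0 : ℝ), kern α (t - s) • f s

theorem fracInt_of_nonpos (f : ℝ → E) {t : ℝ} (ht : t ≤ 0) : fracInt α f t = 0 := by
  unfold fracInt
  rw [setIntegral_congr_fun (g := fun _ => (0 : E)) measurableSet_Ioi, integral_zero]
  intro s hs
  have hs : 0 < s := hs
  simp [kern_of_nonpos (show t - s ≤ 0 by linarith)]

theorem integrableOn_kern_smul (hα : 0 < α) {f : ℝ → E} {t M : ℝ}
    (hf : AEStronglyMeasurable f (volume.restrict (Ioi 0))) (hM : ∀ s ∈ Ioc 0 t, ‖f s‖ ≤ M) :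
    IntegrableOn (fun s => kern α (t - s) • f s) (Ioi 0) := by
  refine ((integrableOn_kern_sub hα t 0).mul_const M).mono' ?_ ?_
  · exact (Measurable.aestronglyMeasurable (by fun_prop)).smul hf
  · filter_upwards [ae_restrict_mem measurableSet_Ioi] with s hs
    rw [norm_smul, Real.norm_of_nonneg (kern_nonneg hα _)]
    by_cases hst : s ≤ t
    · exact mul_le_mul_of_nonneg_left (hM s ⟨hs, hst⟩) (kern_nonneg hα _)
    · simp [kern_of_nonpos (show t - s ≤ 0 by linarith)]

theorem rpow_le_and_le_rpow_add {α s t : ℝ} (hα₁ : α < 1) (hα : 0 < α) (hs : 0 ≤ s) (hst : s ≤ t) :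
    s ^ α ≤ t ^ α ∧ t ^ α ≤ s ^ α + (t - s) ^ α := by
  refine ⟨Real.rpow_le_rpow hs hst hα.le, ?_⟩
  have := Real.rpow_add_le_add_rpow hs (sub_nonneg.2 hst) hα.le hα₁.le
  simpa using this

/-- Cauchy-Schwarz with the weight `|kern α (t - r) - kern α (s - r)|`: its mass is at most `2 (t -
s) ^ α / Γ(1 + α)`, and its integral against `‖f‖²` is at most `2 K`. The bound `M` serves
integrability only and does not enter the estimate. -/
theorem norm_fracInt_sub_le (hα : 0 < α) (hα₁ : α < 1) {f : ℝ → E} {s t M K : ℝ}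
    (hf : AEStronglyMeasurable f (volume.restrict (Ioi 0))) (hs : 0 ≤ s) (hst : s ≤ t)
    (hM : ∀ r ∈ Ioc 0 t, ‖f r‖ ≤ M)
    (hKs : fracInt α (fun r => ‖f r‖ ^ 2) s ≤ K) (hKt : fracInt α (fun r => ‖f r‖ ^ 2) t ≤ K) :
    ‖fracInt α f t - fracInt α f s‖ ≤ 2 * √(K / Real.Gamma (1 + α)) * (t - s) ^ (α / 2) := by
  have hG := Gamma_one_add_pos hα
  have hMs : ∀ r ∈ Ioc 0 s, ‖f r‖ ≤ M := fun r hr => hM r ⟨hr.1, hr.2.trans hst⟩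
  have hM2 : ∀ r ∈ Ioc 0 t, ‖‖f r‖ ^ 2‖ ≤ M ^ 2 := fun r hr => by
    rw [norm_pow, norm_norm]
    exact pow_le_pow_left₀ (norm_nonneg _) (hM r hr) 2
  have hM2s : ∀ r ∈ Ioc 0 s, ‖‖f r‖ ^ 2‖ ≤ M ^ 2 := fun r hr => hM2 r ⟨hr.1, hr.2.trans hst⟩
  have hit := integrableOn_kern_smul hα hf hM
  have his := integrableOn_kern_smul hα hf hMs
  have hit2 := integrableOn_kern_smul hα (hf.norm.pow 2) hM2
  have his2 := integrableOn_kern_smul hα (hf.norm.pow 2) hM2s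
  have hkt := integrableOn_kern_sub hα t 0
  have hks := integrableOn_kern_sub hα s 0
  set w : ℝ → ℝ := fun r => |kern α (t - r) - kern α (s - r)| with hwdef
  have hwi : IntegrableOn w (Ioi 0) := (hkt.sub hks).abs
  have hle : ∀ r, w r ≤ kern α (t - r) + kern α (s - r) := fun r =>
    (abs_sub _ _).trans (by
      rw [abs_of_nonneg (kern_nonneg hα _), abs_of_nonneg (kern_nonneg hα _)])
  have hwm : Measurable w := by
    have : Measurable fun r => kern α (t - r) - kern α (s - r) := by fun_prop
    exact this.abs
  have hwG : IntegrableOn (fun r => w r * ‖f r‖ ^ 2) (Ioi 0) := by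
    refine (hit2.add his2).mono' (hwm.aestronglyMeasurable.mul (hf.norm.pow 2))
      (Eventually.of_forall fun r => ?_)
    rw [Real.norm_of_nonneg (by positivity), Pi.add_apply, smul_eq_mul, smul_eq_mul, ← add_mul]
    exact mul_le_mul_of_nonneg_right (hle r) (by positivity)
  have hK : ∫ r in Ioi 0, w r * ‖f r‖ ^ 2 ≤ 2 * K := by
    have h := integral_mono hwG (hit2.add his2) fun r => by
      rw [Pi.add_apply, smul_eq_mul, smul_eq_mul, ← add_mul]
      exact mul_le_mul_of_nonneg_right (hle r) (by positivity)
    simp only [Pi.add_apply] at h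
    rw [integral_add hit2 his2] at h
    exact h.trans ((add_le_add hKt hKs).trans (by linarith))
  -- The kernel decreases, so the difference has a fixed sign before `s`; after `s` only `kern α (t
  -- - r)` survives, and doubling it corrects the sign. The point `r = s` is left out because `kern
  -- α 0 = 0` breaks the monotonicity there. The signed part integrates to `(s ^ α - t ^ α) / Γ(1 +
  -- α) ≤ 0`.
  have hweq : ∀ r, r ≠ s → w r = (kern α (s - r) - kern α (t - r)) +
      2 * (Ioi s).indicator (fun r => kern α (t - r)) r := by
    intro r hrs
    by_cases hr : s < r
    · rw [indicator_of_mem (show r ∈ Ioi s from hr)]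
      simp only [hwdef, kern_of_nonpos (show s - r ≤ 0 by linarith), sub_zero, zero_sub]
      rw [abs_of_nonneg (kern_nonneg hα _)]
      ring
    · rw [indicator_of_notMem (show r ∉ Ioi s from hr), mul_zero, add_zero]
      have hr := lt_of_le_of_ne (not_lt.1 hr) hrs
      simp only [hwdef]
      rw [abs_sub_comm, abs_of_nonneg]
      have := kern_anti hα hα₁ (show 0 < s - r by linarith) (show s - r ≤ t - r by linarith)
      linarith
  have hW : ∫ r in Ioi 0, w r ≤ 2 * ((t - s) ^ α / Real.Gamma (1 + α)) := by
    have h1 : ∫ r in Ioi 0, w r = ∫ r in Ioi 0, ((kern α (s - r) - kern α (t - r)) +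
        2 * (Ioi s).indicator (fun r => kern α (t - r)) r) := by
      refine integral_congr_ae (ae_restrict_of_ae ?_)
      filter_upwards [compl_mem_ae_iff.2 (measure_singleton s)] with r hr
      exact hweq r hr
    have h2 : IntegrableOn ((Ioi s).indicator fun r => kern α (t - r)) (Ioi 0) :=
      hkt.indicator measurableSet_Ioi
    rw [h1, integral_add (f := fun r => kern α (s - r) - kern α (t - r)) (hks.sub hkt)
      (h2.const_mul 2), integral_sub hks hkt, integral_const_mul,
      setIntegral_indicator measurableSet_Ioi, Ioi_inter_Ioi, sup_eq_right.2 hs,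
      setIntegral_kern_sub hα hs, setIntegral_kern_sub hα (hs.trans hst),
      setIntegral_kern_sub hα hst, sub_zero, sub_zero, ← sub_div]
    have h3 := div_le_div_of_nonneg_right (sub_nonpos.2 (rpow_le_and_le_rpow_add hα₁ hα hs hst).1) hG.le
    rw [zero_div] at h3
    linarith
  obtain ⟨-, h⟩ := integral_weight_mul_le (fun r => abs_nonneg _) (fun r => norm_nonneg (f r))
    hf.norm hwi hwG hW hK
  have hsub : fracInt α f t - fracInt α f s =
      ∫ r in Ioi 0, (kern α (t - r) - kern α (s - r)) • f r := by
    simp only [fracInt, sub_smul]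
    exact (integral_sub hit his).symm
  rw [hsub]
  refine (norm_integral_le_integral_norm _).trans ?_
  simp only [norm_smul, Real.norm_eq_abs]
  refine h.trans (le_of_eq ?_)
  have hts : 0 ≤ t - s := by linarith
  have hK0 : 0 ≤ 2 * K :=
    (integral_nonneg fun r => mul_nonneg (abs_nonneg _) (by positivity)).trans hK
  rw [← Real.sqrt_mul' _ hK0, show α / 2 = α * (1 / 2) by ring, Real.rpow_mul (by linarith),
    ← Real.sqrt_eq_rpow, mul_assoc 2 (√_), ← Real.sqrt_mul' _ (by positivity),
    show 2 * ((t - s) ^ α / Real.Gamma (1 + α)) * (2 * K) =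
      2 ^ 2 * (K / Real.Gamma (1 + α) * (t - s) ^ α) by ring, Real.sqrt_mul (by norm_num),
    Real.sqrt_sq (by norm_num)]

theorem integrableOn_kern_stepFun (hα : 0 < α) {k : ℝ} (hk : 0 < k) (F : ℕ → E) (t : ℝ) :
    IntegrableOn (fun s => kern α (t - s) • stepFun k F s) (Ioi 0) := by
  obtain ⟨M, hM⟩ := exists_bound_stepFun hk F t
  exact integrableOn_kern_smul hα (stronglyMeasurable_stepFun k F).aestronglyMeasurable hM

theorem rpow_cell_eq {k : ℝ} (hk : 0 < k) (m : ℕ) :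
    ((((m : ℝ) + 1) * k) ^ α - (m * k) ^ α) / Real.Gamma (1 + α) = k ^ α * a α m := by
  rw [Real.mul_rpow (by positivity) hk.le, Real.mul_rpow (by positivity) hk.le, a]
  ring

theorem fracInt_eq_intervalIntegral (f : ℝ → E) {t : ℝ} (ht : 0 ≤ t) :
    fracInt α f t = ∫ s in (0 : ℝ)..t, kern α (t - s) • f s := by
  rw [intervalIntegral.integral_of_le ht, fracInt, ← integral_indicator measurableSet_Ioi,
    ← integral_indicator measurableSet_Ioc]
  congr 1
  ext s
  by_cases hs : 0 < s <;> by_cases hst : s ≤ t <;> simp [hs, hst, indicator]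
  simp [kern_of_nonpos (show t - s ≤ 0 by linarith)]

/-- The fractional integral of a step function at a grid point is a discrete convolution. -/
theorem fracInt_stepFun [CompleteSpace E] (hα : 0 < α) {k : ℝ} (hk : 0 < k) (F : ℕ → E) (n : ℕ) :
    fracInt α (stepFun k F) (n * k) =
      k ^ α • ∑ j ∈ Finset.range n, a α (n - 1 - j) • F (j + 1) := by
  have hint : ∀ j < n, IntervalIntegrable
      (fun s => kern α (n * k - s) • stepFun k F s) volume (j * k) ((j + 1 : ℕ) * k) := by
    intro j _
    rw [intervalIntegrable_iff_integrableOn_Ioc_of_le (by push_cast; nlinarith)]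
    exact (integrableOn_kern_stepFun hα hk F (n * k)).mono_set
      fun s hs => lt_of_le_of_lt (by positivity) hs.1
  have h := intervalIntegral.sum_integral_adjacent_intervals (μ := volume)
    (a := fun j : ℕ => (j : ℝ) * k) hint
  rw [fracInt_eq_intervalIntegral _ (by positivity), Finset.smul_sum]
  simp only [Nat.cast_zero, zero_mul] at h
  rw [← h]
  refine Finset.sum_congr rfl fun j hj => ?_
  have hj := Finset.mem_range.1 hj
  have hjn : (j : ℝ) + 1 ≤ n := by exact_mod_cast hj
  have hle : (j : ℝ) * k ≤ (j + 1 : ℕ) * k := by push_cast; nlinarith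
  have h1 : ∫ s in (j * k)..((j + 1 : ℕ) * k), kern α (n * k - s) • stepFun k F s =
      ∫ s in (j * k)..((j + 1 : ℕ) * k), kern α (n * k - s) • F (j + 1) := by
    rw [intervalIntegral.integral_of_le hle, intervalIntegral.integral_of_le hle]
    refine setIntegral_congr_fun measurableSet_Ioc fun s hs => ?_
    rw [stepFun_apply hk F hs.1 (by simpa using hs.2)]
  rw [h1, intervalIntegral.integral_smul_const,
    integral_kern_sub hα hle (mul_le_mul_of_nonneg_right (by exact_mod_cast hj) hk.le), smul_smul,
    ← rpow_cell_eq hk]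
  have h2 : ((n - 1 - j : ℕ) : ℝ) = n - 1 - j := by
    rw [Nat.cast_sub (by omega), Nat.cast_sub (by omega)]; simp
  rw [h2]
  push_cast
  congr 4 <;> ring

/-- A bound for the fractional integral of a nonnegative step function at the grid points gives
twice that bound at all times. -/
theorem fracInt_stepFun_le (hα : 0 < α) (hα₁ : α < 1) {k K : ℝ} (hk : 0 < k) {F : ℕ → ℝ}
    (hF : ∀ n, 0 ≤ F n)
    (hK : ∀ n, k ^ α * ∑ j ∈ Finset.range n, a α (n - 1 - j) * F (j + 1) ≤ K) (t : ℝ) :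
    fracInt α (stepFun k F) t ≤ 2 * K := by
  have hK0 : 0 ≤ K := by simpa using hK 0
  rcases le_or_gt t 0 with ht | ht
  · rw [fracInt_of_nonpos _ ht]; linarith
  obtain ⟨n, h1, h2⟩ := exists_mem_cell hk ht
  have hn0 : (0 : ℝ) ≤ n * k := by positivity
  have hka : 0 < k ^ α := Real.rpow_pos_of_pos hk α
  have hlast : k ^ α * a α 0 * F (n + 1) ≤ K := by
    refine le_trans ?_ (hK (n + 1))
    rw [mul_assoc]
    refine mul_le_mul_of_nonneg_left ?_ hka.le
    have := Finset.single_le_sum (f := fun j => a α (n + 1 - 1 - j) * F (j + 1))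
      (fun j _ => mul_nonneg (a_pos hα _).le (hF _)) (Finset.self_mem_range_succ n)
    simpa using this
  have hgrid : fracInt α (stepFun k F) (n * k) ≤ K := by
    rw [fracInt_stepFun hα hk]
    exact hK n
  have hkt := integrableOn_kern_sub hα t 0
  have hind : IntegrableOn ((Ioi (n * k)).indicator fun s => kern α (t - s)) (Ioi 0) :=
    hkt.indicator measurableSet_Ioi
  -- Before the grid point `n * k` the kernel at `t` is dominated by the kernel at `n * k`, which
  -- costs `K`. The open cell contributes at most the last term of the bound at `n + 1`, which costs
  -- another `K`.
  have hle : fracInt α (stepFun k F) t ≤ ∫ s in Ioi 0, (kern α (n * k - s) • stepFun k F s +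
      (Ioi (n * k)).indicator (fun s => kern α (t - s)) s * F (n + 1)) := by
    refine integral_mono_ae (integrableOn_kern_stepFun hα hk F t)
      ((integrableOn_kern_stepFun hα hk F (n * k)).add (hind.mul_const _)) ?_
    refine ae_restrict_of_ae ?_
    filter_upwards [compl_mem_ae_iff.2 (measure_singleton (n * k : ℝ))] with s hs
    have hs : s ≠ n * k := hs
    have hF0 : 0 ≤ stepFun k F s := hF _
    simp only [smul_eq_mul]
    rcases hs.lt_or_gt with h | h
    · rw [indicator_of_notMem (show s ∉ Ioi (n * k) from not_lt.2 h.le), zero_mul, add_zero]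
      exact mul_le_mul_of_nonneg_right (kern_anti hα hα₁ (by linarith) (by linarith)) hF0
    · rw [indicator_of_mem (show s ∈ Ioi (n * k) from h),
        kern_of_nonpos (show n * k - s ≤ 0 by linarith), zero_mul, zero_add]
      by_cases hst : s ≤ t
      · rw [stepFun_apply hk F h (hst.trans h2)]
      · simp [kern_of_nonpos (show t - s ≤ 0 by linarith)]
  rw [integral_add (integrableOn_kern_stepFun hα hk F _) (hind.mul_const _), integral_mul_const,
    setIntegral_indicator measurableSet_Ioi, Ioi_inter_Ioi, sup_eq_right.2 hn0,
    setIntegral_kern_sub hα h1.le] at hle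
  have hlast' : (t - n * k) ^ α / Real.Gamma (1 + α) * F (n + 1) ≤ K := by
    refine le_trans (mul_le_mul_of_nonneg_right ?_ (hF _)) hlast
    rw [← rpow_cell_eq hk, Nat.cast_zero, zero_mul, zero_add, one_mul, Real.zero_rpow hα.ne',
      sub_zero]
    have := Gamma_one_add_pos hα
    gcongr
    linarith
  unfold fracInt at hgrid
  linarith

end FracInt

/-! ### Fractional integrals of integrable functions. -/

section Integrability

variable {α : ℝ} {E : Type*} [NormedAddCommGroup E] [NormedSpace ℝ E]

theorem integrable_indicator_kern (hα : 0 < α) (T : ℝ) :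
    Integrable ((Ioc 0 T).indicator (kern α)) := by
  rw [integrable_indicator_iff measurableSet_Ioc]
  rcases le_total 0 T with h | h
  · exact (intervalIntegrable_iff_integrableOn_Ioc_of_le h).1 (intervalIntegrable_kern hα _ _)
  · simp [Ioc_eq_empty_of_le h]

/-- Convolutions of `L¹` functions exist almost everywhere, and for `t ≤ T` truncating kernel and
function to `(0, T]` leaves the integrand unchanged. -/
theorem ae_integrableOn_kern_smul (hα : 0 < α) {T : ℝ} {f : ℝ → E}
    (hf : IntegrableOn f (Ioc 0 T)) :
    ∀ᵐ t, t ≤ T → IntegrableOn (fun s => kern α (t - s) • f s) (Ioi 0) := by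
  have h := ((integrable_indicator_iff measurableSet_Ioc).2 hf).ae_convolution_exists
    (ContinuousLinearMap.lsmul ℝ ℝ : ℝ →L[ℝ] E →L[ℝ] E).flip (integrable_indicator_kern hα T)
  filter_upwards [h] with t ht htT
  refine (ht.integrable.integrableOn (s := Ioi 0)).congr_fun (fun s hs => ?_) measurableSet_Ioi
  have hs : 0 < s := hs
  simp only [ContinuousLinearMap.flip_apply, ContinuousLinearMap.lsmul_apply]
  by_cases hst : s < t
  · rw [indicator_of_mem (show s ∈ Ioc 0 T from ⟨hs, by linarith⟩),
      indicator_of_mem (show t - s ∈ Ioc 0 T from ⟨by linarith, by linarith⟩)]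
  · rw [indicator_of_notMem (show t - s ∉ Ioc 0 T from fun h => hst (by linarith [h.1])),
      kern_of_nonpos (by linarith), zero_smul, zero_smul]

theorem fracInt_congr {f g : ℝ → E} {t T : ℝ} (htT : t ≤ T)
    (h : ∀ᵐ s, s ∈ Ioc 0 T → f s = g s) : fracInt α f t = fracInt α g t := by
  refine setIntegral_congr_ae measurableSet_Ioi ?_
  filter_upwards [h] with s hs (hs0 : 0 < s)
  by_cases hst : s < t
  · rw [hs ⟨hs0, by linarith⟩]
  · simp [kern_of_nonpos (show t - s ≤ 0 by linarith)]

theorem fracInt_mono (hα : 0 < α) {f g : ℝ → ℝ} {t T : ℝ} (htT : t ≤ T)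
    (hf : IntegrableOn (fun s => kern α (t - s) • f s) (Ioi 0))
    (hg : IntegrableOn (fun s => kern α (t - s) • g s) (Ioi 0))
    (h : ∀ᵐ s, s ∈ Ioc 0 T → f s ≤ g s) : fracInt α f t ≤ fracInt α g t := by
  refine setIntegral_mono_on_ae hf hg measurableSet_Ioi ?_
  filter_upwards [h] with s hs (hs0 : 0 < s)
  by_cases hst : s < t
  · exact mul_le_mul_of_nonneg_left (hs ⟨hs0, by linarith⟩) (kern_nonneg hα _)
  · simp [kern_of_nonpos (show t - s ≤ 0 by linarith)]

theorem stronglyMeasurable_fracInt {f : ℝ → E} (hf : StronglyMeasurable f) :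
    StronglyMeasurable (fracInt α f) := by
  have : StronglyMeasurable (fun p : ℝ × ℝ => kern α (p.1 - p.2) • f p.2) :=
    (Measurable.stronglyMeasurable (by fun_prop)).smul (hf.comp_measurable measurable_snd)
  exact this.integral_prod_right'

theorem fracInt_smul (c : ℝ) (f : ℝ → E) (t : ℝ) :
    fracInt α (fun s => c • f s) t = c • fracInt α f t := by
  simp only [fracInt, smul_comm _ c]
  exact integral_smul c _

end Integrability

/-- Continuity of translations in `L¹`. -/
theorem exists_forall_lintegral_shift_le {E : Type*} [NormedAddCommGroup E] [NormedSpace ℝ E]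
    {f : ℝ → E} (hf : Integrable f) {ε : ENNReal} (hε : ε ≠ 0) :
    ∃ d > 0, ∀ x : ℝ, |x| < d → ∫⁻ t, ‖f (t + x) - f t‖ₑ ≤ ε := by
  have hε3 : ε / 3 ≠ 0 := by simp [hε]
  obtain ⟨g, hgc, hfg, hg, hgi⟩ := hf.exists_hasCompactSupport_lintegral_sub_le hε3
  obtain ⟨R, hR⟩ := hgc.isCompact.isBounded.subset_closedBall 0
  have hR' : ∀ t, R < |t| → g t = 0 := fun t ht => by
    by_contra h
    have := hR (subset_tsupport g h)
    simp at this
    linarith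
  have huc := hgc.uniformContinuous_of_continuous hg
  set V : ENNReal := volume (Icc (-(|R| + 1)) (|R| + 1)) with hV
  have hV' : V ≠ ⊤ := by rw [hV]; simp
  have hV0 : V ≠ 0 := by
    rw [hV, Real.volume_Icc]
    simp only [ne_eq, ENNReal.ofReal_eq_zero, not_le]
    linarith [abs_nonneg R]
  have hη : ε / 3 / V ≠ 0 := by simp [hε, hV']
  obtain ⟨η, hη0, hηle⟩ : ∃ η : ℝ, 0 < η ∧ ENNReal.ofReal η ≤ ε / 3 / V := by
    by_cases htop : ε / 3 / V = ⊤
    · exact ⟨1, one_pos, by simp [htop]⟩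
    · exact ⟨(ε / 3 / V).toReal, ENNReal.toReal_pos hη htop, ENNReal.ofReal_toReal_le⟩
  obtain ⟨d, hd, hgd⟩ := Metric.uniformContinuous_iff.1 huc η hη0
  -- Shifts shorter than `1` keep both `g` and its translate supported in the interval of volume
  -- `V`.
  refine ⟨min d 1, by positivity, fun x hx => ?_⟩
  have hxd : |x| < d := hx.trans_le (min_le_left _ _)
  have hx1 : |x| < 1 := hx.trans_le (min_le_right _ _)
  have hmid : ∫⁻ t, ‖g (t + x) - g t‖ₑ ≤ ε / 3 := by
    calc ∫⁻ t, ‖g (t + x) - g t‖ₑ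
        ≤ ∫⁻ t, (Icc (-(|R| + 1)) (|R| + 1)).indicator (fun _ => ENNReal.ofReal η) t := by
          refine lintegral_mono fun t => ?_
          by_cases ht : t ∈ Icc (-(|R| + 1)) (|R| + 1)
          · rw [indicator_of_mem ht, ← ofReal_norm]
            refine ENNReal.ofReal_le_ofReal ?_
            rw [← dist_eq_norm]
            exact (hgd (by simpa [Real.dist_eq] using hxd)).le
          · have ht : |R| + 1 < |t| := by
              by_contra h
              exact ht (abs_le.1 (not_lt.1 h))
            have h1 := hR' t (by linarith [le_abs_self R])
            have h2 := hR' (t + x) (by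
              have := abs_sub_abs_le_abs_sub t (-x)
              rw [abs_neg, sub_neg_eq_add] at this
              linarith [le_abs_self R])
            simp [h1, h2]
      _ = ENNReal.ofReal η * V := by
          rw [lintegral_indicator_const measurableSet_Icc]
      _ ≤ ε / 3 / V * V := by gcongr
      _ = ε / 3 := ENNReal.div_mul_cancel hV0 hV'
  have hshift : ∫⁻ t, ‖f (t + x) - g (t + x)‖ₑ ≤ ε / 3 := by
    rw [lintegral_add_right_eq_self (fun t => ‖f t - g t‖ₑ)]
    exact hfg
  have hm1 : AEMeasurable fun t => ‖f t - g t‖ₑ :=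
    (hf.aestronglyMeasurable.sub hg.aestronglyMeasurable).enorm
  have hm2 : AEMeasurable fun t => ‖g (t + x) - g t‖ₑ :=
    (Continuous.aestronglyMeasurable (by fun_prop)).enorm
  calc ∫⁻ t, ‖f (t + x) - f t‖ₑ
      ≤ ∫⁻ t, (‖f (t + x) - g (t + x)‖ₑ + (‖g (t + x) - g t‖ₑ + ‖f t - g t‖ₑ)) := by
        refine lintegral_mono fun t => ?_
        have : f (t + x) - f t =
          (f (t + x) - g (t + x)) + ((g (t + x) - g t) - (f t - g t)) := by abel
        rw [this]
        exact (enorm_add_le _ _).trans (add_le_add le_rfl (enorm_sub_le))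
    _ = (∫⁻ t, ‖f (t + x) - g (t + x)‖ₑ) +
        ((∫⁻ t, ‖g (t + x) - g t‖ₑ) + ∫⁻ t, ‖f t - g t‖ₑ) := by
        have hm3 : AEMeasurable fun t => ‖g (t + x) - g t‖ₑ + ‖f t - g t‖ₑ := hm2.add hm1
        rw [lintegral_add_right' _ hm3, lintegral_add_right' _ hm1]
    _ ≤ ε / 3 + (ε / 3 + ε / 3) := by gcongr
    _ = ε := by rw [← add_assoc, ENNReal.add_thirds]

/-! ### Approximation of the fractional integral by combinations of translations. -/

section TransSum

variable {α : ℝ} {E : Type*} [NormedAddCommGroup E] [NormedSpace ℝ E]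

/-- The approximation of the fractional integral by a combination of translations. -/
noncomputable def transSum (α k : ℝ) (M : ℕ) (f : ℝ → E) (t : ℝ) : E :=
  k ^ α • ∑ j ∈ Finset.range M, a α j • f (t - j * k)

theorem integral_kern_smul_stepFun [CompleteSpace E] (hα : 0 < α) {k : ℝ} (hk : 0 < k) (F : ℕ → E)
    (M : ℕ) : ∫ r in Ioc 0 (M * k), kern α r • stepFun k F r =
      k ^ α • ∑ j ∈ Finset.range M, a α j • F (j + 1) := by
  have hcell : ∀ j : ℕ, (j : ℝ) * k ≤ (j + 1 : ℕ) * k := fun j => by push_cast; nlinarith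
  have heq : ∀ j : ℕ, EqOn (fun r => kern α r • stepFun k F r) (fun r => kern α r • F (j + 1))
      (Ioc (j * k) ((j + 1 : ℕ) * k)) := fun j r hr => by
    simp only
    rw [stepFun_apply hk F hr.1 (by simpa using hr.2)]
  have hint : ∀ j < M, IntervalIntegrable
      (fun r => kern α r • stepFun k F r) volume (j * k) ((j + 1 : ℕ) * k) := by
    intro j _
    rw [intervalIntegrable_iff_integrableOn_Ioc_of_le (hcell j)]
    refine IntegrableOn.congr_fun ?_ (heq j).symm measurableSet_Ioc
    exact ((intervalIntegrable_iff_integrableOn_Ioc_of_le (hcell j)).1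
      (intervalIntegrable_kern hα _ _)).smul_const _
  have h := intervalIntegral.sum_integral_adjacent_intervals (μ := volume)
    (a := fun j : ℕ => (j : ℝ) * k) hint
  simp only [Nat.cast_zero, zero_mul] at h
  rw [← intervalIntegral.integral_of_le (by positivity), ← h, Finset.smul_sum]
  refine Finset.sum_congr rfl fun j _ => ?_
  rw [intervalIntegral.integral_of_le (hcell j), setIntegral_congr_fun measurableSet_Ioc (heq j),
    integral_smul_const, ← intervalIntegral.integral_of_le (hcell j),
    integral_kern hα (by positivity) (hcell j), smul_smul, ← rpow_cell_eq hk]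
  push_cast
  rfl

theorem stronglyMeasurable_transSum {f : ℝ → E} (hf : StronglyMeasurable f) (k : ℝ) (M : ℕ) :
    StronglyMeasurable (transSum α k M f) := by
  refine StronglyMeasurable.const_smul ?_ _
  refine Finset.stronglyMeasurable_fun_sum _ fun j _ => ?_
  exact (hf.comp_measurable (by fun_prop)).const_smul _

theorem transSum_add (k : ℝ) (M : ℕ) (f g : ℝ → E) (t : ℝ) :
    transSum α k M (fun s => f s + g s) t = transSum α k M f t + transSum α k M g t := by
  simp only [transSum, smul_add, Finset.sum_add_distrib]

theorem fracInt_eq_integral_comp_sub {T : ℝ} {f : ℝ → E} (hf0 : ∀ s ≤ 0, f s = 0) {t : ℝ}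
    (ht : t ≤ T) : fracInt α f t = ∫ r in Ioc 0 T, kern α r • f (t - r) := by
  rw [fracInt, setIntegral_eq_integral_of_forall_compl_eq_zero,
    setIntegral_eq_integral_of_forall_compl_eq_zero,
    ← integral_sub_left_eq_self (fun r => kern α r • f (t - r)) volume t]
  · simp
  · intro r hr
    by_cases h : r ≤ 0
    · rw [kern_of_nonpos h, zero_smul]
    · rw [hf0 _ (by by_contra h'; exact hr ⟨not_le.1 h, by linarith⟩), smul_zero]
  · intro s hs
    rw [hf0 s (not_lt.1 hs), smul_zero]

/-- The sum is `∫ kern α r • f (t - τ r)` with `τ r` the rounding of `r` down to the grid. After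
Fubini, the error is the `L¹` modulus of continuity of `f` at scale `k` times the mass of the
kernel. -/
theorem lintegral_transSum_sub_fracInt_le [CompleteSpace E] (hα : 0 < α) {k : ℝ} (hk : 0 < k)
    {M : ℕ} {f : ℝ → E} (hf : Integrable f) (hfm : StronglyMeasurable f) (hf0 : ∀ s ≤ 0, f s = 0)
    {ε : ENNReal} (hω : ∀ x : ℝ, |x| ≤ k → ∫⁻ t, ‖f (t + x) - f t‖ₑ ≤ ε) :
    ∫⁻ t in Ioc 0 (M * k), ‖transSum α k M f t - fracInt α f t‖ₑ ≤
      (∫⁻ r in Ioc 0 (M * k), ‖kern α r‖ₑ) * ε := by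
  set T := M * k with hT
  -- The left end point of the cell containing `r`. The truncated subtraction matters only for `r ≤
  -- 0`, outside the domain of integration.
  set τ : ℝ → ℝ := stepFun k fun n => (n - 1 : ℕ) * k with hτ
  have hτm : Measurable τ := (stronglyMeasurable_stepFun k _).measurable
  have hkern := (integrable_indicator_iff measurableSet_Ioc).1 (integrable_indicator_kern hα T)
  have hpt : ∀ᵐ t, t ∈ Ioc 0 T → ‖transSum α k M f t - fracInt α f t‖ₑ ≤
      ∫⁻ r in Ioc 0 T, ‖kern α r‖ₑ * ‖f (t - τ r) - f (t - r)‖ₑ := by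
    filter_upwards [ae_integrableOn_kern_smul hα (hf.integrableOn (s := Ioc 0 T))] with t ht htT
    have h1 : transSum α k M f t = ∫ r in Ioc 0 T, kern α r • f (t - τ r) := by
      have := integral_kern_smul_stepFun hα hk (fun n => f (t - (n - 1 : ℕ) * k)) M
      simp only [Nat.add_sub_cancel] at this
      rw [transSum, ← this]
      rfl
    have hi1 : IntegrableOn (fun r => kern α r • f (t - τ r)) (Ioc 0 T) := by
      obtain ⟨B, hB⟩ := exists_bound_stepFun hk (fun n => f (t - (n - 1 : ℕ) * k)) T
      refine (hkern.norm.mul_const B).mono' ?_ ?_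
      · exact measurable_kern.aestronglyMeasurable.smul
          (hfm.comp_measurable (by fun_prop)).aestronglyMeasurable
      · filter_upwards [ae_restrict_mem measurableSet_Ioc] with r hr
        rw [norm_smul]
        exact mul_le_mul_of_nonneg_left (hB r hr) (norm_nonneg _)
    have hi2 : IntegrableOn (fun r => kern α r • f (t - r)) (Ioc 0 T) := by
      have h2 : Integrable fun s => kern α (t - s) • f s :=
        (integrableOn_iff_integrable_of_support_subset fun s hs => by
          by_contra h
          simp [hf0 s (not_lt.1 h)] at hs).1 (ht htT.2)
      have := (h2.comp_sub_left t).integrableOn (s := Ioc 0 T)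
      simpa using this
    rw [h1, fracInt_eq_integral_comp_sub hf0 htT.2, ← integral_sub hi1 hi2]
    refine (enorm_integral_le_lintegral_enorm _).trans (lintegral_mono fun r => ?_)
    rw [← smul_sub, enorm_smul]
  have hm : Measurable (Function.uncurry fun t r : ℝ =>
      ‖kern α r‖ₑ * ‖f (t - τ r) - f (t - r)‖ₑ) := by
    have h1 : StronglyMeasurable fun p : ℝ × ℝ => f (p.1 - τ p.2) :=
      hfm.comp_measurable (by fun_prop)
    have h2 : StronglyMeasurable fun p : ℝ × ℝ => f (p.1 - p.2) :=
      hfm.comp_measurable (by fun_prop)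
    exact Measurable.mul (by fun_prop) (h1.sub h2).enorm
  calc ∫⁻ t in Ioc 0 T, ‖transSum α k M f t - fracInt α f t‖ₑ
      ≤ ∫⁻ t in Ioc 0 T, ∫⁻ r in Ioc 0 T, ‖kern α r‖ₑ * ‖f (t - τ r) - f (t - r)‖ₑ :=
        setLIntegral_mono_ae' measurableSet_Ioc hpt
    _ ≤ ∫⁻ t, ∫⁻ r in Ioc 0 T, ‖kern α r‖ₑ * ‖f (t - τ r) - f (t - r)‖ₑ :=
        setLIntegral_le_lintegral _ _
    _ = ∫⁻ r in Ioc 0 T, ∫⁻ t, ‖kern α r‖ₑ * ‖f (t - τ r) - f (t - r)‖ₑ :=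
        lintegral_lintegral_swap hm.aemeasurable
    _ ≤ ∫⁻ r in Ioc 0 T, ‖kern α r‖ₑ * ε := by
        refine setLIntegral_mono' measurableSet_Ioc fun r hr => ?_
        rw [lintegral_const_mul]
        · gcongr
          obtain ⟨n, hn1, hn2⟩ := exists_mem_cell hk hr.1
          have hτr : τ r = n * k := by simp [hτ, stepFun_apply hk _ hn1 hn2]
          have := hω (r - τ r) (by rw [hτr, abs_le]; constructor <;> linarith)
          rw [← lintegral_sub_right_eq_self _ r] at this
          refine le_trans (le_of_eq ?_) this
          congr! 5
          ring
        · have h1 : StronglyMeasurable fun t : ℝ => f (t - τ r) :=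
            hfm.comp_measurable (by fun_prop)
          have h2 : StronglyMeasurable fun t : ℝ => f (t - r) :=
            hfm.comp_measurable (by fun_prop)
          exact (h1.sub h2).enorm
    _ = (∫⁻ r in Ioc 0 T, ‖kern α r‖ₑ) * ε := by
        rw [lintegral_mul_const _ measurable_kern.enorm]

/-- Young's inequality: the weights `k ^ α * a α j` sum to the mass of the kernel on `(0, M * k]`,
so the bound does not deteriorate as `k → 0` with `M * k` fixed. -/
theorem lintegral_transSum_le (hα : 0 < α) {k : ℝ} (hk : 0 < k) (M : ℕ) {f : ℝ → E}
    (hfm : StronglyMeasurable f) :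
    ∫⁻ t, ‖transSum α k M f t‖ₑ ≤ (∫⁻ r in Ioc 0 (M * k), ‖kern α r‖ₑ) * ∫⁻ t, ‖f t‖ₑ := by
  have hsum : ENNReal.ofReal (k ^ α * ∑ j ∈ Finset.range M, a α j) ≤
      ∫⁻ r in Ioc 0 (M * k), ‖kern α r‖ₑ := by
    have h := integral_kern_smul_stepFun hα hk (fun _ => (1 : ℝ)) M
    simp only [stepFun, smul_eq_mul, mul_one] at h
    rw [← h]
    refine le_trans ?_ (enorm_integral_le_lintegral_enorm _)
    rw [← ofReal_norm]
    exact ENNReal.ofReal_le_ofReal (Real.le_norm_self _)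
  refine le_trans ?_ (mul_le_mul_left hsum _)
  have hk0 : 0 ≤ k ^ α := Real.rpow_nonneg hk.le _
  calc ∫⁻ t, ‖transSum α k M f t‖ₑ
      ≤ ∫⁻ t, ENNReal.ofReal (k ^ α) *
          ∑ j ∈ Finset.range M, ENNReal.ofReal (a α j) * ‖f (t - j * k)‖ₑ := by
        refine lintegral_mono fun t => ?_
        rw [transSum, enorm_smul, Real.enorm_of_nonneg hk0]
        gcongr
        refine (enorm_sum_le _ _).trans (Finset.sum_le_sum fun j _ => ?_)
        rw [enorm_smul, Real.enorm_of_nonneg (a_pos hα j).le]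
    _ = ENNReal.ofReal (k ^ α) *
          ∑ j ∈ Finset.range M, ENNReal.ofReal (a α j) * ∫⁻ t, ‖f t‖ₑ := by
        have hm : ∀ j : ℕ, Measurable fun t : ℝ => ‖f (t - j * k)‖ₑ := fun j =>
          (hfm.comp_measurable (by fun_prop)).enorm
        rw [lintegral_const_mul _ (Finset.measurable_fun_sum _ fun j _ => (hm j).const_mul _),
          lintegral_finsetSum _ fun j _ => (hm j).const_mul _]
        congr 1
        refine Finset.sum_congr rfl fun j _ => ?_
        rw [lintegral_const_mul _ (hm j), lintegral_sub_right_eq_self (fun t => ‖f t‖ₑ)]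
    _ = _ := by
        rw [← Finset.sum_mul, ← mul_assoc, ENNReal.ofReal_mul hk0,
          ENNReal.ofReal_sum_of_nonneg fun j _ => (a_pos hα j).le]

theorem transSum_eq {k : ℝ} (hk : 0 < k) {M j : ℕ} (hj : j < M) {f : ℝ → E}
    (hf0 : ∀ s ≤ 0, f s = 0) {t : ℝ} (htk : t ≤ k) :
    transSum α k M f (t + j * k) =
      ∑ i ∈ Finset.range (j + 1), a α (j - i) • (k ^ α • f (t + i * k)) := by
  rw [transSum, Finset.smul_sum, ← Finset.sum_range_reflect _ (j + 1)]
  rw [← Finset.sum_subset (Finset.range_subset_range.2 (Nat.succ_le_of_lt hj))]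
  · refine Finset.sum_congr rfl fun i hi => ?_
    have hi : i ≤ j := by simpa [Nat.lt_succ_iff] using hi
    rw [show j - (j + 1 - 1 - i) = i by omega, smul_comm]
    congr 3
    rw [show j + 1 - 1 - i = j - i by omega, Nat.cast_sub hi]
    ring
  · intro i _ hi
    have hi : j + 1 ≤ i := by simpa using hi
    have hi' : (j : ℝ) + 1 ≤ i := by exact_mod_cast hi
    rw [hf0 _ (by nlinarith), smul_zero, smul_zero]

/-- Along each shifted grid `t₀ + j * k` the translation sum is exactly a discrete convolution of
samples of `f`, so the discrete principle applies pointwise and without error. -/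
theorem transSum_convexity {H : Type*} [NormedAddCommGroup H] [InnerProductSpace ℝ H] (hα : 0 < α)
    (hα₁ : α < 1) {k : ℝ} (hk : 0 < k) {M : ℕ} {f : ℝ → H} (hf0 : ∀ s ≤ 0, f s = 0)
    {h : H → ℝ} {p : H → H} (h0 : h 0 = 0) (hp : ∀ x y, h x + inner ℝ (p x) (y - x) ≤ h y) {t : ℝ}
    (ht : t ∈ Ioc 0 (M * k)) :
    h (transSum α k M f t) ≤
      transSum α k M (fun s => inner ℝ (p (transSum α k M f s)) (f s)) t := by
  obtain ⟨n, hn1, hn2⟩ := exists_mem_cell hk ht.1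
  have hnM : n < M := by
    have : (n : ℝ) < M := lt_of_mul_lt_mul_right (hn1.trans_le ht.2) hk.le
    exact_mod_cast this
  -- The offset satisfies `t₀ ≤ k`, so all samples before index `0` fall at nonpositive times, where
  -- `f` vanishes.
  obtain ⟨t₀, rfl⟩ : ∃ t₀, t = t₀ + n * k := ⟨t - n * k, by ring⟩
  have ht0k : t₀ ≤ k := by linarith
  set F : ℕ → H := fun j => k ^ α • f (t₀ + j * k) with hF
  set z : ℕ → H := fun m => ∑ j ∈ Finset.range m, a α (m - 1 - j) • F j with hz
  have hzt : ∀ j < M, z (j + 1) = transSum α k M f (t₀ + j * k) := fun j hj => by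
    rw [transSum_eq hk hj hf0 ht0k]
    simp [hz, hF]
  have hconv := discrete_convexity hα hα₁ (z := z) (F := F) (p := fun n => p (z n))
    (Φ := fun n => h (z n)) (fun n => by simp [hz]) (fun n m => hp _ _) (n + 1)
  rw [hzt n hnM] at hconv
  refine hconv.trans (le_of_eq ?_)
  rw [transSum_eq hk hnM (fun s hs => by simp [hf0 s hs]) ht0k]
  simp only [hz, Finset.range_zero, Finset.sum_empty, h0, zero_add, Nat.add_sub_cancel]
  refine Finset.sum_congr rfl fun j hj => ?_
  have hj : j < M := by have := Finset.mem_range.1 hj; omega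
  have := hzt j hj
  simp only [hz, Nat.add_sub_cancel] at this
  rw [this, hF, inner_smul_right]
  simp only [smul_eq_mul]

end TransSum

/-! ### The energy inequality for fractional integrals of integrable functions. -/

section Comparison

variable {α : ℝ}

theorem lintegral_kern_lt_top (hα : 0 < α) (T : ℝ) : ∫⁻ r in Ioc 0 T, ‖kern α r‖ₑ ≠ ⊤ :=
  ((integrable_indicator_iff measurableSet_Ioc).1 (integrable_indicator_kern hα T)).2.ne

theorem tendsto_lintegral_transSum_sub {E : Type*} [NormedAddCommGroup E] [NormedSpace ℝ E]
    [CompleteSpace E] (hα : 0 < α) {T : ℝ} (hT : 0 < T) {f : ℝ → E} (hf : Integrable f)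
    (hfm : StronglyMeasurable f) (hf0 : ∀ s ≤ 0, f s = 0) :
    Tendsto (fun n : ℕ => ∫⁻ t in Ioc 0 T,
      ‖transSum α (T / (n + 1)) (n + 1) f t - fracInt α f t‖ₑ) atTop (𝓝 0) := by
  set C := ∫⁻ r in Ioc 0 T, ‖kern α r‖ₑ with hC
  have hCt : C ≠ ⊤ := lintegral_kern_lt_top hα T
  rw [ENNReal.tendsto_nhds_zero]
  intro ε hε
  have hε' : ε / (C + 1) ≠ 0 := by simp [hε.ne', hCt]
  obtain ⟨d, hd, hω⟩ := exists_forall_lintegral_shift_le hf hε'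
  have hlim : Tendsto (fun n : ℕ => T / ((n : ℝ) + 1)) atTop (𝓝 0) :=
    tendsto_const_nhds.div_atTop (tendsto_natCast_atTop_atTop.atTop_add tendsto_const_nhds)
  filter_upwards [hlim.eventually (gt_mem_nhds hd)] with n hn
  have hk : 0 < T / ((n : ℝ) + 1) := by positivity
  have hMk : ((n + 1 : ℕ) : ℝ) * (T / ((n : ℝ) + 1)) = T := by push_cast; field_simp
  have h := lintegral_transSum_sub_fracInt_le hα hk (M := n + 1) hf hfm hf0
    fun x hx => hω x (hx.trans_lt hn)
  rw [hMk] at h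
  refine h.trans ?_
  calc C * (ε / (C + 1)) ≤ (C + 1) * (ε / (C + 1)) := by gcongr; exact le_self_add
    _ = ε := ENNReal.mul_div_cancel (by simp) (by simp [hCt])

theorem one_le_sqrt_one_add_sq {H : Type*} [NormedAddCommGroup H] (x : H) : 1 ≤ √(1 + ‖x‖ ^ 2) :=
  Real.one_le_sqrt.2 (by linarith [sq_nonneg ‖x‖])

variable {H : Type*} [NormedAddCommGroup H] [InnerProductSpace ℝ H]

/-- A convex substitute for `‖x‖² / 2` whose gradient is bounded by `1`: the pairing of the gradient
at `z` with an `L¹` function stays integrable even if `z` is unbounded. -/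
theorem sqrt_one_add_sq_convex (x y : H) :
    (√(1 + ‖x‖ ^ 2) - 1) + inner ℝ ((√(1 + ‖x‖ ^ 2))⁻¹ • x) (y - x) ≤ √(1 + ‖y‖ ^ 2) - 1 := by
  have hx := one_le_sqrt_one_add_sq x
  have hy := one_le_sqrt_one_add_sq y
  have hx2 : √(1 + ‖x‖ ^ 2) ^ 2 = 1 + ‖x‖ ^ 2 := Real.sq_sqrt (by positivity)
  have hy2 : √(1 + ‖y‖ ^ 2) ^ 2 = 1 + ‖y‖ ^ 2 := Real.sq_sqrt (by positivity)
  set X := √(1 + ‖x‖ ^ 2)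
  set Y := √(1 + ‖y‖ ^ 2)
  have hcs : inner ℝ x y ≤ ‖x‖ * ‖y‖ := real_inner_le_norm x y
  have hkey : 1 + inner ℝ x y ≤ X * Y := by
    have h1 : 1 + ‖x‖ * ‖y‖ ≤ X * Y := by
      refine abs_le_of_sq_le_sq' ?_ (by positivity) |>.2
      rw [mul_pow, hx2, hy2]
      nlinarith [sq_nonneg (‖x‖ - ‖y‖)]
    linarith
  rw [real_inner_smul_left, inner_sub_right, real_inner_self_eq_norm_sq]
  have hX : 0 < X := by linarith
  have : X⁻¹ * (inner ℝ x y - ‖x‖ ^ 2) ≤ Y - X := by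
    rw [inv_mul_le_iff₀ hX]
    nlinarith
  linarith

theorem norm_smul_sqrt_le (x : H) : ‖(√(1 + ‖x‖ ^ 2))⁻¹ • x‖ ≤ 1 := by
  have hx := one_le_sqrt_one_add_sq x
  rw [norm_smul, norm_inv, Real.norm_of_nonneg (by linarith), inv_mul_le_iff₀ (by linarith), mul_one]
  exact Real.le_sqrt_of_sq_le (by linarith)

variable [CompleteSpace H]

/-- The discrete principle for `transSum`, passed to the limit: the positive part of the defect has
integral zero. -/
theorem ae_sqrt_convexity (hα : 0 < α) (hα₁ : α < 1) {T : ℝ} (hT : 0 < T) {f : ℝ → H}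
    (hf : Integrable f) (hfm : StronglyMeasurable f) (hf0 : ∀ s ∉ Ioc 0 T, f s = 0) :
    ∀ᵐ t, t ∈ Ioc 0 T → √(1 + ‖fracInt α f t‖ ^ 2) - 1 ≤
      fracInt α (fun s => inner ℝ ((√(1 + ‖fracInt α f s‖ ^ 2))⁻¹ • fracInt α f s) (f s)) t := by
  set z := fracInt α f with hz
  set h : H → ℝ := fun x => √(1 + ‖x‖ ^ 2) - 1 with hh
  set p : H → H := fun x => (√(1 + ‖x‖ ^ 2))⁻¹ • x with hp
  have hpc : Continuous p := by
    refine Continuous.smul (Continuous.inv₀ (by fun_prop) fun x => ?_) continuous_id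
    linarith [one_le_sqrt_one_add_sq x]
  have hp1 : ∀ x, ‖p x‖ ≤ 1 := norm_smul_sqrt_le
  have hhp : ∀ x y, h x + inner ℝ (p x) (y - x) ≤ h y := sqrt_one_add_sq_convex
  have hf0' : ∀ s ≤ 0, f s = 0 := fun s hs => hf0 s fun h => by linarith [h.1]
  have hzm : StronglyMeasurable z := stronglyMeasurable_fracInt hfm
  set Z : ℕ → ℝ → H := fun n => transSum α (T / (n + 1)) (n + 1) f with hZ
  have hZm : ∀ n, StronglyMeasurable (Z n) := fun n => stronglyMeasurable_transSum hfm _ _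
  set G : ℝ → ℝ := fun s => inner ℝ (p (z s)) (f s) with hG
  have hGm : StronglyMeasurable G := (hpc.comp_stronglyMeasurable hzm).inner hfm
  have hG0 : ∀ s ≤ 0, G s = 0 := fun s hs => by simp [hG, hf0' s hs]
  have hGb : ∀ x : H, ∀ s, ‖(inner ℝ (p x) (f s) : ℝ)‖ ≤ ‖f s‖ := fun x s =>
    (norm_inner_le_norm _ _).trans (mul_le_of_le_one_left (norm_nonneg _) (hp1 _))
  have hGi : Integrable G :=
    hf.norm.mono' hGm.aestronglyMeasurable (Eventually.of_forall fun s => hGb _ s)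
  -- The error of evaluating the gradient at the approximation `Z n` instead of at `z`. It tends to
  -- zero in `L¹` by domination with `2 ‖f‖`, once `Z n → z` almost everywhere along a subsequence.
  set D : ℕ → ℝ → ℝ := fun n s => inner ℝ (p (Z n s)) (f s) - G s with hD
  have hDm : ∀ n, StronglyMeasurable (D n) := fun n =>
    ((hpc.comp_stronglyMeasurable (hZm n)).inner hfm).sub hGm
  have hlimf := tendsto_lintegral_transSum_sub hα hT hf hfm hf0'
  have hlimG := tendsto_lintegral_transSum_sub hα hT hGi hGm hG0
  obtain ⟨ns, hns, hae⟩ : ∃ ns : ℕ → ℕ, StrictMono ns ∧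
      ∀ᵐ t ∂(volume.restrict (Ioc 0 T)), Tendsto (fun i => Z (ns i) t) atTop (𝓝 (z t)) := by
    refine TendstoInMeasure.exists_seq_tendsto_ae
      (tendstoInMeasure_of_tendsto_eLpNorm (p := 1) one_ne_zero
        (fun n => (hZm n).aestronglyMeasurable) hzm.aestronglyMeasurable ?_)
    simp only [eLpNorm_one_eq_lintegral_enorm]
    exact hlimf
  have hlimD : Tendsto (fun i => ∫⁻ s, ‖D (ns i) s‖ₑ) atTop (𝓝 0) := by
    have h2 : ∫⁻ s, 2 * ‖f s‖ₑ ≠ ⊤ := by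
      rw [lintegral_const_mul _ hfm.enorm]
      exact ENNReal.mul_ne_top (by simp) hf.2.ne
    have := tendsto_lintegral_of_dominated_convergence (fun s => 2 * ‖f s‖ₑ)
      (F := fun i s => ‖D (ns i) s‖ₑ) (f := fun _ => 0) (fun i => (hDm _).enorm)
      (fun i => Eventually.of_forall fun s => ?_) h2 ?_
    · simpa using this
    · change ‖D (ns i) s‖ₑ ≤ 2 * ‖f s‖ₑ
      rw [two_mul]
      refine enorm_sub_le.trans (add_le_add ?_ ?_) <;>
        exact enorm_le_iff_norm_le.2 (hGb _ s)
    · rw [ae_restrict_iff' measurableSet_Ioc] at hae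
      filter_upwards [hae] with s hs
      by_cases hsT : s ∈ Ioc 0 T
      · have h1 : Tendsto (fun i => D (ns i) s) atTop (𝓝 (G s - G s)) :=
          ((((hpc.tendsto _).comp (hs hsT)).inner tendsto_const_nhds)).sub tendsto_const_nhds
        rw [sub_self] at h1
        simpa using h1.enorm
      · simp [hD, hG, hf0 s hsT]
  set C := ∫⁻ r in Ioc 0 T, ‖kern α r‖ₑ with hC
  -- The three errors are the replacement of `z` by `Z n` (the function `h` is 1-Lipschitz), of
  -- `fracInt α G` by its translation sum, and of the gradient at `z` by the one at `Z n`.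
  have hbound : ∀ n, ∫⁻ t in Ioc 0 T, ENNReal.ofReal (h (z t) - fracInt α G t) ≤
      (∫⁻ t in Ioc 0 T, ‖Z n t - z t‖ₑ) +
        ((∫⁻ t in Ioc 0 T, ‖transSum α (T / (n + 1)) (n + 1) G t - fracInt α G t‖ₑ) +
        C * ∫⁻ s, ‖D n s‖ₑ) := by
    intro n
    have hk : 0 < T / ((n : ℝ) + 1) := by positivity
    have hMk : ((n + 1 : ℕ) : ℝ) * (T / ((n : ℝ) + 1)) = T := by push_cast; field_simp
    have hA := lintegral_transSum_le hα hk (n + 1) (hDm n)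
    rw [hMk] at hA
    have hA' := (setLIntegral_le_lintegral (Ioc 0 T) _).trans hA
    refine le_trans ?_ (add_le_add le_rfl (add_le_add le_rfl hA'))
    have hm1 : Measurable fun t => ‖transSum α (T / (n + 1)) (n + 1) (D n) t‖ₑ :=
      (stronglyMeasurable_transSum (hDm n) _ _).enorm
    have hm2 : Measurable fun t => ‖Z n t - z t‖ₑ := ((hZm n).sub hzm).enorm
    rw [← lintegral_add_right _ hm1, ← lintegral_add_left hm2]
    refine setLIntegral_mono' measurableSet_Ioc fun t ht => ?_
    have hc := transSum_convexity hα hα₁ hk hf0' (M := n + 1) (h := h) (p := p) (by simp [hh]) hhp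
      (t := t) (by rwa [hMk])
    have hsplit : transSum α (T / (n + 1)) (n + 1) (fun s => inner ℝ (p (Z n s)) (f s)) t =
        transSum α (T / (n + 1)) (n + 1) G t + transSum α (T / (n + 1)) (n + 1) (D n) t := by
      rw [← transSum_add]
      simp only [hD, add_sub_cancel]
    have hlip : h (z t) - h (Z n t) ≤ ‖Z n t - z t‖ := by
      have h1 := hhp (z t) (Z n t)
      have h2 := (abs_le.1 ((abs_real_inner_le_norm (p (z t)) (Z n t - z t)).trans
        (mul_le_of_le_one_left (norm_nonneg _) (hp1 _)))).1
      linarith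
    have hc : h (Z n t) ≤ _ := hc
    rw [hsplit] at hc
    have hreal : h (z t) - fracInt α G t ≤ ‖Z n t - z t‖ +
        (‖transSum α (T / (n + 1)) (n + 1) G t - fracInt α G t‖ +
          ‖transSum α (T / (n + 1)) (n + 1) (D n) t‖) := by
      have h1 := Real.le_norm_self (transSum α (T / (n + 1)) (n + 1) G t - fracInt α G t)
      have h2 := Real.le_norm_self (transSum α (T / (n + 1)) (n + 1) (D n) t)
      linarith
    refine (ENNReal.ofReal_le_ofReal hreal).trans (le_of_eq ?_)
    rw [ENNReal.ofReal_add (norm_nonneg _) (by positivity),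
      ENNReal.ofReal_add (norm_nonneg _) (norm_nonneg _), ofReal_norm, ofReal_norm, ofReal_norm]
  have hzero : ∫⁻ t in Ioc 0 T, ENNReal.ofReal (h (z t) - fracInt α G t) = 0 := by
    refine le_antisymm (ge_of_tendsto' (x := atTop) ?_ fun i => hbound (ns i)) zero_le
    have h3 := ENNReal.Tendsto.const_mul hlimD (Or.inr (lintegral_kern_lt_top hα T))
    rw [mul_zero] at h3
    have h4 := (hlimf.comp hns.tendsto_atTop).add ((hlimG.comp hns.tendsto_atTop).add h3)
    rw [add_zero, add_zero] at h4
    exact h4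
  rw [lintegral_eq_zero_iff] at hzero
  · rw [EventuallyEq, ae_restrict_iff' measurableSet_Ioc] at hzero
    filter_upwards [hzero] with t ht htT
    have := ht htT
    simp only [Pi.zero_apply, ENNReal.ofReal_eq_zero] at this
    linarith
  · have h1 : Continuous h := by fun_prop
    exact ((h1.comp_stronglyMeasurable hzm).measurable.sub
      (stronglyMeasurable_fracInt hGm).measurable).ennreal_ofReal

/-- The energy inequality `‖z‖² / 2 ≤ J^α δ` for `z = J^α f` with `⟨z, f⟩ ≤ δ`. -/
theorem ae_norm_sq_le_fracInt (hα : 0 < α) (hα₁ : α < 1) {T : ℝ} (hT : 0 < T) {f z : ℝ → H}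
    {δ : ℝ → ℝ} (hf : IntegrableOn f (Ioc 0 T)) (hδ : IntegrableOn δ (Ioc 0 T))
    (hz : ∀ᵐ t, t ∈ Ioc 0 T → z t = fracInt α f t)
    (hδ0 : ∀ᵐ t, t ∈ Ioc 0 T → 0 ≤ δ t)
    (h : ∀ᵐ t, t ∈ Ioc 0 T → inner ℝ (z t) (f t) ≤ δ t) :
    ∀ᵐ t, t ∈ Ioc 0 T → ‖z t‖ ^ 2 ≤ 2 * fracInt α δ t := by
  set g : ℝ → H := (Ioc 0 T).indicator (hf.aestronglyMeasurable.mk f) with hg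
  have hfg : ∀ᵐ s, s ∈ Ioc 0 T → f s = g s := by
    filter_upwards [(ae_restrict_iff' measurableSet_Ioc).1 hf.aestronglyMeasurable.ae_eq_mk]
      with s hs hsT
    rw [hs hsT, hg, indicator_of_mem hsT]
  have hgm : StronglyMeasurable g :=
    hf.aestronglyMeasurable.stronglyMeasurable_mk.indicator measurableSet_Ioc
  have hg0 : ∀ s ∉ Ioc 0 T, g s = 0 := fun s hs => indicator_of_notMem hs _
  have hgi : Integrable g :=
    (integrable_indicator_iff measurableSet_Ioc).2 (hf.congr hf.aestronglyMeasurable.ae_eq_mk)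
  have hzg : ∀ᵐ t, t ∈ Ioc 0 T → z t = fracInt α g t := by
    filter_upwards [hz] with t ht htT
    rw [ht htT, fracInt_congr htT.2 hfg]
  -- Scaling by `l = 1 / (n + 1)` recovers the squared norm, since `√(1 + l²‖z‖²) - 1 ≈ l²‖z‖² / 2`
  -- as `l → 0`. The factor `1 / √(1 + …) ≤ 1` in the gradient is absorbed because `δ ≥ 0`.
  have hscale : ∀ n : ℕ, ∀ᵐ t, t ∈ Ioc 0 T →
      √(1 + ‖(1 / ((n : ℝ) + 1)) • z t‖ ^ 2) - 1 ≤ (1 / ((n : ℝ) + 1)) ^ 2 * fracInt α δ t := by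
    intro n
    set l : ℝ := 1 / ((n : ℝ) + 1) with hl
    have hl0 : 0 < l := by positivity
    have hint : IntegrableOn (fun s => inner ℝ ((√(1 + ‖fracInt α (fun r => l • g r) s‖ ^ 2))⁻¹ •
        fracInt α (fun r => l • g r) s) (l • g s)) (Ioc 0 T) := by
      refine Integrable.mono' (hgi.smul l).norm.integrableOn ?_
        (Eventually.of_forall fun s => (norm_inner_le_norm _ _).trans
          (mul_le_of_le_one_left (norm_nonneg _) (norm_smul_sqrt_le _)))
      have h1 := stronglyMeasurable_fracInt (α := α) (hgm.const_smul l)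
      refine StronglyMeasurable.aestronglyMeasurable (StronglyMeasurable.inner
        (StronglyMeasurable.smul ?_ h1) (hgm.const_smul l))
      exact (Measurable.stronglyMeasurable
        (Measurable.sqrt ((h1.norm.measurable.pow_const 2).const_add 1))).inv₀
    filter_upwards [ae_sqrt_convexity hα hα₁ hT (f := fun r => l • g r) (hgi.smul l) (hgm.const_smul l)
      (fun s hs => by simp [hg0 s hs]), hzg, ae_integrableOn_kern_smul hα hint,
      ae_integrableOn_kern_smul hα (hδ.const_mul (l ^ 2))] with t ht hzt hi1 hi2 htT
    have h1 := ht htT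
    rw [fracInt_smul, ← hzt htT] at h1
    refine h1.trans ?_
    rw [← smul_eq_mul, ← fracInt_smul]
    refine fracInt_mono hα htT.2 (hi1 htT.2) (hi2 htT.2) ?_
    filter_upwards [hzg, hfg, h, hδ0] with s hzs hfs hs hδs hsT
    rw [fracInt_smul, ← hzs hsT, ← hfs hsT]
    have h2 := one_le_sqrt_one_add_sq (l • z s)
    simp only [real_inner_smul_left, inner_smul_right, smul_eq_mul]
    rw [show l * ((√(1 + ‖l • z s‖ ^ 2))⁻¹ * (l * inner ℝ (z s) (f s))) =
      l ^ 2 * ((√(1 + ‖l • z s‖ ^ 2))⁻¹ * inner ℝ (z s) (f s)) by ring]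
    refine mul_le_mul_of_nonneg_left ?_ (by positivity)
    rw [inv_mul_le_iff₀ (by linarith)]
    nlinarith [hs hsT, hδs hsT]
  filter_upwards [ae_all_iff.2 hscale] with t ht htT
  set D := fracInt α δ t with hD
  have hle : ∀ n : ℕ, ‖z t‖ ^ 2 ≤ 2 * D + (1 / ((n : ℝ) + 1)) ^ 2 * D ^ 2 := by
    intro n
    have h1 := ht n htT
    set l : ℝ := 1 / ((n : ℝ) + 1) with hl
    have hl0 : 0 < l := by positivity
    have h2 : 1 + ‖l • z t‖ ^ 2 ≤ (1 + l ^ 2 * D) ^ 2 := by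
      rw [← Real.sqrt_le_sqrt_iff (by positivity)]
      exact (show √(1 + ‖l • z t‖ ^ 2) ≤ 1 + l ^ 2 * D by linarith).trans
        (by rw [Real.sqrt_sq_eq_abs]; exact le_abs_self _)
    rw [norm_smul, Real.norm_of_nonneg hl0.le, mul_pow] at h2
    have h3 : l ^ 2 * ‖z t‖ ^ 2 ≤ l ^ 2 * (2 * D + l ^ 2 * D ^ 2) := by nlinarith
    exact le_of_mul_le_mul_left h3 (by positivity)
  have hlim : Tendsto (fun n : ℕ => 2 * D + (1 / ((n : ℝ) + 1)) ^ 2 * D ^ 2) atTop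
      (𝓝 (2 * D + 0 ^ 2 * D ^ 2)) :=
    ((tendsto_one_div_add_atTop_nhds_zero_nat.pow 2).mul_const _).const_add _
  simpa using ge_of_tendsto' hlim hle

end Comparison

/-! ### Subgradients and proximal points of convex functions. -/

section Convex

variable {H : Type*} [NormedAddCommGroup H] [InnerProductSpace ℝ H] {φ : H → ℝ}

theorem mem_subdiff_of_forall_le {u ξ : H} (h : ∀ w, φ u + inner ℝ ξ (w - u) ≤ φ w) :
    ξ ∈ subdiff φ u := by
  refine Filter.le_liminf_of_le (α := EReal) (by isBoundedDefault)
    (Eventually.of_forall fun w => ?_)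
  rw [EReal.coe_nonneg]
  have := h w
  exact div_nonneg (by linarith) (norm_nonneg _)

theorem convex_line_le (hφ : ConvexOn ℝ univ φ) (u w : H) {t : ℝ} (ht0 : 0 ≤ t) (ht1 : t ≤ 1) :
    φ (u + t • (w - u)) ≤ (1 - t) * φ u + t * φ w := by
  have := hφ.2 (mem_univ u) (mem_univ w) (sub_nonneg.2 ht1) ht0 (by ring)
  rw [show u + t • (w - u) = (1 - t) • u + t • w by module]
  simpa using this

/-- The local condition is tested at `u + t • (w - u)`. Convexity bounds the increment of `φ` there
by `t` times the full increment, so dividing by `t` gives the global inequality up to `ε * ‖w - u‖`.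
-/
theorem le_of_mem_subdiff (hφ : ConvexOn ℝ univ φ) {u ξ : H} (h : ξ ∈ subdiff φ u) (w : H) :
    φ u + inner ℝ ξ (w - u) ≤ φ w := by
  rcases eq_or_ne w u with rfl | hwu
  · simp
  have hd : 0 < ‖w - u‖ := norm_pos_iff.2 (sub_ne_zero.2 hwu)
  have hpath : Tendsto (fun t : ℝ => u + t • (w - u)) (𝓝[>] 0) (𝓝[≠] u) := by
    refine tendsto_nhdsWithin_iff.2 ⟨?_, ?_⟩
    · have : Continuous fun t : ℝ => u + t • (w - u) := by fun_prop
      simpa using (this.tendsto 0).mono_left (nhdsWithin_le_nhds (s := Ioi 0))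
    · filter_upwards [self_mem_nhdsWithin] with t (ht : 0 < t)
      simp [ht.ne', sub_ne_zero.2 hwu]
  have hε : ∀ ε : ℝ, 0 < ε → φ u + inner ℝ ξ (w - u) ≤ φ w + ε * ‖w - u‖ := by
    intro ε hε
    have hlt : ((-ε : ℝ) : EReal) < liminf (fun w : H =>
        (((φ w - φ u - inner ℝ ξ (w - u)) / ‖w - u‖ : ℝ) : EReal)) (𝓝[≠] u) :=
      lt_of_lt_of_le (by exact_mod_cast neg_neg_of_pos hε) h
    have hev := hpath.eventually (eventually_lt_of_lt_liminf hlt)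
    obtain ⟨t, ht, ht0, ht1⟩ := (hev.and (Ioo_mem_nhdsGT one_pos)).exists
    rw [EReal.coe_lt_coe_iff] at ht
    have hc := convex_line_le hφ u w ht0.le ht1.le
    rw [add_sub_cancel_left, inner_smul_right, norm_smul, Real.norm_of_nonneg ht0.le,
      lt_div_iff₀ (by positivity)] at ht
    have : t * (φ u + inner ℝ ξ (w - u)) ≤ t * (φ w + ε * ‖w - u‖) := by nlinarith
    exact le_of_mul_le_mul_left this ht0
  have hlim : Tendsto (fun ε : ℝ => φ w + ε * ‖w - u‖) (𝓝[>] 0) (𝓝 (φ w + 0 * ‖w - u‖)) := by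
    have : Continuous fun ε : ℝ => φ w + ε * ‖w - u‖ := by fun_prop
    exact (this.tendsto 0).mono_left nhdsWithin_le_nhds
  rw [zero_mul, add_zero] at hlim
  exact ge_of_tendsto hlim (by filter_upwards [self_mem_nhdsWithin] with ε h using hε ε h)

theorem subdiff_monotone (hφ : ConvexOn ℝ univ φ) {u v ξ η : H} (hξ : ξ ∈ subdiff φ u)
    (hη : η ∈ subdiff φ v) : 0 ≤ inner ℝ (u - v) (ξ - η) := by
  have h1 := le_of_mem_subdiff hφ hξ v
  have h2 := le_of_mem_subdiff hφ hη u
  rw [← neg_sub u v, inner_neg_right] at h1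
  rw [real_inner_comm, inner_sub_left]
  linarith

/-- Strong convexity at the midpoint, from the parallelogram law. It yields both uniqueness of
minimizers and the Cauchy property of minimizing sequences. -/
theorem prox_midpoint_le (hφ : ConvexOn ℝ univ φ) (B : ℝ) (m x y : H) :
    B * ‖(2⁻¹ : ℝ) • (x + y) - m‖ ^ 2 + φ ((2⁻¹ : ℝ) • (x + y)) + B / 4 * ‖x - y‖ ^ 2 ≤
      2⁻¹ * (B * ‖x - m‖ ^ 2 + φ x) + 2⁻¹ * (B * ‖y - m‖ ^ 2 + φ y) := by
  have h1 := convex_line_le hφ x y (t := 2⁻¹) (by norm_num) (by norm_num)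
  rw [show x + (2⁻¹ : ℝ) • (y - x) = (2⁻¹ : ℝ) • (x + y) by module] at h1
  have h2 := parallelogram_law_with_norm ℝ (x - m) (y - m)
  rw [show x - m - (y - m) = x - y by abel,
    show x - m + (y - m) = (2 : ℝ) • ((2⁻¹ : ℝ) • (x + y) - m) by module, norm_smul] at h2
  rw [Real.norm_of_nonneg (by norm_num : (0 : ℝ) ≤ 2)] at h2
  linear_combination B / 4 * h2 + h1

theorem prox_unique (hφ : ConvexOn ℝ univ φ) {B : ℝ} (hB : 0 < B) {m x y : H}
    (hx : IsMinOn (fun v => B * ‖v - m‖ ^ 2 + φ v) univ x)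
    (hy : IsMinOn (fun v => B * ‖v - m‖ ^ 2 + φ v) univ y) : x = y := by
  have h := prox_midpoint_le hφ B m x y
  have h1 := isMinOn_iff.1 hx ((2⁻¹ : ℝ) • (x + y)) (mem_univ _)
  have h2 := isMinOn_iff.1 hy ((2⁻¹ : ℝ) • (x + y)) (mem_univ _)
  have h3 : ‖x - y‖ ^ 2 ≤ 0 := by
    have : B / 4 * ‖x - y‖ ^ 2 ≤ B / 4 * 0 := by linarith
    exact le_of_mul_le_mul_left this (by positivity)
  have h4 : ‖x - y‖ = 0 := by nlinarith [norm_nonneg (x - y)]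
  exact sub_eq_zero.1 (norm_eq_zero.1 h4)

/-- Minimizing sequences are Cauchy, so they converge in norm and strong lower semicontinuity is
enough; no weak compactness enters. -/
theorem exists_prox [CompleteSpace H] (hφ : ConvexOn ℝ univ φ) (hlsc : LowerSemicontinuous φ)
    (hbd : BddBelow (range φ)) {B : ℝ} (hB : 0 < B) (m : H) :
    ∃ x, IsMinOn (fun v => B * ‖v - m‖ ^ 2 + φ v) univ x := by
  set F : H → ℝ := fun v => B * ‖v - m‖ ^ 2 + φ v with hF
  have hFlsc : LowerSemicontinuous F := by
    refine LowerSemicontinuous.add (Continuous.lowerSemicontinuous ?_) hlsc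
    fun_prop
  obtain ⟨b, hb⟩ := hbd
  have hFb : BddBelow (range F) := by
    refine ⟨b, ?_⟩
    rintro _ ⟨v, rfl⟩
    have := hb (mem_range_self v)
    have : 0 ≤ B * ‖v - m‖ ^ 2 := by positivity
    simp only [hF]
    linarith
  set I := ⨅ v, F v with hI
  have hIle : ∀ v, I ≤ F v := fun v => ciInf_le hFb v
  have hex : ∀ n : ℕ, ∃ v, F v < I + 1 / ((n : ℝ) + 1) := fun n =>
    exists_lt_of_ciInf_lt (lt_add_of_pos_right _ (by positivity))
  choose v hv using hex
  have hdist : ∀ n k, B / 4 * ‖v n - v k‖ ^ 2 ≤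
      2⁻¹ * (1 / ((n : ℝ) + 1)) + 2⁻¹ * (1 / ((k : ℝ) + 1)) := by
    intro n k
    have h1 := prox_midpoint_le hφ B m (v n) (v k)
    have h2 := hIle ((2⁻¹ : ℝ) • (v n + v k))
    have h3 := hv n
    have h4 := hv k
    simp only [hF] at h2 h3 h4
    linarith
  have hcau : CauchySeq v := by
    rw [Metric.cauchySeq_iff']
    intro ε hε
    obtain ⟨N, hN⟩ := exists_nat_one_div_lt (show 0 < B / 4 * ε ^ 2 by positivity)
    refine ⟨N, fun n hn => ?_⟩
    have h1 := hdist n N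
    have h2 : 1 / ((n : ℝ) + 1) ≤ 1 / ((N : ℝ) + 1) := by gcongr
    have h3 : B / 4 * ‖v n - v N‖ ^ 2 < B / 4 * ε ^ 2 := by linarith
    rw [dist_eq_norm]
    exact lt_of_pow_lt_pow_left₀ 2 hε.le (lt_of_mul_lt_mul_left h3 (by positivity))
  obtain ⟨x, hx⟩ := cauchySeq_tendsto_of_complete hcau
  have hFx : F x ≤ I := by
    by_contra hlt
    rw [not_le] at hlt
    obtain ⟨y, hy1, hy2⟩ := exists_between hlt
    have h1 := hx.eventually (hFlsc x y hy2)
    have h2 : Tendsto (fun n : ℕ => I + 1 / ((n : ℝ) + 1)) atTop (𝓝 (I + 0)) :=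
      tendsto_one_div_add_atTop_nhds_zero_nat.const_add I
    rw [add_zero] at h2
    obtain ⟨n, hn1, hn2⟩ := (h1.and (h2.eventually (gt_mem_nhds hy1))).exists
    linarith [hv n]
  exact ⟨x, isMinOn_iff.2 fun w _ => hFx.trans (hIle w)⟩

/-- A comparison of `x` with `x + t • (w - x)`, divided by `t`: the quadratic term leaves its
gradient and a remainder of order `t`. -/
theorem prox_mem_subdiff (hφ : ConvexOn ℝ univ φ) {B : ℝ} {m x : H}
    (hx : IsMinOn (fun v => B * ‖v - m‖ ^ 2 + φ v) univ x) : (2 * B) • (m - x) ∈ subdiff φ x := by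
  refine mem_subdiff_of_forall_le fun w => ?_
  have hlim : Tendsto (fun t : ℝ => φ w + B * t * ‖w - x‖ ^ 2) (𝓝[>] 0)
      (𝓝 (φ w + B * 0 * ‖w - x‖ ^ 2)) := by
    have : Continuous fun t : ℝ => φ w + B * t * ‖w - x‖ ^ 2 := by fun_prop
    exact (this.tendsto 0).mono_left nhdsWithin_le_nhds
  rw [mul_zero, zero_mul, add_zero] at hlim
  refine ge_of_tendsto hlim ?_
  filter_upwards [Ioo_mem_nhdsGT one_pos] with t ht
  have h1 := isMinOn_iff.1 hx (x + t • (w - x)) (mem_univ _)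
  have h2 := convex_line_le hφ x w ht.1.le ht.2.le
  have h3 : ‖x + t • (w - x) - m‖ ^ 2 =
      ‖x - m‖ ^ 2 + 2 * (t * inner ℝ (x - m) (w - x)) + t ^ 2 * ‖w - x‖ ^ 2 := by
    rw [show x + t • (w - x) - m = (x - m) + t • (w - x) by abel, norm_add_sq_real,
      inner_smul_right, norm_smul, mul_pow, Real.norm_eq_abs, sq_abs]
  rw [h3] at h1
  rw [real_inner_smul_left, ← neg_sub x m, inner_neg_left]
  have h4 : t * (φ x + 2 * B * -inner ℝ (x - m) (w - x)) ≤ t * (φ w + B * t * ‖w - x‖ ^ 2) := by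
    nlinarith
  exact le_of_mul_le_mul_left h4 ht.1

end Convex

/-! ### Well-posedness, Euler-Lagrange equations and energy of the scheme. -/

section Scheme

variable {α k : ℝ} {H : Type*} [NormedAddCommGroup H] [InnerProductSpace ℝ H] {φ : H → ℝ} {u₀ : H}

/-- The barycentre of the earlier values that enter the step functional. -/
noncomputable def stepMean (α : ℝ) (U : ℕ → H) (n : ℕ) : H :=
  (c α 0)⁻¹ • (∑ j ∈ Finset.Ico 1 n, c α j • U (n - j) + cc α n • U 0)

theorem c_zero_pos (hα : 0 < α) : 0 < c α 0 := by
  rw [c_zero]; exact aInv_zero_pos hα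

theorem stepMean_congr {U W : ℕ → H} {n : ℕ} (hn : 1 ≤ n) (h : ∀ i < n, U i = W i) :
    stepMean α U n = stepMean α W n := by
  unfold stepMean
  rw [h 0 hn]
  congr 2
  refine Finset.sum_congr rfl fun j hj => ?_
  have := Finset.mem_Ico.1 hj
  rw [h (n - j) (by omega)]

/-- The weights `c α j` and `cc α n` sum to `c α 0`, so completing the square turns each step into a
proximal step around the barycentre of the past. -/
theorem exists_stepFunctional_eq (hα : 0 < α) (φ : H → ℝ) (k : ℝ) (U : ℕ → H) (n : ℕ) :
    ∃ K, ∀ v, stepFunctional φ α k U n v =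
      (c α 0 / (2 * k ^ α) * ‖v - stepMean α U n‖ ^ 2 + φ v) + K := by
  have hc := c_zero_pos hα
  set m := stepMean α U n with hm
  have hcm : c α 0 • m = ∑ j ∈ Finset.Ico 1 n, c α j • U (n - j) + cc α n • U 0 := by
    rw [hm, stepMean, smul_inv_smul₀ hc.ne']
  set S := ∑ j ∈ Finset.Ico 1 n, c α j * ‖U (n - j)‖ ^ 2 + cc α n * ‖U 0‖ ^ 2 with hS
  refine ⟨1 / (2 * k ^ α) * (S - c α 0 * ‖m‖ ^ 2), fun v => ?_⟩
  have hinner : c α 0 * inner ℝ v m =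
      ∑ j ∈ Finset.Ico 1 n, c α j * inner ℝ v (U (n - j)) + cc α n * inner ℝ v (U 0) := by
    rw [← inner_smul_right, hcm, inner_add_right, inner_sum, inner_smul_right]
    simp only [inner_smul_right]
  have hquad : ∑ j ∈ Finset.Ico 1 n, c α j * ‖v - U (n - j)‖ ^ 2 + cc α n * ‖v - U 0‖ ^ 2 =
      c α 0 * ‖v‖ ^ 2 - 2 * (c α 0 * inner ℝ v m) + S := by
    have h1 : ∀ j, c α j * ‖v - U (n - j)‖ ^ 2 = c α j * ‖v‖ ^ 2 -
        2 * (c α j * inner ℝ v (U (n - j))) + c α j * ‖U (n - j)‖ ^ 2 := fun j => by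
      rw [norm_sub_sq_real]; ring
    simp only [h1]
    rw [Finset.sum_add_distrib, Finset.sum_sub_distrib, ← Finset.sum_mul, ← Finset.mul_sum, hinner,
      norm_sub_sq_real]
    have h2 : c α 0 = ∑ j ∈ Finset.Ico 1 n, c α j + cc α n := by rw [cc]; ring
    rw [h2, hS]
    ring
  rw [stepFunctional, hquad, norm_sub_sq_real]
  ring

theorem isMinOn_stepFunctional_iff (hα : 0 < α) (φ : H → ℝ) (k : ℝ) (U : ℕ → H) (n : ℕ) (x : H) :
    IsMinOn (stepFunctional φ α k U n) univ x ↔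
      IsMinOn (fun v => c α 0 / (2 * k ^ α) * ‖v - stepMean α U n‖ ^ 2 + φ v) univ x := by
  obtain ⟨K, hK⟩ := exists_stepFunctional_eq hα φ k U n
  simp only [isMinOn_iff, hK, add_le_add_iff_right]

/-- The sequence generated by a map `P` from the barycentres to the next value. -/
noncomputable def schemeSeq (α : ℝ) (P : H → H) (u₀ : H) : ℕ → H
  | 0 => u₀
  -- The cut-off makes the recursion well-founded; `stepMean` at `n + 1` reads only indices up to
  -- `n`, so the default `0` is never used.
  | n + 1 => P (stepMean α (fun i => if _h : i < n + 1 then schemeSeq α P u₀ i else 0) (n + 1))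

theorem exists_isScheme [CompleteSpace H] (hα : 0 < α) (hφ : ConvexOn ℝ univ φ)
    (hlsc : LowerSemicontinuous φ) (hbd : BddBelow (range φ)) (hk : 0 < k) (u₀ : H) :
    ∃ U, IsScheme φ α k u₀ U := by
  have hB : 0 < c α 0 / (2 * k ^ α) := by
    have := c_zero_pos hα
    have := Real.rpow_pos_of_pos hk α
    positivity
  choose P hP using exists_prox hφ hlsc hbd hB
  refine ⟨schemeSeq α P u₀, by rw [schemeSeq], fun n hn => ?_⟩
  obtain ⟨n, rfl⟩ : ∃ m, n = m + 1 := ⟨n - 1, by omega⟩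
  rw [isMinOn_stepFunctional_iff hα]
  have h : schemeSeq α P u₀ (n + 1) = P (stepMean α (schemeSeq α P u₀) (n + 1)) := by
    rw [schemeSeq]
    congr 1
    exact stepMean_congr (by omega) fun i hi => by simp [hi]
  rw [h]
  exact hP _

theorem IsScheme.unique (hα : 0 < α) (hφ : ConvexOn ℝ univ φ) (hk : 0 < k) {U W : ℕ → H}
    (hU : IsScheme φ α k u₀ U) (hW : IsScheme φ α k u₀ W) : W = U := by
  have hB : 0 < c α 0 / (2 * k ^ α) := by
    have := c_zero_pos hα
    have := Real.rpow_pos_of_pos hk α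
    positivity
  ext n
  induction n using Nat.strong_induction_on with
  | _ n ih =>
    rcases Nat.eq_zero_or_pos n with rfl | hn
    · rw [hU.1, hW.1]
    · have h1 := (isMinOn_stepFunctional_iff hα φ k U n _).1 (hU.2 n hn)
      have h2 := (isMinOn_stepFunctional_iff hα φ k W n _).1 (hW.2 n hn)
      rw [stepMean_congr hn ih] at h2
      exact prox_unique hφ hB h2 h1

/-- The Euler-Lagrange equations of the scheme, solved for `U` by discrete fractional
integration. -/
theorem IsScheme.exists_subgradients (hα : 0 < α) (hφ : ConvexOn ℝ univ φ) (hk : 0 < k)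
    {U : ℕ → H} (hU : IsScheme φ α k u₀ U) :
    ∃ ξ : ℕ → H, (∀ n, ξ (n + 1) ∈ subdiff φ (U (n + 1))) ∧
      ∀ n, U n = u₀ - k ^ α • ∑ j ∈ Finset.range n, a α (n - 1 - j) • ξ (j + 1) := by
  have hka := Real.rpow_pos_of_pos hk α
  have hc := c_zero_pos hα
  refine ⟨fun n => (2 * (c α 0 / (2 * k ^ α))) • (stepMean α U n - U n), fun n =>
    prox_mem_subdiff hφ ((isMinOn_stepFunctional_iff hα φ k U _ _).1 (hU.2 (n + 1) (by omega))),
    fun n => ?_⟩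
  -- Up to sign, `k ^ α • ξ` is the discrete Caputo derivative of `U`, that is, a convolution with
  -- `aInv`; convolving with `a` recovers `U`.
  have hξ : ∀ n, k ^ α • ((2 * (c α 0 / (2 * k ^ α))) • (stepMean α U (n + 1) - U (n + 1))) =
      -∑ i ∈ Finset.range (n + 1), aInv α i • (U (n + 1 - i) - U 0) := by
    intro n
    rw [smul_smul, show k ^ α * (2 * (c α 0 / (2 * k ^ α))) = c α 0 by field_simp, smul_sub,
      stepMean, smul_inv_smul₀ hc.ne', sum_aInv_sub]
    have h2 : c α 0 = ∑ j ∈ Finset.Ico 1 (n + 1), c α j + cc α (n + 1) := by rw [cc]; ring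
    rw [h2, add_smul, Finset.sum_smul]
    simp only [smul_sub, Finset.sum_sub_distrib]
    abel
  cases n with
  | zero => simp [hU.1]
  | succ n =>
    have h1 := conv_a_conv_aInv hα (fun n => U (n + 1) - U 0) n
    rw [Finset.smul_sum, ← Finset.sum_range_reflect]
    have h2 : ∀ j ∈ Finset.range (n + 1), k ^ α • a α (n + 1 - 1 - (n + 1 - 1 - j)) •
        (2 * (c α 0 / (2 * k ^ α))) • (stepMean α U (n + 1 - 1 - j + 1) -
          U (n + 1 - 1 - j + 1)) =
        -(a α j • ∑ i ∈ Finset.range (n - j + 1), aInv α (n - j - i) • (U (i + 1) - U 0)) := by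
      intro j hj
      have hj := Finset.mem_range.1 hj
      rw [smul_comm, hξ, show n + 1 - 1 - (n + 1 - 1 - j) = j by omega, smul_neg,
        show n + 1 - 1 - j = n - j by omega, ← Finset.sum_range_reflect]
      congr 2
      refine Finset.sum_congr rfl fun i hi => ?_
      have hi := Finset.mem_range.1 hi
      congr 2
      congr 1
      omega
    rw [Finset.sum_congr rfl h2, Finset.sum_neg_distrib, h1, hU.1]
    abel

/-- The energy estimate of the scheme. -/
theorem scheme_energy_le (hα : 0 < α) (hα₁ : α < 1) (hφ : ConvexOn ℝ univ φ)
    (hbd : BddBelow (range φ)) {U ξ : ℕ → H}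
    (hξ : ∀ n, ξ (n + 1) ∈ subdiff φ (U (n + 1)))
    (hU : ∀ n, U n = u₀ - k ^ α • ∑ j ∈ Finset.range n, a α (n - 1 - j) • ξ (j + 1)) (n : ℕ) :
    k ^ α * ∑ j ∈ Finset.range n, a α (n - 1 - j) * ‖ξ (j + 1)‖ ^ 2 ≤ φ u₀ - ⨅ v, φ v := by
  have hU0 : U 0 = u₀ := by simpa using hU 0
  -- The increments are minus the subgradients, so the pairing in the convexity principle becomes
  -- `-k ^ α * ‖ξ‖²`.
  have h := discrete_convexity hα hα₁ (z := U) (F := fun j => -(k ^ α • ξ (j + 1))) (p := ξ)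
    (Φ := fun n => φ (U n)) (fun n => by
      rw [hU n, hU0, Finset.smul_sum, sub_eq_add_neg, ← Finset.sum_neg_distrib]
      congr 1
      refine Finset.sum_congr rfl fun j _ => ?_
      rw [smul_neg, smul_comm]) (fun n m => le_of_mem_subdiff hφ (hξ n) _) n
  simp only [inner_neg_right, inner_smul_right, real_inner_self_eq_norm_sq, hU0, mul_neg,
    Finset.sum_neg_distrib] at h
  have h2 : (⨅ v, φ v) ≤ φ (U n) := ciInf_le hbd _
  rw [Finset.mul_sum]
  have h3 : ∀ j, k ^ α * (a α (n - 1 - j) * ‖ξ (j + 1)‖ ^ 2) =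
      a α (n - 1 - j) * (k ^ α * ‖ξ (j + 1)‖ ^ 2) := fun j => by ring
  simp only [h3]
  linarith

end Scheme

/-! ### Uniform bounds for the interpolants and comparison of two time steps. -/

section Interpolation

variable {α k : ℝ} {H : Type*} [NormedAddCommGroup H] [InnerProductSpace ℝ H] {φ : H → ℝ} {u₀ : H}
  {U ξ : ℕ → H}

/-- A solution of the discretized equation together with its subgradients. -/
structure IsDiscreteSolution (φ : H → ℝ) (α k : ℝ) (u₀ : H) (U ξ : ℕ → H) : Prop where
  mem_subdiff : ∀ n, ξ (n + 1) ∈ subdiff φ (U (n + 1))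
  eq_sum : ∀ n, U n = u₀ - k ^ α • ∑ j ∈ Finset.range n, a α (n - 1 - j) • ξ (j + 1)

/-- The natural interpolation of a discrete solution. -/
noncomputable def interp (α k : ℝ) (u₀ : H) (ξ : ℕ → H) (t : ℝ) : H :=
  u₀ - fracInt α (stepFun k ξ) t

theorem IsDiscreteSolution.interp_grid [CompleteSpace H] (hα : 0 < α) (hk : 0 < k)
    (h : IsDiscreteSolution φ α k u₀ U ξ) (n : ℕ) : interp α k u₀ ξ (n * k) = U n := by
  rw [interp, fracInt_stepFun hα hk, h.eq_sum]

theorem IsDiscreteSolution.stepFun_mem_subdiff (hk : 0 < k)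
    (h : IsDiscreteSolution φ α k u₀ U ξ) {t : ℝ} (ht : 0 < t) :
    stepFun k ξ t ∈ subdiff φ (stepFun k U t) := by
  obtain ⟨n, h1, h2⟩ := exists_mem_cell hk ht
  rw [stepFun_apply hk _ h1 h2, stepFun_apply hk _ h1 h2]
  exact h.mem_subdiff n

theorem IsDiscreteSolution.fracInt_norm_sq_le (hα : 0 < α) (hα₁ : α < 1)
    (hφ : ConvexOn ℝ univ φ) (hbd : BddBelow (range φ)) (hk : 0 < k)
    (h : IsDiscreteSolution φ α k u₀ U ξ) (t : ℝ) :
    fracInt α (fun s => ‖stepFun k ξ s‖ ^ 2) t ≤ 2 * (φ u₀ - ⨅ v, φ v) :=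
  fracInt_stepFun_le hα hα₁ hk (F := fun n => ‖ξ n‖ ^ 2) (fun n => by positivity)
    (scheme_energy_le hα hα₁ hφ hbd h.mem_subdiff h.eq_sum) t

theorem IsDiscreteSolution.norm_interp_sub_le (hα : 0 < α) (hα₁ : α < 1)
    (hφ : ConvexOn ℝ univ φ) (hbd : BddBelow (range φ)) (hk : 0 < k)
    (h : IsDiscreteSolution φ α k u₀ U ξ) {s t : ℝ} (hs : 0 ≤ s) (ht : 0 ≤ t) :
    ‖interp α k u₀ ξ t - interp α k u₀ ξ s‖ ≤
      2 * √(2 * (φ u₀ - ⨅ v, φ v) / Real.Gamma (1 + α)) * |t - s| ^ (α / 2) := by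
  wlog hst : s ≤ t generalizing s t
  · rw [norm_sub_rev, abs_sub_comm]
    exact this ht hs (le_of_not_ge hst)
  obtain ⟨M, hM⟩ := exists_bound_stepFun hk ξ t
  have := norm_fracInt_sub_le hα hα₁ (stronglyMeasurable_stepFun k ξ).aestronglyMeasurable hs hst hM
    (h.fracInt_norm_sq_le hα hα₁ hφ hbd hk s) (h.fracInt_norm_sq_le hα hα₁ hφ hbd hk t)
  rw [abs_of_nonneg (sub_nonneg.2 hst), interp, interp, sub_sub_sub_cancel_left, norm_sub_rev]
  exact this

theorem continuousOn_of_holder {E : Type*} [NormedAddCommGroup E] {f : ℝ → E} {s : Set ℝ} {C b : ℝ}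
    (hb : 0 < b) (h : ∀ x ∈ s, ∀ y ∈ s, ‖f y - f x‖ ≤ C * |y - x| ^ b) : ContinuousOn f s := by
  intro x hx
  rw [ContinuousWithinAt, tendsto_iff_norm_sub_tendsto_zero]
  have hlim : Tendsto (fun y : ℝ => C * |y - x| ^ b) (𝓝[s] x) (𝓝 (C * |x - x| ^ b)) := by
    have : Continuous fun y : ℝ => C * |y - x| ^ b :=
      continuous_const.mul ((continuous_id.sub continuous_const).abs.rpow_const
        fun _ => Or.inr hb.le)
    exact (this.tendsto x).mono_left nhdsWithin_le_nhds
  rw [sub_self, abs_zero, Real.zero_rpow hb.ne', mul_zero] at hlim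
  exact squeeze_zero' (Eventually.of_forall fun _ => norm_nonneg _)
    (by filter_upwards [self_mem_nhdsWithin] with y hy using h x hx y hy) hlim

/-- The step function takes the value of the interpolant at the right end of the cell, at distance
at most `k`, so this is the Hölder bound. -/
theorem IsDiscreteSolution.norm_stepFun_sub_interp_le [CompleteSpace H] (hα : 0 < α) (hα₁ : α < 1)
    (hφ : ConvexOn ℝ univ φ) (hbd : BddBelow (range φ)) (hk : 0 < k)
    (h : IsDiscreteSolution φ α k u₀ U ξ) {t : ℝ} (ht : 0 < t) :
    ‖stepFun k U t - interp α k u₀ ξ t‖ ≤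
      2 * √(2 * (φ u₀ - ⨅ v, φ v) / Real.Gamma (1 + α)) * k ^ (α / 2) := by
  obtain ⟨n, h1, h2⟩ := exists_mem_cell hk ht
  rw [stepFun_apply hk _ h1 h2, ← h.interp_grid hα hk]
  have h3 : t ≤ (n + 1 : ℕ) * k := by simpa using h2
  refine (h.norm_interp_sub_le hα hα₁ hφ hbd hk ht.le (ht.le.trans h3)).trans ?_
  gcongr
  rw [abs_of_nonneg (by linarith)]
  push_cast
  linarith

/-- Cauchy-Schwarz with weight `kern α (t - s)`, of mass at most `T ^ α / Γ(1 + α)`. This controls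
the norms of the subgradients in the comparison of two steps. -/
theorem IsDiscreteSolution.fracInt_norm_le (hα : 0 < α) (hα₁ : α < 1)
    (hφ : ConvexOn ℝ univ φ) (hbd : BddBelow (range φ)) (hk : 0 < k)
    (h : IsDiscreteSolution φ α k u₀ U ξ) {t T : ℝ} (ht : 0 ≤ t) (htT : t ≤ T) :
    fracInt α (fun s => ‖stepFun k ξ s‖) t ≤
      √(T ^ α / Real.Gamma (1 + α)) * √(2 * (φ u₀ - ⨅ v, φ v)) := by
  refine (integral_weight_mul_le (fun s => kern_nonneg hα _) (fun s => norm_nonneg _)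
    (stronglyMeasurable_stepFun k ξ).norm.aestronglyMeasurable (integrableOn_kern_sub hα t 0)
    (integrableOn_kern_stepFun hα hk (fun n => ‖ξ n‖ ^ 2) t) ?_
    (h.fracInt_norm_sq_le hα hα₁ hφ hbd hk t)).2
  rw [setIntegral_kern_sub hα ht, sub_zero]
  have := Gamma_one_add_pos hα
  gcongr

theorem energy_nonneg {H : Type*} {φ : H → ℝ} (hbd : BddBelow (range φ)) (u₀ : H) :
    0 ≤ φ u₀ - ⨅ v, φ v :=
  sub_nonneg.2 (ciInf_le hbd _)

/-- Comparison of two discrete solutions with different time steps. -/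
theorem IsDiscreteSolution.norm_sub_sq_le [CompleteSpace H] (hα : 0 < α) (hα₁ : α < 1)
    (hφ : ConvexOn ℝ univ φ) (hbd : BddBelow (range φ)) (hk : 0 < k)
    (h : IsDiscreteSolution φ α k u₀ U ξ) {k' : ℝ} (hk' : 0 < k') {U' ξ' : ℕ → H}
    (h' : IsDiscreteSolution φ α k' u₀ U' ξ') {T : ℝ} (hT : 0 < T) {t : ℝ} (ht : t ∈ Icc 0 T) :
    ‖interp α k u₀ ξ t - interp α k' u₀ ξ' t‖ ^ 2 ≤
      16 * √(T ^ α) / Real.Gamma (1 + α) * (φ u₀ - ⨅ v, φ v) * (k ^ (α / 2) + k' ^ (α / 2)) := by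
  have hG := Gamma_one_add_pos hα
  have hE : 0 ≤ φ u₀ - ⨅ v, φ v := energy_nonneg hbd u₀
  set E := φ u₀ - ⨅ v, φ v with hEdef
  -- The sum of the two interpolation errors.
  set D := 2 * √(2 * E / Real.Gamma (1 + α)) * (k ^ (α / 2) + k' ^ (α / 2)) with hD
  have hD0 : 0 ≤ D := by positivity
  set X := stepFun k ξ with hX
  set X' := stepFun k' ξ' with hX'
  set z : ℝ → H := fun t => interp α k u₀ ξ t - interp α k' u₀ ξ' t with hz
  have hXm : StronglyMeasurable X := stronglyMeasurable_stepFun k ξ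
  have hXm' : StronglyMeasurable X' := stronglyMeasurable_stepFun k' ξ'
  have hint : ∀ {F : ℕ → H} {l : ℝ}, 0 < l → IntegrableOn (stepFun l F) (Ioc 0 T) := by
    intro F l hl
    obtain ⟨M, hM⟩ := exists_bound_stepFun hl F T
    exact IntegrableOn.of_bound (by simp) (stronglyMeasurable_stepFun l F).aestronglyMeasurable M
      ((ae_restrict_iff' measurableSet_Ioc).2 (Eventually.of_forall hM))
  have hJ : ∀ t, fracInt α (fun s => X' s - X s) t = z t := by
    intro t
    simp only [hz, interp, fracInt, smul_sub]
    rw [integral_sub (integrableOn_kern_stepFun hα hk' ξ' t) (integrableOn_kern_stepFun hα hk ξ t)]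
    abel
  have hJδ : ∀ t ∈ Icc 0 T, fracInt α (fun s => D * (‖X s‖ + ‖X' s‖)) t ≤
      D * (2 * (√(T ^ α / Real.Gamma (1 + α)) * √(2 * E))) := by
    intro t ht
    have h1 := h.fracInt_norm_le hα hα₁ hφ hbd hk ht.1 ht.2
    have h2 := h'.fracInt_norm_le hα hα₁ hφ hbd hk' ht.1 ht.2
    rw [show (fun s => D * (‖X s‖ + ‖X' s‖)) = fun s => D • (‖X s‖ + ‖X' s‖) from rfl, fracInt_smul,
      smul_eq_mul]
    refine mul_le_mul_of_nonneg_left ?_ hD0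
    have h3 : fracInt α (fun s => ‖X s‖ + ‖X' s‖) t =
        fracInt α (fun s => ‖X s‖) t + fracInt α (fun s => ‖X' s‖) t := by
      simp only [fracInt, smul_add]
      exact integral_add (integrableOn_kern_stepFun hα hk (fun n => ‖ξ n‖) t)
        (integrableOn_kern_stepFun hα hk' (fun n => ‖ξ' n‖) t)
    linarith
  have hae := ae_norm_sq_le_fracInt hα hα₁ hT (f := fun s => X' s - X s) (z := z)
    (δ := fun s => D * (‖X s‖ + ‖X' s‖)) ((hint hk').sub (hint hk))
    (((hint hk).norm.add (hint hk').norm).const_mul D)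
    (Eventually.of_forall fun t _ => (hJ t).symm)
    (Eventually.of_forall fun t _ => by positivity)
    (Eventually.of_forall fun t ht => by
      have h1 := subdiff_monotone hφ (h.stepFun_mem_subdiff hk ht.1)
        (h'.stepFun_mem_subdiff hk' ht.1)
      have h2 := h.norm_stepFun_sub_interp_le hα hα₁ hφ hbd hk ht.1
      have h3 := h'.norm_stepFun_sub_interp_le hα hα₁ hφ hbd hk' ht.1
      set P := stepFun k U t
      set P' := stepFun k' U' t
      -- The subgradients belong to the step values `P`, `P'` and not to the interpolants.
      -- Monotonicity disposes of the part with `P - P'`; the remainder is paired with a vector of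
      -- norm at most `D`.
      have h4 : inner ℝ (z t) (X' t - X t) = inner ℝ ((P - interp α k u₀ ξ t) -
          (P' - interp α k' u₀ ξ' t)) (X t - X' t) - inner ℝ (P - P') (X t - X' t) := by
        rw [← inner_sub_left, ← neg_sub (X t), inner_neg_right, ← inner_neg_left]
        congr 1
        simp only [hz]
        abel
      rw [h4]
      have h5 := real_inner_le_norm ((P - interp α k u₀ ξ t) - (P' - interp α k' u₀ ξ' t))
        (X t - X' t)
      have h6 : ‖(P - interp α k u₀ ξ t) - (P' - interp α k' u₀ ξ' t)‖ ≤ D := by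
        refine (norm_sub_le _ _).trans ((add_le_add h2 h3).trans (le_of_eq ?_))
        rw [hD]; ring
      have h7 := norm_sub_le (X t) (X' t)
      have h8 := mul_le_mul h6 h7 (norm_nonneg _) hD0
      linarith)
  set B := D * (4 * (√(T ^ α / Real.Gamma (1 + α)) * √(2 * E))) with hB
  have hzc : ContinuousOn z (Icc 0 T) := by
    have hc1 : ContinuousOn (interp α k u₀ ξ) (Icc 0 T) :=
      continuousOn_of_holder (by linarith) fun x hx y hy =>
        h.norm_interp_sub_le hα hα₁ hφ hbd hk hx.1 hy.1
    have hc2 : ContinuousOn (interp α k' u₀ ξ') (Icc 0 T) :=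
      continuousOn_of_holder (by linarith) fun x hx y hy =>
        h'.norm_interp_sub_le hα hα₁ hφ hbd hk' hx.1 hy.1
    exact hc1.sub hc2
  -- The bound holds almost everywhere, hence on a dense set, and passes to every time, end points
  -- included, by continuity of `z`.
  have hgood : ∀ t ∈ Icc 0 T, ‖z t‖ ^ 2 ≤ B := by
    have hd : Dense {t : ℝ | t ∈ Ioc 0 T → ‖z t‖ ^ 2 ≤ B} := by
      refine Measure.dense_of_ae (μ := volume) ?_
      filter_upwards [hae] with t ht htT
      have := hJδ t ⟨htT.1.le, htT.2⟩
      have := ht htT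
      rw [hB]
      linarith
    intro t ht
    have htc : t ∈ closure (Ioo 0 T ∩ {t : ℝ | t ∈ Ioc 0 T → ‖z t‖ ^ 2 ≤ B}) := by
      rw [← closure_Ioo hT.ne] at ht
      exact closure_minimal (hd.open_subset_closure_inter isOpen_Ioo) isClosed_closure ht
    have hcw : ContinuousWithinAt (fun t => ‖z t‖ ^ 2)
        (Ioo 0 T ∩ {t : ℝ | t ∈ Ioc 0 T → ‖z t‖ ^ 2 ≤ B}) t :=
      ((hzc.norm.pow 2) t ht).mono fun s hs => Ioo_subset_Icc_self hs.1
    exact hcw.closure_le htc continuousWithinAt_const fun s hs => hs.2 (Ioo_subset_Ioc_self hs.1)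
  refine (hgood t ht).trans (le_of_eq ?_)
  have hs1 : √(2 * E / Real.Gamma (1 + α)) * √(2 * E) * √(T ^ α / Real.Gamma (1 + α)) =
      2 * E * √(T ^ α) / Real.Gamma (1 + α) := by
    rw [Real.sqrt_div (by positivity), Real.sqrt_div (by positivity)]
    have h1 : √(2 * E) * √(2 * E) = 2 * E := Real.mul_self_sqrt (by positivity)
    have h2 : √(Real.Gamma (1 + α)) * √(Real.Gamma (1 + α)) = Real.Gamma (1 + α) :=
      Real.mul_self_sqrt hG.le
    calc _ = (√(2 * E) * √(2 * E)) * √(T ^ α) /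
        (√(Real.Gamma (1 + α)) * √(Real.Gamma (1 + α))) := by ring
      _ = _ := by rw [h1, h2]
  calc B = 8 * (√(2 * E / Real.Gamma (1 + α)) * √(2 * E) * √(T ^ α / Real.Gamma (1 + α))) *
      (k ^ (α / 2) + k' ^ (α / 2)) := by rw [hB, hD]; ring
    _ = _ := by rw [hs1]; ring

end Interpolation

/-! ### Weak limits: measurability and closedness of the subdifferential. -/

section Weak

variable {H : Type*} [NormedAddCommGroup H] [InnerProductSpace ℝ H]

theorem exists_norm_le_of_weak_tendsto [CompleteSpace H] {x : ℕ → H} {y : H}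
    (h : ∀ v, Tendsto (fun n => inner ℝ (x n) v) atTop (𝓝 (inner ℝ y v))) :
    ∃ M, ∀ n, ‖x n‖ ≤ M := by
  obtain ⟨M, hM⟩ := banach_steinhaus (g := fun n => innerSL ℝ (x n)) fun v => by
    obtain ⟨C, hC⟩ := (h v).norm.bddAbove_range
    exact ⟨C, fun n => hC ⟨n, rfl⟩⟩
  exact ⟨M, fun n => by simpa using hM n⟩

/-- Pettis' theorem for separable inner product spaces. -/
theorem stronglyMeasurable_of_inner [TopologicalSpace.SeparableSpace H] {X : Type*}
    [MeasurableSpace X] {f : X → H} (hf : ∀ v, Measurable fun x => inner ℝ (f x) v) :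
    StronglyMeasurable f := by
  borelize H
  refine Measurable.stronglyMeasurable ?_
  set d := TopologicalSpace.denseSeq H with hd
  have hdense : DenseRange d := TopologicalSpace.denseRange_denseSeq H
  -- A closed ball is cut out by countably many scalar inequalities, one for each dense direction,
  -- and each of these defines a measurable set of parameters.
  have hball : ∀ (x : H) (r : ℝ), 0 ≤ r →
      f ⁻¹' Metric.closedBall x r = ⋂ j, {t | inner ℝ (f t) (d j) - inner ℝ x (d j) ≤ r * ‖d j‖} := by
    intro x r hr
    ext t
    simp only [mem_preimage, Metric.mem_closedBall, dist_eq_norm, mem_iInter, mem_ofPred_eq,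
      ← inner_sub_left]
    constructor
    · intro h j
      exact (real_inner_le_norm _ _).trans (mul_le_mul_of_nonneg_right h (norm_nonneg _))
    · intro h
      have hall : ∀ v, inner ℝ (f t - x) v ≤ r * ‖v‖ := by
        intro v
        exact hdense.induction_on (p := fun v => inner ℝ (f t - x) v ≤ r * ‖v‖) v
          (isClosed_le (by fun_prop) (by fun_prop)) h
      have h1 := hall (f t - x)
      rw [real_inner_self_eq_norm_sq] at h1
      rcases (norm_nonneg (f t - x)).eq_or_lt with h0 | h0
      · rw [← h0]; exact hr
      · exact le_of_mul_le_mul_right (by nlinarith) h0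
  refine measurable_of_isOpen fun O hO => ?_
  have hO' : f ⁻¹' O = ⋃ (i : ℕ) (q : ℚ) (_ : 0 ≤ q ∧ Metric.closedBall (d i) q ⊆ O),
      f ⁻¹' Metric.closedBall (d i) q := by
    ext t
    simp only [mem_preimage, mem_iUnion, exists_prop]
    constructor
    · intro ht
      obtain ⟨ε, hε, hb⟩ := Metric.isOpen_iff.1 hO _ ht
      obtain ⟨q, hq0, hqε⟩ := exists_rat_btwn (show 0 < ε / 2 by positivity)
      obtain ⟨i, hi⟩ := hdense.exists_dist_lt (f t) (show (0 : ℝ) < q from hq0)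
      refine ⟨i, q, ⟨by exact_mod_cast hq0.le, fun y hy => hb ?_⟩, hi.le⟩
      rw [Metric.mem_closedBall] at hy
      rw [Metric.mem_ball]
      calc dist y (f t) ≤ dist y (d i) + dist (d i) (f t) := dist_triangle _ _ _
        _ < ε := by rw [dist_comm (d i)]; linarith
    · rintro ⟨i, q, ⟨-, hq⟩, ht⟩
      exact hq ht
  rw [hO']
  refine MeasurableSet.iUnion fun i => MeasurableSet.iUnion fun q => MeasurableSet.iUnion fun h => ?_
  rw [hball _ _ (by exact_mod_cast h.1)]
  exact MeasurableSet.iInter fun j => measurableSet_le ((hf _).sub_const _) measurable_const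

/-- A weakly convergent sequence is bounded, so its pairing with `u - x n → 0` vanishes in the
limit; lower semicontinuity of `φ` handles the other term of the subgradient inequality. -/
theorem mem_subdiff_of_weak_tendsto [CompleteSpace H] {φ : H → ℝ} (hφ : ConvexOn ℝ univ φ)
    (hlsc : LowerSemicontinuous φ) {x ξ : ℕ → H} {u η : H} (hx : Tendsto x atTop (𝓝 u))
    (hξ : ∀ n, ξ n ∈ subdiff φ (x n))
    (hw : ∀ v, Tendsto (fun n => inner ℝ (ξ n) v) atTop (𝓝 (inner ℝ η v))) :
    η ∈ subdiff φ u := by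
  refine mem_subdiff_of_forall_le fun w => ?_
  obtain ⟨M, hM⟩ := exists_norm_le_of_weak_tendsto hw
  have h1 : Tendsto (fun n => inner ℝ (ξ n) (u - x n)) atTop (𝓝 0) := by
    have h2 : Tendsto (fun n => M * ‖u - x n‖) atTop (𝓝 (M * ‖u - u‖)) :=
      ((tendsto_const_nhds.sub hx).norm).const_mul M
    rw [sub_self, norm_zero, mul_zero] at h2
    refine squeeze_zero_norm (fun n => ?_) h2
    exact (norm_inner_le_norm _ _).trans (mul_le_mul_of_nonneg_right (hM n) (norm_nonneg _))
  have h3 : Tendsto (fun n => inner ℝ (ξ n) (w - x n)) atTop (𝓝 (inner ℝ η (w - u))) := by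
    have := (hw (w - u)).add h1
    rw [add_zero] at this
    refine this.congr fun n => ?_
    rw [← inner_add_right]
    congr 1
    abel
  have h4 : ∀ y < φ u, y ≤ φ w - inner ℝ η (w - u) := by
    intro y hy
    have h5 : y + inner ℝ η (w - u) ≤ φ w := by
      refine le_of_tendsto (h3.const_add y) ?_
      filter_upwards [hx.eventually (hlsc u y hy)] with n hn
      have := le_of_mem_subdiff hφ (hξ n) w
      linarith
    linarith
  have := le_of_forall_lt_imp_le_of_dense h4
  linarith

end Weak

/-! ### Passage to the limit in the scheme. -/

section Limit

variable {α : ℝ} {H : Type*} [NormedAddCommGroup H] [InnerProductSpace ℝ H] [CompleteSpace H]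
  {φ : H → ℝ}

theorem tendsto_const_mul_rpow {k : ℕ → ℝ} (hk : Tendsto k atTop (𝓝 0)) (C : ℝ) {b : ℝ}
    (hb : 0 < b) : Tendsto (fun n => C * k n ^ b) atTop (𝓝 0) := by
  have h := (hk.rpow_const (Or.inr hb.le : (0 : ℝ) ≠ 0 ∨ 0 ≤ b)).const_mul C
  rwa [Real.zero_rpow hb.ne', mul_zero] at h

/-- The interpolated discrete solutions converge uniformly when the time step tends to zero. -/
theorem exists_uniform_limit (hα : 0 < α) (hα₁ : α < 1) (hφ : ConvexOn ℝ univ φ)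
    (hbd : BddBelow (range φ)) (u₀ : H) {T : ℝ} (hT : 0 < T) {k : ℕ → ℝ} (hk : ∀ n, 0 < k n)
    (hk0 : Tendsto k atTop (𝓝 0)) {U ξ : ℕ → ℕ → H}
    (h : ∀ n, IsDiscreteSolution φ α (k n) u₀ (U n) (ξ n)) :
    ∃ u : ℝ → H, (∀ t ∈ Icc 0 T, Tendsto (fun n => interp α (k n) u₀ (ξ n) t) atTop (𝓝 (u t))) ∧
      ∀ l, 0 < l → ∀ W η, IsDiscreteSolution φ α l u₀ W η → ∀ t ∈ Icc 0 T,
        ‖interp α l u₀ η t - u t‖ ^ 2 ≤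
          16 * √(T ^ α) / Real.Gamma (1 + α) * (φ u₀ - ⨅ v, φ v) * l ^ (α / 2) := by
  have hE : 0 ≤ φ u₀ - ⨅ v, φ v := energy_nonneg hbd u₀
  have hG := Gamma_one_add_pos hα
  set B := 16 * √(T ^ α) / Real.Gamma (1 + α) * (φ u₀ - ⨅ v, φ v) with hB
  have hB0 : 0 ≤ B := by positivity
  have hlim0 := tendsto_const_mul_rpow hk0 B (b := α / 2) (by linarith)
  have hex : ∀ t ∈ Icc 0 T, ∃ x, Tendsto (fun n => interp α (k n) u₀ (ξ n) t) atTop (𝓝 x) := by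
    intro t ht
    refine cauchySeq_tendsto_of_complete ?_
    rw [Metric.cauchySeq_iff]
    intro ε hε
    obtain ⟨N, hN⟩ := eventually_atTop.1
      (hlim0.eventually (gt_mem_nhds (show 0 < ε ^ 2 / 2 by positivity)))
    refine ⟨N, fun m hm n hn => ?_⟩
    have h1 := (h m).norm_sub_sq_le hα hα₁ hφ hbd (hk m) (hk n) (h n) hT ht
    have h2 := hN m hm
    have h3 := hN n hn
    rw [dist_eq_norm]
    exact lt_of_pow_lt_pow_left₀ 2 hε.le (by rw [← hB, mul_add] at h1; linarith)
  choose! u hu using hex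
  refine ⟨u, hu, fun l hl W η hW t ht => ?_⟩
  have h1 : Tendsto (fun n => ‖interp α l u₀ η t - interp α (k n) u₀ (ξ n) t‖ ^ 2) atTop
      (𝓝 (‖interp α l u₀ η t - u t‖ ^ 2)) := ((tendsto_const_nhds.sub (hu t ht)).norm).pow 2
  have h2 := hlim0.const_add (B * l ^ (α / 2))
  rw [add_zero] at h2
  refine le_of_tendsto_of_tendsto' h1 h2 fun n => ?_
  rw [← mul_add]
  exact hW.norm_sub_sq_le hα hα₁ hφ hbd hl (hk n) (h n) hT ht

/-- The limit of the discrete solutions is a mild solution of the fractional gradient flow. -/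
theorem exists_limit_solution [TopologicalSpace.SeparableSpace H] (hα : 0 < α) (hα₁ : α < 1)
    (hφ : ConvexOn ℝ univ φ) (hlsc : LowerSemicontinuous φ) (hbd : BddBelow (range φ))
    (hsw : StrongToWeak φ) (u₀ : H) {T : ℝ} (hT : 0 < T) :
    ∃ u η : ℝ → H, StronglyMeasurable η ∧ (∃ M, ∀ t, ‖η t‖ ≤ M) ∧
      (∀ t ∈ Icc 0 T, u t = u₀ - fracInt α η t) ∧ (∀ t ∈ Ioc 0 T, η t ∈ subdiff φ (u t)) ∧
      (∀ s ∈ Icc 0 T, ∀ t ∈ Icc 0 T, ‖u t - u s‖ ≤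
        2 * √(2 * (φ u₀ - ⨅ v, φ v) / Real.Gamma (1 + α)) * |t - s| ^ (α / 2)) ∧
      ∀ l, 0 < l → ∀ W ζ, IsDiscreteSolution φ α l u₀ W ζ → ∀ t ∈ Icc 0 T,
        ‖interp α l u₀ ζ t - u t‖ ^ 2 ≤
          16 * √(T ^ α) / Real.Gamma (1 + α) * (φ u₀ - ⨅ v, φ v) * l ^ (α / 2) := by
  set k : ℕ → ℝ := fun n => T / ((n : ℝ) + 1) with hkdef
  have hk : ∀ n, 0 < k n := fun n => by simp only [hkdef]; positivity
  have hk0 : Tendsto k atTop (𝓝 0) :=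
    tendsto_const_nhds.div_atTop (tendsto_natCast_atTop_atTop.atTop_add tendsto_const_nhds)
  have hex : ∀ n, ∃ U ξ : ℕ → H, IsDiscreteSolution φ α (k n) u₀ U ξ := by
    intro n
    obtain ⟨U, hU⟩ := exists_isScheme hα hφ hlsc hbd (hk n) u₀
    obtain ⟨ξ, h1, h2⟩ := hU.exists_subgradients hα hφ (hk n)
    exact ⟨U, ξ, h1, h2⟩
  choose U ξ h using hex
  obtain ⟨u, hu, herr⟩ := exists_uniform_limit hα hα₁ hφ hbd u₀ hT hk hk0 h
  have hHol : ∀ s ∈ Icc 0 T, ∀ t ∈ Icc 0 T, ‖u t - u s‖ ≤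
      2 * √(2 * (φ u₀ - ⨅ v, φ v) / Real.Gamma (1 + α)) * |t - s| ^ (α / 2) :=
    fun s hs t ht => le_of_tendsto ((hu t ht).sub (hu s hs)).norm
      (Eventually.of_forall fun n => (h n).norm_interp_sub_le hα hα₁ hφ hbd (hk n) hs.1 ht.1)
  have huc : ContinuousOn u (Icc 0 T) := continuousOn_of_holder (by linarith) hHol
  set X : ℕ → ℝ → H := fun n => stepFun (k n) (ξ n) with hX
  set P : ℕ → ℝ → H := fun n => stepFun (k n) (U n) with hP
  have hXP : ∀ n, ∀ t ∈ Ioc 0 T, X n t ∈ subdiff φ (P n t) := fun n t ht =>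
    (h n).stepFun_mem_subdiff (hk n) ht.1
  obtain ⟨e, he0, hPu⟩ : ∃ e : ℕ → ℝ, Tendsto e atTop (𝓝 0) ∧
      ∀ n, ∀ t ∈ Ioc 0 T, ‖P n t - u t‖ ≤ e n := by
    set D := 2 * √(2 * (φ u₀ - ⨅ v, φ v) / Real.Gamma (1 + α))
    set B := 16 * √(T ^ α) / Real.Gamma (1 + α) * (φ u₀ - ⨅ v, φ v)
    refine ⟨fun n => D * k n ^ (α / 2) + √(B * k n ^ (α / 2)), ?_, fun n t ht => ?_⟩
    · have h1 := tendsto_const_mul_rpow hk0 D (b := α / 2) (by linarith)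
      have h2 := (tendsto_const_mul_rpow hk0 B (b := α / 2) (by linarith)).sqrt
      rw [Real.sqrt_zero] at h2
      simpa using h1.add h2
    · have h1 := (h n).norm_stepFun_sub_interp_le hα hα₁ hφ hbd (hk n) ht.1
      have h2 := Real.le_sqrt_of_sq_le (herr (k n) (hk n) (U n) (ξ n) (h n) t ⟨ht.1.le, ht.2⟩)
      rw [← sub_add_sub_cancel (P n t) (interp α (k n) u₀ (ξ n) t) (u t)]
      exact (norm_add_le _ _).trans (add_le_add h1 h2)
  have hPt : ∀ t ∈ Ioc 0 T, Tendsto (fun n => P n t) atTop (𝓝 (u t)) := fun t ht =>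
    tendsto_iff_norm_sub_tendsto_zero.2
      (squeeze_zero (fun _ => norm_nonneg _) (fun n => hPu n t ht) he0)
  have hweak : ∀ t ∈ Ioc 0 T, ∃ y, ∀ v,
      Tendsto (fun n => inner ℝ (X n t) v) atTop (𝓝 (inner ℝ y v)) := fun t ht =>
    hsw _ _ (hPt t ht) _ fun n => hXP n t ht
  -- Otherwise subgradients of norm above `m` occur at times `t m` with arbitrarily fine steps.
  -- Along convergent times the step values tend to `u t'`, so by the regularity assumption these
  -- subgradients converge weakly and are bounded, a contradiction.
  obtain ⟨M, N, hMN⟩ : ∃ M : ℝ, ∃ N : ℕ, ∀ n ≥ N, ∀ t ∈ Ioc 0 T, ‖X n t‖ ≤ M := by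
    by_contra! hcon
    choose n hn t ht hbig using fun m : ℕ => hcon m m
    obtain ⟨t', ht', ψ, hψ, hlim⟩ := isCompact_Icc.tendsto_subseq
      fun m => Ioc_subset_Icc_self (ht m)
    have hnψ : Tendsto (fun m => n (ψ m)) atTop atTop :=
      tendsto_atTop_mono (fun m => hn (ψ m)) hψ.tendsto_atTop
    have hlimP : Tendsto (fun m => P (n (ψ m)) (t (ψ m))) atTop (𝓝 (u t')) := by
      have h1 : Tendsto (fun m => u (t (ψ m))) atTop (𝓝 (u t')) :=
        (huc t' ht').tendsto.comp (tendsto_nhdsWithin_iff.2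
          ⟨hlim, Eventually.of_forall fun m => Ioc_subset_Icc_self (ht (ψ m))⟩)
      have h2 : Tendsto (fun m => P (n (ψ m)) (t (ψ m)) - u (t (ψ m))) atTop (𝓝 0) :=
        squeeze_zero_norm (fun m => hPu _ _ (ht (ψ m))) (he0.comp hnψ)
      simpa using h2.add h1
    obtain ⟨y, hy⟩ := hsw _ _ hlimP (fun m => X (n (ψ m)) (t (ψ m))) fun m => hXP _ _ (ht (ψ m))
    obtain ⟨M, hM⟩ := exists_norm_le_of_weak_tendsto hy
    obtain ⟨m, hm⟩ := exists_nat_gt M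
    have h1 := hbig (ψ m)
    have h2 : (m : ℝ) ≤ ψ m := by exact_mod_cast hψ.id_le m
    linarith [hM m]
  choose! y hy using hweak
  -- The chosen weak limits are unspecified outside `(0, T]`; setting them to zero there makes `η`
  -- measurable and bounded on the whole line.
  set η : ℝ → H := (Ioc 0 T).indicator y with hη
  have hηw : ∀ t ∈ Ioc 0 T, ∀ v,
      Tendsto (fun n => inner ℝ (X n t) v) atTop (𝓝 (inner ℝ (η t) v)) := fun t ht v => by
    rw [hη, indicator_of_mem ht]
    exact hy t ht v
  have hη0 : ∀ t ∉ Ioc 0 T, η t = 0 := fun t ht => indicator_of_notMem ht _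
  have hηm : StronglyMeasurable η := by
    refine stronglyMeasurable_of_inner fun v => ?_
    refine measurable_of_tendsto_metrizable
      (f := fun n t => (Ioc 0 T).indicator (fun t => inner ℝ (X n t) v) t) (fun n => ?_)
      (tendsto_pi_nhds.2 fun t => ?_)
    · exact (((stronglyMeasurable_stepFun (k n) (ξ n)).inner
        stronglyMeasurable_const).indicator measurableSet_Ioc).measurable
    · by_cases ht : t ∈ Ioc 0 T
      · simpa only [indicator_of_mem ht] using hηw t ht v
      · simp only [indicator_of_notMem ht, hη0 t ht, inner_zero_left]
        exact tendsto_const_nhds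
  have hηM : ∀ t, ‖η t‖ ≤ max M 0 := by
    intro t
    by_cases ht : t ∈ Ioc 0 T
    · have h1 : Tendsto (fun n => inner ℝ (X n t) (η t)) atTop (𝓝 (inner ℝ (η t) (η t))) :=
        hηw t ht _
      have h2 : inner ℝ (η t) (η t) ≤ M * ‖η t‖ := by
        refine le_of_tendsto h1 ?_
        filter_upwards [eventually_ge_atTop N] with n hn
        exact (real_inner_le_norm _ _).trans
          (mul_le_mul_of_nonneg_right (hMN n hn t ht) (norm_nonneg _))
      rw [real_inner_self_eq_norm_sq] at h2
      rcases (norm_nonneg (η t)).eq_or_lt with h0 | h0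
      · rw [← h0]; exact le_max_right _ _
      · exact (le_of_mul_le_mul_right (by linarith [sq ‖η t‖]) h0).trans (le_max_left _ _)
    · rw [hη0 t ht, norm_zero]; exact le_max_right _ _
  refine ⟨u, η, hηm, ⟨_, hηM⟩, fun t ht => ?_, fun t ht => ?_, hHol, herr⟩
  -- Only weak convergence of the subgradients is available, so the integral equation is tested
  -- against a vector `v` and the limit is taken by dominated convergence of scalars.
  · refine ext_inner_left ℝ fun v => ?_
    have hint : IntegrableOn (fun s => kern α (t - s) • η s) (Ioi 0) :=
      integrableOn_kern_smul hα hηm.aestronglyMeasurable fun s _ => hηM s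
    have h1 : Tendsto (fun n => inner ℝ v (interp α (k n) u₀ (ξ n) t)) atTop
        (𝓝 (inner ℝ v (u t))) := tendsto_const_nhds.inner (hu t ht)
    refine tendsto_nhds_unique h1 ?_
    have h2 : ∀ n, inner ℝ v (interp α (k n) u₀ (ξ n) t) =
        inner ℝ v u₀ - ∫ s in Ioi 0, inner ℝ v (kern α (t - s) • X n s) := fun n => by
      rw [interp, inner_sub_right, fracInt,
        ← integral_inner (integrableOn_kern_stepFun hα (hk n) (ξ n) t) v]
    simp only [h2]
    rw [inner_sub_right, fracInt, ← integral_inner hint v]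
    refine Tendsto.const_sub _ ?_
    refine tendsto_integral_filter_of_dominated_convergence
      (fun s => kern α (t - s) * (‖v‖ * M)) ?_ ?_
      ((integrableOn_kern_sub hα t 0).mul_const _) ?_
    · exact Eventually.of_forall fun n =>
        aestronglyMeasurable_const.inner (integrableOn_kern_stepFun hα (hk n) (ξ n) t).1
    · filter_upwards [eventually_ge_atTop N] with n hn
      filter_upwards [ae_restrict_mem measurableSet_Ioi] with s (hs : 0 < s)
      rw [inner_smul_right, norm_mul, Real.norm_of_nonneg (kern_nonneg hα _)]
      by_cases hst : s ≤ t
      · refine mul_le_mul_of_nonneg_left ?_ (kern_nonneg hα _)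
        exact (norm_inner_le_norm _ _).trans
          (mul_le_mul_of_nonneg_left (hMN n hn s ⟨hs, hst.trans ht.2⟩) (norm_nonneg _))
      · simp [kern_of_nonpos (show t - s ≤ 0 by linarith)]
    · filter_upwards [ae_restrict_mem measurableSet_Ioi] with s (hs : 0 < s)
      simp only [inner_smul_right]
      by_cases hst : s ≤ t
      · refine Tendsto.const_mul _ ?_
        simpa only [real_inner_comm] using hηw s ⟨hs, hst.trans ht.2⟩ v
      · simp [kern_of_nonpos (show t - s ≤ 0 by linarith)]
  · exact mem_subdiff_of_weak_tendsto hφ hlsc (hPt t ht) (fun n => hXP n t ht) (hηw t ht)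

end Limit

/-! ### Abel inversion and duality of left- and right-sided fractional integrals. -/

section Abel

variable {α β : ℝ}

theorem integral_rpow_mul_rpow (hα : 0 < α) (hβ : 0 < β) {q : ℝ} (hq : 0 < q) :
    ∫ x in (0 : ℝ)..q, x ^ (α - 1) * (q - x) ^ (β - 1) =
      q ^ (α + β - 1) * (Real.Gamma α * Real.Gamma β / Real.Gamma (α + β)) := by
  have h := Complex.betaIntegral_scaled (α : ℂ) (β : ℂ) hq
  rw [Complex.betaIntegral_eq_Gamma_mul_div _ _ (by simpa) (by simpa)] at h
  have h2 : ∫ x in (0 : ℝ)..q, (x : ℂ) ^ ((α : ℂ) - 1) * ((q : ℂ) - x) ^ ((β : ℂ) - 1) =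
      ∫ x in (0 : ℝ)..q, ((x ^ (α - 1) * (q - x) ^ (β - 1) : ℝ) : ℂ) := by
    rw [intervalIntegral.integral_of_le hq.le, intervalIntegral.integral_of_le hq.le]
    refine setIntegral_congr_fun measurableSet_Ioc fun x hx => ?_
    have h3 : 0 ≤ q - x := sub_nonneg.2 hx.2
    rw [Complex.ofReal_mul, Complex.ofReal_cpow hx.1.le, Complex.ofReal_cpow h3]
    push_cast
    rfl
  rw [h2, intervalIntegral.integral_ofReal] at h
  rw [← Complex.ofReal_add, Complex.Gamma_ofReal, Complex.Gamma_ofReal, Complex.Gamma_ofReal] at h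
  rw [show ((α + β : ℝ) : ℂ) - 1 = ((α + β - 1 : ℝ) : ℂ) by push_cast; rfl,
    ← Complex.ofReal_cpow hq.le] at h
  exact_mod_cast h

/-- The kernels of complementary orders convolve to the Heaviside function. -/
theorem integral_kern_mul_kern (hα : 0 < α) (hβ : 0 < β) (hαβ : α + β = 1) (q : ℝ) :
    ∫ p, kern α p * kern β (q - p) = (Ioi (0 : ℝ)).indicator 1 q := by
  by_cases hq : 0 < q
  · rw [indicator_of_mem (show q ∈ Ioi (0 : ℝ) from hq), Pi.one_apply]
    have h1 : ∫ p, kern α p * kern β (q - p) = ∫ p in Ioo 0 q, kern α p * kern β (q - p) := by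
      refine (setIntegral_eq_integral_of_forall_compl_eq_zero fun p hp => ?_).symm
      by_cases h0 : 0 < p
      · rw [kern_of_nonpos (show q - p ≤ 0 from by by_contra h; exact hp ⟨h0, by linarith⟩),
          mul_zero]
      · rw [kern_of_nonpos (not_lt.1 h0), zero_mul]
    have h2 : ∫ p in Ioo 0 q, kern α p * kern β (q - p) = ∫ p in Ioo 0 q,
        (Real.Gamma α * Real.Gamma β)⁻¹ * (p ^ (α - 1) * (q - p) ^ (β - 1)) := by
      refine setIntegral_congr_fun measurableSet_Ioo fun p hp => ?_
      rw [kern_of_pos hp.1, kern_of_pos (sub_pos.2 hp.2)]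
      field_simp
    rw [h1, h2, integral_const_mul, ← integral_Ioc_eq_integral_Ioo,
      ← intervalIntegral.integral_of_le hq.le, integral_rpow_mul_rpow hα hβ hq, hαβ, sub_self,
      Real.rpow_zero, Real.Gamma_one]
    have := Real.Gamma_pos_of_pos hα
    have := Real.Gamma_pos_of_pos hβ
    field_simp
  · rw [indicator_of_notMem (show q ∉ Ioi (0 : ℝ) from hq)]
    refine integral_eq_zero_of_ae (Eventually.of_forall fun p => ?_)
    by_cases h0 : 0 < p
    · simp [kern_of_nonpos (show q - p ≤ 0 by linarith)]
    · simp [kern_of_nonpos (not_lt.1 h0)]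

/-- The right-sided fractional integral of order `β`. -/
noncomputable def rightInt (β : ℝ) (ψ : ℝ → ℝ) (s : ℝ) : ℝ := ∫ t, kern β t * ψ (t + s)

theorem rightInt_congr {ψ χ : ℝ → ℝ} {s : ℝ} (h : ∀ t > s, ψ t = χ t) :
    rightInt β ψ s = rightInt β χ s := by
  refine integral_congr_ae (Eventually.of_forall fun t => ?_)
  by_cases ht : 0 < t
  · simp only
    rw [h _ (by linarith)]
  · simp [kern_of_nonpos (not_lt.1 ht)]

theorem rightInt_eq_zero {ψ : ℝ → ℝ} {R s : ℝ} (h : ∀ x ≥ R, ψ x = 0) (hs : R ≤ s) :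
    rightInt β ψ s = 0 := by
  rw [rightInt_congr (χ := fun _ => 0) fun t ht => h t (by linarith)]
  simp [rightInt]

/-- Translates the distribution in the Caputo derivative into a right-sided integral of order `1 -
α`, so that the whole duality argument takes place between ordinary integrals. -/
theorem gDist_neg (α : ℝ) (ψ : ℝ → ℝ) (s : ℝ) :
    gDist (-α) (fun t => ψ (t + s)) = -rightInt (1 - α) (deriv ψ) s := by
  have h1 : rightInt (1 - α) (deriv ψ) s =
      ∫ t in Ioi (0 : ℝ), kern (1 - α) t * deriv ψ (t + s) := by
    refine (setIntegral_eq_integral_of_forall_compl_eq_zero fun t ht => ?_).symm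
    rw [kern_of_nonpos (not_lt.1 ht), zero_mul]
  have h2 : ∫ t in Ioi (0 : ℝ), kern (1 - α) t * deriv ψ (t + s) =
      ∫ t in Ioi (0 : ℝ), 1 / Real.Gamma (1 - α) *
        (t ^ (-α) * deriv (fun t => ψ (t + s)) t) := by
    refine setIntegral_congr_fun measurableSet_Ioi fun t ht => ?_
    rw [kern_of_pos ht, deriv_comp_add_const, show 1 - α - 1 = -α by ring]
    ring
  rw [h1, h2, integral_const_mul, gDist, ← sub_eq_add_neg]
  ring

theorem exists_bound_of_hasCompactSupport {φ : ℝ → ℝ} (hφ : Continuous φ)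
    (hc : HasCompactSupport φ) : ∃ B, ∀ x, ‖φ x‖ ≤ B :=
  hφ.bounded_above_of_compact_support hc

theorem exists_right_bound {φ : ℝ → ℝ} (hc : HasCompactSupport φ) : ∃ R, ∀ x ≥ R, φ x = 0 := by
  obtain ⟨R, hR⟩ := hc.isCompact.bddAbove
  refine ⟨R + 1, fun x hx => ?_⟩
  by_contra h
  have := hR (subset_tsupport φ h)
  linarith

/-- Semigroup property for right-sided integrals of complementary orders. -/
theorem rightInt_rightInt (hα : 0 < α) (hβ : 0 < β) (hαβ : α + β = 1) {φ : ℝ → ℝ}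
    (hφ : Continuous φ) (hc : HasCompactSupport φ) (s : ℝ) :
    rightInt α (rightInt β φ) s = ∫ q in Ioi (0 : ℝ), φ (q + s) := by
  obtain ⟨B, hB⟩ := exists_bound_of_hasCompactSupport hφ hc
  obtain ⟨R, hR⟩ := exists_right_bound hc
  -- Beyond `q = L` the factor `φ (q + s)` vanishes, so both kernels may be truncated to `(0, L]`,
  -- which makes the double integral absolutely convergent.
  set L := R - s with hL
  have h1 : rightInt α (rightInt β φ) s =
      ∫ p, ∫ q, kern α p * kern β (q - p) * φ (q + s) := by
    refine integral_congr_ae (Eventually.of_forall fun p => ?_)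
    simp only [rightInt, mul_assoc]
    rw [integral_const_mul]
    congr 1
    rw [← integral_sub_right_eq_self _ p]
    congr 1
    ext q
    congr 2
    ring
  have hint : Integrable (Function.uncurry fun q p => kern α p * kern β (q - p) * φ (q + s))
      (volume.prod volume) := by
    have h2 := (integrable_indicator_kern hα L).convolution_integrand (ContinuousLinearMap.mul ℝ ℝ)
      (integrable_indicator_kern hβ L)
    have h3 : Integrable (fun x : ℝ × ℝ => φ (x.1 + s) *
        (ContinuousLinearMap.mul ℝ ℝ ((Ioc 0 L).indicator (kern α) x.2)
          ((Ioc 0 L).indicator (kern β) (x.1 - x.2)))) (volume.prod volume) :=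
      h2.bdd_mul (c := B) (Continuous.aestronglyMeasurable (by fun_prop))
        (Eventually.of_forall fun x => hB _)
    refine h3.congr (Eventually.of_forall fun ⟨q, p⟩ => ?_)
    simp only [Function.uncurry, ContinuousLinearMap.mul_apply']
    by_cases hq : q < L
    · have e1 : (Ioc 0 L).indicator (kern α) p * (Ioc 0 L).indicator (kern β) (q - p) =
          kern α p * kern β (q - p) := by
        by_cases hp : 0 < p
        · by_cases hqp : 0 < q - p
          · rw [indicator_of_mem (show p ∈ Ioc 0 L from ⟨hp, by linarith⟩),
              indicator_of_mem (show q - p ∈ Ioc 0 L from ⟨hqp, by linarith⟩)]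
          · rw [kern_of_nonpos (not_lt.1 hqp),
              indicator_of_notMem (show q - p ∉ Ioc 0 L from fun h => hqp h.1), mul_zero, mul_zero]
        · rw [kern_of_nonpos (not_lt.1 hp),
            indicator_of_notMem (show p ∉ Ioc 0 L from fun h => hp h.1), zero_mul, zero_mul]
      rw [e1, mul_comm]
    · rw [hR (q + s) (by linarith), zero_mul, mul_zero]
  rw [h1, ← integral_integral_swap hint, ← integral_indicator measurableSet_Ioi]
  congr 1
  ext q
  rw [integral_mul_const, integral_kern_mul_kern hα hβ hαβ]
  by_cases hq : q ∈ Ioi (0 : ℝ) <;> simp only [hq, indicator_of_mem, indicator_of_notMem,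
    Pi.one_apply, one_mul, zero_mul, not_false_eq_true]

/-- Abel inversion: integrals of complementary orders compose to `∫` over `(s, ∞)`, which undoes the
derivative. It is used with `β = 1 - α` and also with the two orders exchanged. -/
theorem rightInt_rightInt_deriv (hα : 0 < α) (hβ : 0 < β) (hαβ : α + β = 1) {φ : ℝ → ℝ}
    (hφ : ContDiff ℝ 1 φ) (hc : HasCompactSupport φ) (s : ℝ) :
    rightInt α (rightInt β (deriv φ)) s = -φ s := by
  rw [rightInt_rightInt hα hβ hαβ (hφ.continuous_deriv le_rfl) hc.deriv,
    ← hc.integral_Ioi_deriv_eq hφ s, ← integral_indicator measurableSet_Ioi,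
    ← integral_indicator measurableSet_Ioi,
    ← integral_add_right_eq_self ((Ioi s).indicator fun x => deriv φ x) s]
  congr 1
  ext q
  simp [indicator]

theorem stronglyMeasurable_rightInt {ψ : ℝ → ℝ} (hψ : Measurable ψ) :
    StronglyMeasurable (rightInt β ψ) := by
  have : StronglyMeasurable (fun p : ℝ × ℝ => kern β p.2 * ψ (p.2 + p.1)) :=
    Measurable.stronglyMeasurable (by fun_prop)
  exact this.integral_prod_right'

theorem exists_bound_rightInt (hβ : 0 < β) {ψ : ℝ → ℝ} {B R : ℝ} (hB : ∀ x, ‖ψ x‖ ≤ B)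
    (hR : ∀ x ≥ R, ψ x = 0) : ∃ C, ∀ s ≥ 0, ‖rightInt β ψ s‖ ≤ C := by
  refine ⟨∫ t, (Ioc 0 R).indicator (kern β) t * B, fun s hs => ?_⟩
  refine norm_integral_le_of_norm_le ((integrable_indicator_kern hβ R).mul_const B)
    (Eventually.of_forall fun t => ?_)
  rw [norm_mul, Real.norm_of_nonneg (kern_nonneg hβ _)]
  by_cases ht : t ∈ Ioc 0 R
  · rw [indicator_of_mem ht]
    exact mul_le_mul_of_nonneg_left (hB _) (kern_nonneg hβ _)
  · rw [indicator_of_notMem ht, zero_mul]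
    by_cases h0 : 0 < t
    · have : R < t := by by_contra h; exact ht ⟨h0, not_lt.1 h⟩
      rw [hR _ (by linarith), norm_zero, mul_zero]
    · rw [kern_of_nonpos (not_lt.1 h0), zero_mul]

variable {E : Type*} [NormedAddCommGroup E] [NormedSpace ℝ E]

theorem fracInt_eq_convolution {f : ℝ → E} {t T : ℝ} (ht : t ≤ T) :
    fracInt α f t = ∫ s, (Ioc 0 T).indicator (kern α) (t - s) • (Ioc 0 T).indicator f s := by
  rw [fracInt, ← integral_indicator measurableSet_Ioi]
  congr 1
  ext s
  by_cases hs : 0 < s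
  · rw [indicator_of_mem (show s ∈ Ioi (0 : ℝ) from hs)]
    by_cases hst : s < t
    · rw [indicator_of_mem (show s ∈ Ioc 0 T from ⟨hs, by linarith⟩),
        indicator_of_mem (show t - s ∈ Ioc 0 T from ⟨by linarith, by linarith⟩)]
    · rw [indicator_of_notMem (show t - s ∉ Ioc 0 T from fun h => hst (by linarith [h.1])),
        kern_of_nonpos (by linarith), zero_smul, zero_smul]
  · rw [indicator_of_notMem (show s ∉ Ioi (0 : ℝ) from hs),
      indicator_of_notMem (show s ∉ Ioc 0 T from fun h => hs h.1), smul_zero]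

theorem integrable_kern_convolution_integrand (hα : 0 < α) {f : ℝ → E} {T : ℝ}
    (hf : IntegrableOn f (Ioc 0 T)) :
    Integrable (fun p : ℝ × ℝ => (Ioc 0 T).indicator (kern α) (p.1 - p.2) •
      (Ioc 0 T).indicator f p.2) (volume.prod volume) :=
  ((integrable_indicator_iff measurableSet_Ioc).2 hf).convolution_integrand
    (ContinuousLinearMap.lsmul ℝ ℝ : ℝ →L[ℝ] E →L[ℝ] E).flip (integrable_indicator_kern hα T)

theorem integrableOn_fracInt (hα : 0 < α) {f : ℝ → E} {T : ℝ} (hf : IntegrableOn f (Ioc 0 T)) :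
    IntegrableOn (fracInt α f) (Ioc 0 T) := by
  refine ((integrable_kern_convolution_integrand hα hf).integral_prod_left.integrableOn
    (s := Ioc 0 T)).congr_fun (fun t ht => ?_) measurableSet_Ioc
  exact (fracInt_eq_convolution ht.2).symm

/-- The left- and right-sided fractional integrals are adjoint to each other. -/
theorem integral_smul_fracInt [CompleteSpace E] (hα : 0 < α) {f : ℝ → E} {T B : ℝ}
    (hf : IntegrableOn f (Ioc 0 T)) {χ : ℝ → ℝ} (hχ : Measurable χ) (hB : ∀ s ≥ 0, ‖χ s‖ ≤ B)
    (hχT : ∀ s ≥ T, χ s = 0) :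
    ∫ s in Ioc 0 T, χ s • fracInt α f s = ∫ r in Ioc 0 T, rightInt α χ r • f r := by
  have h1 : ∫ s in Ioc 0 T, χ s • fracInt α f s = ∫ s, ∫ r, (Ioc 0 T).indicator χ s •
      ((Ioc 0 T).indicator (kern α) (s - r) • (Ioc 0 T).indicator f r) := by
    rw [← integral_indicator measurableSet_Ioc]
    congr 1
    ext s
    rw [integral_smul]
    by_cases hs : s ∈ Ioc 0 T
    · rw [indicator_of_mem hs, indicator_of_mem hs, ← fracInt_eq_convolution hs.2]
    · rw [indicator_of_notMem hs, indicator_of_notMem hs, zero_smul]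
  have hint : Integrable (Function.uncurry fun s r => (Ioc 0 T).indicator χ s •
      ((Ioc 0 T).indicator (kern α) (s - r) • (Ioc 0 T).indicator f r))
      (volume.prod volume) := by
    refine (integrable_kern_convolution_integrand hα hf).bdd_smul |B|
      ((hχ.indicator measurableSet_Ioc).comp measurable_fst).aestronglyMeasurable
      (Eventually.of_forall fun p => ?_)
    simp only [indicator]
    split_ifs with h
    · exact (hB _ h.1.le).trans (le_abs_self B)
    · simp
  rw [h1, integral_integral_swap hint, ← integral_indicator measurableSet_Ioc]
  congr 1
  ext r
  simp only [smul_smul]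
  rw [integral_smul_const]
  by_cases hr : r ∈ Ioc 0 T
  · rw [indicator_of_mem hr, indicator_of_mem hr]
    congr 1
    rw [rightInt, ← integral_sub_right_eq_self (fun t => kern α t * χ (t + r)) r]
    congr 1
    ext s
    rw [sub_add_cancel, mul_comm]
    by_cases hsr : r < s
    · by_cases hsT : s < T
      · rw [indicator_of_mem (show s ∈ Ioc 0 T from ⟨hr.1.trans hsr, hsT.le⟩),
          indicator_of_mem (show s - r ∈ Ioc 0 T from ⟨by linarith, by linarith [hr.1]⟩)]
      · rw [hχT s (not_lt.1 hsT), mul_zero, indicator_apply]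
        simp [hχT s (not_lt.1 hsT)]
    · rw [kern_of_nonpos (by linarith),
        indicator_of_notMem (show s - r ∉ Ioc 0 T from fun h => hsr (by linarith [h.1])), zero_mul,
        zero_mul]
  · rw [indicator_of_notMem hr, indicator_of_notMem hr, smul_zero]

end Abel

/-! ### The distributional Caputo derivative as the inverse of the fractional integral. -/

section Caputo

variable {α T : ℝ}

theorem exists_right_bound_lt {ψ : ℝ → ℝ} (hT : 0 < T) (hc : HasCompactSupport ψ)
    (hs : tsupport ψ ⊆ Iio T) : ∃ R, 0 < R ∧ R < T ∧ ∀ x ≥ R, ψ x = 0 := by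
  -- Adjoining `0` covers an empty support and makes the resulting bound positive.
  obtain ⟨m, hm⟩ := (hc.isCompact.insert 0).exists_isGreatest (insert_nonempty _ _)
  have hm0 : 0 ≤ m := hm.2 (mem_insert _ _)
  have hmT : m < T := by
    rcases hm.1 with rfl | h
    · exact hT
    · exact hs h
  refine ⟨(m + T) / 2, by linarith, by linarith, fun x hx => ?_⟩
  by_contra h
  have := hm.2 (mem_insert_of_mem 0 (subset_tsupport ψ h))
  linarith

variable {E : Type*} [NormedAddCommGroup E]

theorem integrableOn_Ioc_of_locallyIntegrableOn {f : ℝ → E}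
    (hf : LocallyIntegrableOn f (Ico 0 T)) {R : ℝ} (hR : R < T) : IntegrableOn f (Ioc 0 R) :=
  (hf.integrableOn_compact_subset (fun _ hx => ⟨hx.1, hx.2.trans_lt hR⟩) isCompact_Icc).mono_set
    Ioc_subset_Icc_self

theorem setIntegral_Ico_eq_Ioc [NormedSpace ℝ E] {g : ℝ → E} {R : ℝ} (hR : R < T)
    (hg : ∀ s ≥ R, g s = 0) : ∫ s in Ico 0 T, g s = ∫ s in Ioc 0 R, g s := by
  rw [integral_Ico_eq_integral_Ioo]
  refine setIntegral_eq_of_subset_of_forall_sdiff_eq_zero measurableSet_Ioo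
    (fun s hs => ⟨hs.1, hs.2.trans_lt hR⟩) fun s hs => hg s ?_
  by_contra h
  exact hs.2 ⟨hs.1.1, (not_le.1 h).le⟩

theorem rightInt_neg (β : ℝ) (ψ : ℝ → ℝ) (s : ℝ) :
    rightInt β (fun x => -ψ x) s = -rightInt β ψ s := by
  simp only [rightInt, mul_neg, integral_neg]

variable {H : Type*} [NormedAddCommGroup H] [InnerProductSpace ℝ H] [CompleteSpace H]

/-- The Caputo derivative inverts the fractional integral. -/
theorem hasCaputo_of_eq_fracInt (hα : 0 < α) (hα₁ : α < 1) (hT : 0 < T) {X₀ : H} {X f : ℝ → H}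
    (hf : LocallyIntegrableOn f (Ico 0 T))
    (hX : ∀ t ∈ Ioo 0 T, X t - X₀ = fracInt α f t) : HasCaputo α T X₀ X f := by
  refine ⟨hf, fun ψ ⟨hψ, hψc, hψT⟩ => ?_⟩
  have hψ1 : ContDiff ℝ 1 ψ := hψ.of_le (by exact_mod_cast le_top)
  have hψ'c : Continuous (deriv ψ) := hψ1.continuous_deriv le_rfl
  obtain ⟨R₁, h10, h1T, h1⟩ := exists_right_bound_lt hT hψc hψT
  obtain ⟨R₂, h20, h2T, h2⟩ := exists_right_bound_lt hT hψc.deriv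
    ((closure_minimal support_deriv_subset (isClosed_tsupport ψ)).trans hψT)
  set R := max R₁ R₂ with hR
  have hRT : R < T := max_lt h1T h2T
  obtain ⟨B, hB⟩ := exists_bound_of_hasCompactSupport hψ'c hψc.deriv
  obtain ⟨C, hC⟩ := exists_bound_rightInt (β := 1 - α) (by linarith) hB h2
  -- This is the function paired with `X - X₀` by the Caputo derivative. Its right-sided integral of
  -- order `α` is `ψ`, so moving `fracInt` across the pairing leaves `ψ` against `f`.
  set χ : ℝ → ℝ := fun s => -rightInt (1 - α) (deriv ψ) s with hχ
  have hχm : Measurable χ := (stronglyMeasurable_rightInt hψ'c.measurable).measurable.neg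
  have hχ0 : ∀ s ≥ R, χ s = 0 := fun s hs => by
    simp only [hχ]
    rw [rightInt_eq_zero h2 ((le_max_right _ _).trans hs), neg_zero]
  have hχψ : ∀ r, rightInt α χ r = ψ r := fun r => by
    rw [hχ, rightInt_neg, rightInt_rightInt_deriv hα (by linarith) (by ring) hψ1 hψc, neg_neg]
  simp only [caputo, gDist_neg]
  rw [setIntegral_Ico_eq_Ioc hRT fun s hs => by
      have := hχ0 s hs
      simp only [hχ] at this
      rw [this, zero_smul],
    setIntegral_Ico_eq_Ioc hRT fun s hs => by rw [h1 s ((le_max_left _ _).trans hs), zero_smul]]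
  have h3 : ∫ s in Ioc 0 R, -rightInt (1 - α) (deriv ψ) s • (X s - X₀) =
      ∫ s in Ioc 0 R, χ s • fracInt α f s := by
    refine setIntegral_congr_fun measurableSet_Ioc fun s hs => ?_
    simp only [hχ]
    rw [hX s ⟨hs.1, hs.2.trans_lt hRT⟩]
  rw [h3, integral_smul_fracInt hα (integrableOn_Ioc_of_locallyIntegrableOn hf hRT) hχm
    (fun s hs => by simpa [hχ] using hC s hs) hχ0]
  simp only [hχψ]

theorem rightInt_eq_convolution (β : ℝ) (χ : ℝ → ℝ) :
    rightInt β χ = convolution (fun t => kern β (-t)) χ (ContinuousLinearMap.mul ℝ ℝ) volume := by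
  ext s
  rw [rightInt, convolution_def, ← integral_neg_eq_self]
  congr 1
  ext t
  simp only [ContinuousLinearMap.mul_apply']
  congr 2
  ring

theorem locallyIntegrable_kern_neg (hα : 0 < α) : LocallyIntegrable (fun t => kern α (-t)) := by
  intro x
  refine ⟨Ioc (x - 1) (x + 1), Ioc_mem_nhds (by linarith) (by linarith), ?_⟩
  refine (intervalIntegrable_iff_integrableOn_Ioc_of_le (by linarith)).1 ?_
  simpa using intervalIntegrable_kern_sub hα 0 (x - 1) (x + 1)

theorem contDiff_rightInt (hα : 0 < α) {χ : ℝ → ℝ} (hχ : ContDiff ℝ ∞ χ)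
    (hc : HasCompactSupport χ) : ContDiff ℝ ∞ (rightInt α χ) := by
  rw [rightInt_eq_convolution]
  exact hc.contDiff_convolution_right _ (locallyIntegrable_kern_neg hα) hχ

theorem deriv_rightInt (hα : 0 < α) {χ : ℝ → ℝ} (hχ : ContDiff ℝ 1 χ)
    (hc : HasCompactSupport χ) (s : ℝ) : deriv (rightInt α χ) s = rightInt α (deriv χ) s := by
  rw [rightInt_eq_convolution, rightInt_eq_convolution]
  exact (hc.hasDerivAt_convolution_right _ (locallyIntegrable_kern_neg hα) hχ s).deriv

/-- Every smooth test function on `(0, T)` is represented by the Caputo derivative. -/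
theorem exists_test_gDist_eq (hα : 0 < α) (hα₁ : α < 1) {χ : ℝ → ℝ} (hχ : ContDiff ℝ ∞ χ)
    (hc : HasCompactSupport χ) {R : ℝ} (hRT : R < T) (hR : ∀ x ≥ R, χ x = 0) :
    ∃ ψ, IsTest T ψ ∧ (∀ s ≥ 0, ψ s = rightInt α χ s) ∧
      ∀ s ≥ 0, gDist (-α) (fun t => ψ (t + s)) = χ s := by
  have hχ1 : ContDiff ℝ 1 χ := hχ.of_le (by exact_mod_cast le_top)
  -- The right-sided integral of `χ` is smooth but need not vanish far to the left. The factor cuts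
  -- it off between `-2` and `-1`, unseen at `s ≥ 0`, where `gDist` depends only on `ψ'` to the
  -- right of `s`.
  set ψ : ℝ → ℝ := fun x => Real.smoothTransition (x + 2) * rightInt α χ x with hψ
  have hψeq : ∀ x > -1, ψ x = rightInt α χ x := fun x hx => by
    simp only [hψ]
    rw [Real.smoothTransition.one_of_one_le (by linarith), one_mul]
  have hψ0 : ∀ x ∉ Icc (-2) R, ψ x = 0 := by
    intro x hx
    by_cases h : x < -2
    · simp only [hψ]
      rw [Real.smoothTransition.zero_of_nonpos (by linarith), zero_mul]
    · simp only [hψ]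
      rw [rightInt_eq_zero hR (by by_contra h'; exact hx ⟨not_lt.1 h, (not_le.1 h').le⟩), mul_zero]
  refine ⟨ψ, ⟨?_, HasCompactSupport.intro isCompact_Icc hψ0, ?_⟩, fun s hs => hψeq s (by linarith),
    fun s hs => ?_⟩
  · exact (Real.smoothTransition.contDiff.comp (contDiff_id.add contDiff_const)).mul
      (contDiff_rightInt hα hχ hc)
  · refine (closure_minimal (fun x hx => ?_) isClosed_Icc).trans
      fun x (hx : x ∈ Icc (-2) R) => hx.2.trans_lt hRT
    by_contra h
    exact hx (hψ0 x h)
  · have h1 : ∀ t > s, deriv ψ t = rightInt α (deriv χ) t := fun t ht => by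
      rw [← deriv_rightInt hα hχ1 hc]
      refine Filter.EventuallyEq.deriv_eq ?_
      filter_upwards [lt_mem_nhds (show -1 < t by linarith)] with x hx using hψeq x hx
    rw [gDist_neg, rightInt_congr h1,
      rightInt_rightInt_deriv (by linarith) hα (by ring) hχ1 hc, neg_neg]

/-- A function with a locally integrable Caputo derivative is the fractional integral of it. -/
theorem HasCaputo.ae_eq_fracInt (hα : 0 < α) (hα₁ : α < 1) (hT : 0 < T) {X₀ : H} {X f : ℝ → H}
    (hX : LocallyIntegrableOn X (Ico 0 T)) (h : HasCaputo α T X₀ X f) :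
    ∀ᵐ t, t ∈ Ioo 0 T → X t - X₀ = fracInt α f t := by
  have hint : ∀ R < T, IntegrableOn (fun t => (X t - X₀) - fracInt α f t) (Ioc 0 R) := by
    intro R hR
    refine ((integrableOn_Ioc_of_locallyIntegrableOn hX hR).sub (integrableOn_const ?_)).sub
      (integrableOn_fracInt hα (integrableOn_Ioc_of_locallyIntegrableOn h.1 hR))
    simp
  have hloc : LocallyIntegrableOn (fun t => (X t - X₀) - fracInt α f t) (Ioo 0 T) := by
    intro x hx
    refine ⟨Ioc 0 ((x + T) / 2), ?_, hint _ (by linarith [hx.2])⟩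
    exact mem_nhdsWithin_of_mem_nhds (Ioc_mem_nhds hx.1 (by linarith [hx.2]))
  -- By duality it suffices to pair with an arbitrary test function `χ`; the Caputo identity for the
  -- `ψ` that represents `χ` says exactly that this pairing vanishes.
  have hzero := isOpen_Ioo.ae_eq_zero_of_integral_contDiff_smul_eq_zero hloc
    fun χ hχ hχc hχs => by
      obtain ⟨R, hR0, hRT, hR⟩ := exists_right_bound_lt hT hχc (hχs.trans Ioo_subset_Iio_self)
      obtain ⟨B, hB⟩ := exists_bound_of_hasCompactSupport hχ.continuous hχc
      obtain ⟨ψ, hψ, hψeq, hψg⟩ := exists_test_gDist_eq hα hα₁ hχ hχc hRT hR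
      have hfR := integrableOn_Ioc_of_locallyIntegrableOn h.1 hRT
      have h1 : caputo α T X₀ X ψ = ∫ s in Ioc 0 R, χ s • (X s - X₀) := by
        rw [caputo, setIntegral_congr_fun (g := fun s => χ s • (X s - X₀)) measurableSet_Ico
          fun s hs => by simp only [hψg s hs.1]]
        exact setIntegral_Ico_eq_Ioc hRT fun s hs => by rw [hR s hs, zero_smul]
      have h2 : ∫ t in Ico 0 T, ψ t • f t = ∫ s in Ioc 0 R, χ s • fracInt α f s := by
        rw [integral_smul_fracInt hα hfR hχ.continuous.measurable (fun s _ => hB s) hR,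
          setIntegral_Ico_eq_Ioc hRT fun s hs => by
            rw [hψeq s (hR0.le.trans hs), rightInt_eq_zero hR hs, zero_smul]]
        exact setIntegral_congr_fun measurableSet_Ioc fun s hs => by
          simp only [hψeq s hs.1.le]
      have hbd : ∀ {g : ℝ → H}, IntegrableOn g (Ioc 0 R) →
          IntegrableOn (fun s => χ s • g s) (Ioc 0 R) := fun hg =>
        hg.bdd_smul B hχ.continuous.aestronglyMeasurable (Eventually.of_forall hB)
      have h3 : ∫ s, χ s • ((X s - X₀) - fracInt α f s) =
          ∫ s in Ioc 0 R, χ s • ((X s - X₀) - fracInt α f s) := by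
        refine (setIntegral_eq_integral_of_forall_compl_eq_zero fun s hs => ?_).symm
        have : χ s = 0 := by
          by_contra hne
          have h4 := hχs (subset_tsupport χ hne)
          exact hs ⟨h4.1, by by_contra h5; exact hne (hR s (not_le.1 h5).le)⟩
        rw [this, zero_smul]
      rw [h3]
      simp only [smul_sub (χ _) (X _ - X₀)]
      have hXR : IntegrableOn (fun s => X s - X₀) (Ioc 0 R) :=
        (integrableOn_Ioc_of_locallyIntegrableOn hX hRT).sub (integrableOn_const (by simp))
      rw [integral_sub (hbd hXR) (hbd (integrableOn_fracInt hα hfR)), ← h1, ← h2,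
        h.2 ψ hψ, sub_self]
  filter_upwards [hzero] with t ht htT using sub_eq_zero.1 (ht htT)

end Caputo

/-! ### Strong solutions: existence from the integral equation, and uniqueness. -/

section Main

variable {α T : ℝ} {H : Type*} [NormedAddCommGroup H] [InnerProductSpace ℝ H] [CompleteSpace H]
  {φ : H → ℝ} {u₀ : H}

/-- The fractional integral vanishes at `0`, so `u 0 = u₀`, and the Hölder bound there gives the
averaged initial condition. -/
theorem isStrongSolution_of_mild (hα : 0 < α) (hα₁ : α < 1) (hT : 0 < T) {u η : ℝ → H}
    (hη : StronglyMeasurable η) {M D : ℝ} (hM : ∀ t, ‖η t‖ ≤ M)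
    (hu : ∀ t ∈ Icc 0 T, u t = u₀ - fracInt α η t) (hs : ∀ t ∈ Ioc 0 T, η t ∈ subdiff φ (u t))
    (hD : 0 ≤ D)
    (hH : ∀ s ∈ Icc 0 T, ∀ t ∈ Icc 0 T, ‖u t - u s‖ ≤ D * |t - s| ^ (α / 2)) :
    IsStrongSolution φ α T u₀ u := by
  have hu0 : u 0 = u₀ := by
    rw [hu 0 ⟨le_rfl, hT.le⟩, fracInt_of_nonpos _ le_rfl, sub_zero]
  have hcont : ContinuousOn u (Icc 0 T) := continuousOn_of_holder (by linarith) hH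
  refine ⟨(hcont.mono Ico_subset_Icc_self).locallyIntegrableOn measurableSet_Ico, ?_,
    fun t => -η t, hasCaputo_of_eq_fracInt hα hα₁ hT ?_ fun t ht => ?_, ?_⟩
  · have hlim : Tendsto (fun t : ℝ => D * t ^ (α / 2)) (𝓝[>] 0) (𝓝 0) := by
      have h1 : Continuous fun t : ℝ => D * t ^ (α / 2) :=
        continuous_const.mul (continuous_id.rpow_const fun _ => Or.inr (by linarith))
      have h2 := (h1.tendsto 0).mono_left (nhdsWithin_le_nhds (s := Ioi 0))
      rwa [Real.zero_rpow (by linarith), mul_zero] at h2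
    refine squeeze_zero_norm' ?_ hlim
    filter_upwards [Ioo_mem_nhdsGT hT] with t ht
    have h1 : ‖∫ s in (0 : ℝ)..t, ‖u s - u₀‖‖ ≤ D * t ^ (α / 2) * |t - 0| := by
      refine intervalIntegral.norm_integral_le_of_norm_le_const fun s hs => ?_
      rw [uIoc_of_le ht.1.le] at hs
      rw [norm_norm, ← hu0]
      refine (hH 0 ⟨le_rfl, hT.le⟩ s ⟨hs.1.le, hs.2.trans ht.2.le⟩).trans ?_
      rw [sub_zero, abs_of_pos hs.1]
      have := Real.rpow_le_rpow hs.1.le hs.2 (show 0 ≤ α / 2 by linarith)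
      exact mul_le_mul_of_nonneg_left this hD
    rw [sub_zero, abs_of_pos ht.1] at h1
    rw [norm_mul, Real.norm_of_nonneg (one_div_pos.2 ht.1).le, one_div, inv_mul_le_iff₀ ht.1]
    linarith
  · have : LocallyIntegrable η := fun x =>
      ⟨Ioc (x - 1) (x + 1), Ioc_mem_nhds (by linarith) (by linarith),
        IntegrableOn.of_bound (by simp) hη.aestronglyMeasurable M (Eventually.of_forall hM)⟩
    exact this.neg.locallyIntegrableOn _
  · rw [hu t (Ioo_subset_Icc_self ht), fracInt, fracInt]
    simp only [smul_neg, integral_neg]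
    abel
  · rw [ae_restrict_iff' measurableSet_Ico]
    filter_upwards [compl_mem_ae_iff.2 (measure_singleton (0 : ℝ))] with t ht0 htT
    rw [neg_neg]
    exact hs t ⟨lt_of_le_of_ne htT.1 (Ne.symm ht0), htT.2.le⟩

/-- The difference of two solutions is the fractional integral of the difference of their
derivatives, with which it has nonpositive product by monotonicity; the energy inequality with `δ =
0` makes it vanish. -/
theorem IsStrongSolution.ae_unique (hα : 0 < α) (hα₁ : α < 1) (hT : 0 < T)
    (hφ : ConvexOn ℝ univ φ) {u w : ℝ → H} (hu : IsStrongSolution φ α T u₀ u)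
    (hw : IsStrongSolution φ α T u₀ w) : ∀ᵐ t ∂(volume.restrict (Ico 0 T)), w t = u t := by
  obtain ⟨hu1, -, f, hf, hfs⟩ := hu
  obtain ⟨hw1, -, g, hg, hgs⟩ := hw
  rw [ae_restrict_iff' measurableSet_Ico] at hfs hgs ⊢
  have hJu := hf.ae_eq_fracInt hα hα₁ hT hu1
  have hJw := hg.ae_eq_fracInt hα hα₁ hT hw1
  have hloc : ∀ n : ℕ, ∀ᵐ t, t ∈ Ioc 0 (T - T / ((n : ℝ) + 2)) → w t = u t := by
    intro n
    -- Integrability is known only on intervals ending before `T`, so these are exhausted; `n + 2`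
    -- keeps `R` positive at `n = 0`.
    set R := T - T / ((n : ℝ) + 2) with hR
    have hRT : R < T := sub_lt_self T (by positivity)
    have hR0 : 0 < R := sub_pos.2 (div_lt_self hT (by linarith [n.cast_nonneg (α := ℝ)]))
    have hfi := integrableOn_Ioc_of_locallyIntegrableOn hf.1 hRT
    have hgi := integrableOn_Ioc_of_locallyIntegrableOn hg.1 hRT
    have h0 := ae_norm_sq_le_fracInt hα hα₁ hR0 (f := fun t => g t - f t)
      (z := fun t => w t - u t) (δ := fun _ => 0) (hgi.sub hfi) integrableOn_zero (by
        filter_upwards [hJu, hJw, ae_integrableOn_kern_smul hα hfi,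
          ae_integrableOn_kern_smul hα hgi] with t h1 h2 h3 h4 ht
        have htT : t ∈ Ioo 0 T := ⟨ht.1, ht.2.trans_lt hRT⟩
        rw [← sub_sub_sub_cancel_right (w t) (u t) u₀, h1 htT, h2 htT]
        simp only [fracInt, smul_sub]
        exact (integral_sub (h4 ht.2) (h3 ht.2)).symm)
      (Eventually.of_forall fun _ _ => le_rfl) (by
        filter_upwards [hfs, hgs] with t h1 h2 ht
        have htT : t ∈ Ico 0 T := ⟨ht.1.le, ht.2.trans_lt hRT⟩
        have := subdiff_monotone hφ (h2 htT) (h1 htT)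
        rw [show -g t - -f t = -(g t - f t) by abel, inner_neg_right] at this
        linarith)
    filter_upwards [h0] with t ht htR
    have h1 := ht htR
    simp only [fracInt, smul_zero, integral_zero, mul_zero] at h1
    exact sub_eq_zero.1 (norm_eq_zero.1 (pow_eq_zero_iff two_ne_zero |>.1
      (le_antisymm h1 (by positivity))))
  filter_upwards [ae_all_iff.2 hloc, compl_mem_ae_iff.2 (measure_singleton (0 : ℝ))] with t ht h0 htT
  have ht0 : 0 < t := lt_of_le_of_ne htT.1 (Ne.symm h0)
  obtain ⟨n, hn⟩ := exists_nat_one_div_lt (show 0 < (T - t) / T by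
    have := htT.2; exact div_pos (by linarith) hT)
  refine ht n ⟨ht0, ?_⟩
  have h1 : 1 / ((n : ℝ) + 2) ≤ 1 / ((n : ℝ) + 1) := by gcongr; norm_num
  have h2 : T / ((n : ℝ) + 2) ≤ T - t := by
    rw [lt_div_iff₀ hT] at hn
    calc T / ((n : ℝ) + 2) = 1 / ((n : ℝ) + 2) * T := by ring
      _ ≤ 1 / ((n : ℝ) + 1) * T := by gcongr
      _ ≤ T - t := hn.le
  linarith

end Main

end FracGradFlow

theorem theorem5p1 (α T : ℝ) (hα₀ : 0 < α) (hα₁ : α < 1) (hT : 0 < T) :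
    ∃ C : ℝ, ∀ (H : Type*) [NormedAddCommGroup H] [InnerProductSpace ℝ H] [CompleteSpace H]
      [TopologicalSpace.SeparableSpace H] (φ : H → ℝ) (u₀ : H),
      LowerSemicontinuous φ → ConvexOn ℝ Set.univ φ → BddBelow (Set.range φ) →
      FracGradFlow.StrongToWeak φ →
      ∃ u : ℝ → H,
        -- existence and uniqueness of the strong solution
        FracGradFlow.IsStrongSolution φ α T u₀ u ∧
        (∀ w : ℝ → H, FracGradFlow.IsStrongSolution φ α T u₀ w →
          ∀ᵐ t ∂(volume.restrict (Set.Ico 0 T)), w t = u t) ∧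
        -- Hölder continuity, up to the end point
        (∀ s ∈ Set.Icc 0 T, ∀ t ∈ Set.Icc 0 T,
          ‖u t - u s‖ ≤ C * √(φ u₀ - ⨅ v : H, φ v) * |t - s| ^ (α / 2)) ∧
        -- well-definedness of the scheme and the error estimate
        ∀ N : ℕ, 1 ≤ N → ∃ U : ℕ → H,
          FracGradFlow.IsScheme φ α (T / N) u₀ U ∧
          (∀ W : ℕ → H, FracGradFlow.IsScheme φ α (T / N) u₀ W → W = U) ∧
          ∀ n : ℕ, n * (T / N) ≤ T →
            ‖U n - u (n * (T / N))‖ ≤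
              C * √(φ u₀ - ⨅ v : H, φ v) * (T / N) ^ (α / 4) := by
  have hG := FracGradFlow.Gamma_one_add_pos hα₀
  -- `A` is the Hölder constant and `B` the square root of the constant in the squared error bound,
  -- both with `√E` factored out.
  set A := 2 * √(2 / Real.Gamma (1 + α)) with hA
  set B := √(16 * √(T ^ α) / Real.Gamma (1 + α)) with hB
  refine ⟨max A B, fun H _ _ _ _ φ u₀ hlsc hφ hbd hsw => ?_⟩
  have hE : 0 ≤ φ u₀ - ⨅ v, φ v := FracGradFlow.energy_nonneg hbd u₀
  obtain ⟨u, η, hη, ⟨M, hM⟩, hu, hs, hH, herr⟩ :=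
    FracGradFlow.exists_limit_solution hα₀ hα₁ hφ hlsc hbd hsw u₀ hT
  set E := φ u₀ - ⨅ v, φ v with hEdef
  have hsol := FracGradFlow.isStrongSolution_of_mild hα₀ hα₁ hT hη hM hu hs (by positivity) hH
  refine ⟨u, hsol, fun w hw => hsol.ae_unique hα₀ hα₁ hT hφ hw, fun s hs t ht => ?_,
    fun N hN => ?_⟩
  · refine (hH s hs t ht).trans ?_
    refine mul_le_mul_of_nonneg_right ?_ (by positivity)
    rw [show 2 * E / Real.Gamma (1 + α) = 2 / Real.Gamma (1 + α) * E by ring,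
      Real.sqrt_mul (by positivity), ← mul_assoc]
    exact mul_le_mul_of_nonneg_right (le_max_left _ _) (Real.sqrt_nonneg _)
  · have hk : 0 < T / N := div_pos hT (by exact_mod_cast hN)
    obtain ⟨U, hU⟩ := FracGradFlow.exists_isScheme hα₀ hφ hlsc hbd hk u₀
    obtain ⟨ξ, h1, h2⟩ := hU.exists_subgradients hα₀ hφ hk
    have hd : FracGradFlow.IsDiscreteSolution φ α (T / N) u₀ U ξ := ⟨h1, h2⟩
    refine ⟨U, hU, fun W hW => hU.unique hα₀ hφ hk hW, fun n hn => ?_⟩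
    -- At grid points the interpolant equals `U n`, so no interpolation error is added and the
    -- square root of this bound is the claimed rate.
    have h3 := herr _ hk U ξ hd (n * (T / N)) ⟨by positivity, hn⟩
    rw [hd.interp_grid hα₀ hk] at h3
    refine (Real.le_sqrt_of_sq_le h3).trans ?_
    rw [Real.sqrt_mul (by positivity), Real.sqrt_mul (by positivity),
      Real.sqrt_eq_rpow ((T / N) ^ (α / 2)), ← Real.rpow_mul hk.le,
      show α / 2 * (1 / 2) = α / 4 by ring]
    gcongr
    exact le_max_right _ _
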